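/- Let $R$ be a skew field (division ring) and $m\ge 0$ an integer; vector spaces are left $R$-modules. Take a finite collection of triangles and glue them edge-to-edge in an arbitrary way: the set of all sides of all triangles is partitioned into classes, and the sides of each class are identified with one another by compatible affine bijections (any number of sides, also several sides of one triangle, may be identified, with arbitrary matching of end points, but no side is identified with itself by the reversal). Deleting the vertices of the triangles we obtain a topological space $\mathcal S$ (possibly singular along the edges, possibly non-orientable) with a triangulation $\mathcal T$; the deleted vertices are called its punctures. A flag in an $m$-dimensional vector space $V$ is a filtration $V=\mathcal F^0\supset\mathcal F^1\supset\dots\supset\mathcal F^m=0$ with $\operatorname{codim}\mathcal F^i=i$. A triple of flags $(\mathcal A,\mathcal B,\mathcal C)$ in $V$ is generic if for all integers $a,b,c\ge 0$ with $a+b+c=m$ the natural map $V\to V/\mathcal A^a\oplus V/\mathcal B^b\oplus V/\mathcal C^c$ is an isomorphism. Let $\mathcal G_{\mathcal S}$ be the groupoid whose objects are local systems of $m$-dimensional $R$-vector spaces on $\mathcal S$ (functors from the fundamental groupoid of $\mathcal S$) equipped with a framing, that is, a flat section of the associated local system of flags over a union of small punctured neighbourhoods of the punctures (equivalently, for each puncture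 a flag in a fiber near it, invariant under the local monodromy), such that for each triangle of $\mathcal T$ the three flags near its vertices, transported inside the triangle to one point, form a generic triple. Morphisms are isomorphisms of local systems that preserve the framings. Let $\Gamma_m(\mathcal T)$ be the following bipartite graph (multiple edges allowed). Subdivide each triangle by its $m$-triangulation, which divides each side into $m$ equal segments and cuts the triangle into little triangles; the $\circ$-triangles are those having the same orientation as the big triangle (translates of it, scaled by $1/m$), and the $\bullet$-triangles are the other, inverted ones. The $\circ$-vertices of $\Gamma_m(\mathcal T)$ are the $\circ$-triangles of all triangles of $\mathcal T$. Its $\bullet$-vertices are the $\bullet$-triangles of all triangles of $\mathcal T$, together with the $m$ segments of every edge of $\mathcal T$ (matching segments of glued sides give the same $\bullet$-vertex). Every side of a $\circ$-triangle gives an edge, joining this $\circ$-triangle to the $\bullet$-triangle sharing the side or, if the side lies on the boundary of the big triangle, to the corresponding segment. A $1$-dimensional local system on a bipartite graph assigns a $1$-dimensional $R$-vector space to every vertex and an isomorphism between the spaces at the two ends to every edge; morphisms are collections of isomorphisms at the vertices, compatible with the edge isomorphisms. Then the groupoid $\mathcal G_{\mathcal S}$ is equivalent to the groupoid of $1$-dimensional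 $R$-local systems on $\Gamma_m(\mathcal T)$. -/

import Mathlib

open CategoryTheory

universe u

/-- Combinatorial data for gluing finitely many triangles edge-to-edge.  The vertices of a triangle
are numbered by `Fin 3`, its side `i` is the one opposite to the vertex `i`, with end points the
vertices `i + 1` and `i + 2` (mod 3).  The type `Edge` is the set of edges of the glued complex, and
`edge t i` is the edge to which the side `i` of `t` is glued.  Every edge is oriented; `flip t i`
records which end point of the side `i` of `t` is glued to the head of the edge.  Any number of sides
(also sides of the same triangle) may be glued to one edge, with arbitrary matching of end points. -/
structure GluedTriangles where
  Tri : Type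
  Edge : Type
  [finTri : Finite Tri]
  [finEdge : Finite Edge]
  edge : Tri → Fin 3 → Edge
  flip : Tri → Fin 3 → Bool
  edge_surjective : ∀ e, ∃ t i, edge t i = e

/-- The closed triangle with its three vertices deleted, in barycentric coordinates. -/
def PuncturedTriangle : Type :=
  {x : Fin 3 → ℝ // (∀ i, 0 ≤ x i) ∧ x 0 + x 1 + x 2 = 1 ∧ ∀ i, x i < 1}

instance : TopologicalSpace PuncturedTriangle :=
  inferInstanceAs (TopologicalSpace
    {x : Fin 3 → ℝ // (∀ i, 0 ≤ x i) ∧ x 0 + x 1 + x 2 = 1 ∧ ∀ i, x i < 1})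

namespace GluedTriangles

variable (S : GluedTriangles)

/-- The vertex of the triangle `t` that lies at the head of its side `i`. -/
def head (t : S.Tri) (i : Fin 3) : Fin 3 := if S.flip t i then i + 2 else i + 1

/-- The disjoint union of the triangles, with their vertices deleted. -/
abbrev Pieces : Type := Σ _ : S.Tri, PuncturedTriangle

/-- Two points are glued when they lie on sides glued to the same edge, at the same position. -/
def Glue (p q : S.Pieces) : Prop :=
  ∃ i j, p.2.1 i = 0 ∧ q.2.1 j = 0 ∧ S.edge p.1 i = S.edge q.1 j ∧
    p.2.1 (S.head p.1 i) = q.2.1 (S.head q.1 j)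

/-- The (possibly singular, possibly non-orientable) surface glued from the triangles, with all
vertices deleted; it carries the quotient topology. -/
def Surface : Type := Quot S.Glue

instance : TopologicalSpace S.Surface := inferInstanceAs (TopologicalSpace (Quot S.Glue))

/-- The canonical map from the triangle `t` to the surface. -/
def triMap (t : S.Tri) (x : PuncturedTriangle) : S.Surface := Quot.mk S.Glue ⟨t, x⟩

theorem continuous_triMap (t : S.Tri) : Continuous (S.triMap t) :=
  continuous_quot_mk.comp continuous_sigmaMk

/-- The union of the punctured neighbourhoods of the punctures (the deleted vertices): it consists of
the points of the triangles having one barycentric coordinate greater than `1/2`. -/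
def nearPunctures : Set S.Surface :=
  {s | ∃ t x i, s = S.triMap t x ∧ (1 / 2 : ℝ) < x.1 i}

theorem triMap_mem_nearPunctures (t : S.Tri) {x : PuncturedTriangle} {i : Fin 3}
    (h : (1 / 2 : ℝ) < x.1 i) : S.triMap t x ∈ S.nearPunctures :=
  ⟨t, x, i, rfl, h⟩

end GluedTriangles

section LinearAlgebra

variable (R : Type u) [DivisionRing R]

/-- A flag `V = F⁰ ⊃ F¹ ⊃ ⋯ ⊃ Fᵐ = 0` with `codim Fⁱ = i`. -/
structure FullFlag (V : Type*) [AddCommGroup V] [Module R V] (m : ℕ) where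
  space : Fin (m + 1) → Submodule R V
  antitone : Antitone space
  space_zero : space 0 = ⊤
  space_last : space (Fin.last m) = ⊥
  codim : ∀ i, Module.finrank R (V ⧸ space i) = i

/-- A triple of filtrations, indexed by `0, …, m`, is generic if for all `a + b + c = m` the natural
map `V → V / F₀ᵃ ⊕ V / F₁ᵇ ⊕ V / F₂ᶜ` is an isomorphism. -/
def GenericTriple {V : Type*} [AddCommGroup V] [Module R V] {m : ℕ}
    (F : Fin 3 → Fin (m + 1) → Submodule R V) : Prop :=
  ∀ a b c : Fin (m + 1), (a : ℕ) + b + c = m →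
    Function.Bijective
      ((F 0 a).mkQ.prod ((F 1 b).mkQ.prod (F 2 c).mkQ))

end LinearAlgebra

section FramedLocalSystems

/-- Parallel transport along a path, for a local system given as a functor on the fundamental
groupoid. -/
def transport {R : Type u} [DivisionRing R] {X : Type} [TopologicalSpace X]
    (L : FundamentalGroupoid X ⥤ ModuleCat.{u} R) {x y : X} (γ : Path x y) :
    L.obj ⟨x⟩ →ₗ[R] L.obj ⟨y⟩ :=
  (L.map (FundamentalGroupoid.fromPath (Path.Homotopic.Quotient.mk γ))).hom

/-- A local system of `m`-dimensional `R`-vector spaces on the surface, with a framing (a flat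
section, near the punctures, of the associated local system of flags) such that on each triangle the
three flags near its vertices, transported inside the triangle to one point, form a generic triple. -/
structure FramedLocalSystem (R : Type u) [DivisionRing R] (m : ℕ) (S : GluedTriangles) where
  sys : FundamentalGroupoid S.Surface ⥤ ModuleCat.{u} R
  finite : ∀ x, Module.Finite R (sys.obj x)
  finrank : ∀ x, Module.finrank R (sys.obj x) = m
  flag : ∀ x : S.Surface, x ∈ S.nearPunctures → FullFlag R (sys.obj ⟨x⟩) m
  flat : ∀ {x y : S.Surface} (hx : x ∈ S.nearPunctures) (hy : y ∈ S.nearPunctures) (γ : Path x y),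
    (∀ s, γ s ∈ S.nearPunctures) →
      ∀ i, ((flag x hx).space i).map (transport sys γ) = (flag y hy).space i
  generic : ∀ (t : S.Tri) (x : Fin 3 → PuncturedTriangle) (hx : ∀ i, (1 / 2 : ℝ) < (x i).1 i)
    (y : PuncturedTriangle) (γ : ∀ i, Path (x i) y),
      GenericTriple R fun i a =>
        ((flag (S.triMap t (x i)) (S.triMap_mem_nearPunctures t (hx i))).space a).map
          (transport sys ((γ i).map (S.continuous_triMap t)))

namespace FramedLocalSystem

variable {R : Type u} [DivisionRing R] {m : ℕ} {S : GluedTriangles}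

/-- An isomorphism of local systems that carries the framing of `X` to the framing of `Y`. -/
@[ext]
structure Hom (X Y : FramedLocalSystem R m S) where
  iso : X.sys ≅ Y.sys
  map_flag : ∀ x (hx : x ∈ S.nearPunctures) i,
    ((X.flag x hx).space i).map (iso.hom.app ⟨x⟩).hom = (Y.flag x hx).space i

noncomputable instance : Groupoid (FramedLocalSystem R m S) where
  Hom X Y := Hom X Y
  id X := ⟨Iso.refl _, fun x hx i => by
    change Submodule.map LinearMap.id _ = _
    exact Submodule.map_id _⟩
  comp f g := ⟨f.iso ≪≫ g.iso, fun x hx i => by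
    rw [← g.map_flag x hx i, ← f.map_flag x hx i, ← Submodule.map_comp]
    rfl⟩
  inv {X Y} f := ⟨f.iso.symm, fun x hx i => by
    rw [← f.map_flag x hx i, ← Submodule.map_comp]
    have h : ((f.iso.symm.hom.app ⟨x⟩).hom ∘ₗ (f.iso.hom.app ⟨x⟩).hom) = LinearMap.id := by
      have := f.iso.hom_inv_id_app ⟨x⟩
      exact congrArg ModuleCat.Hom.hom this
    rw [h, Submodule.map_id]⟩
  id_comp f := Hom.ext (Iso.refl_trans _)
  comp_id f := Hom.ext (Iso.trans_refl _)
  assoc f g h := Hom.ext (Iso.trans_assoc _ _ _)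
  inv_comp f := Hom.ext (Iso.symm_self_id _)
  comp_inv f := Hom.ext (Iso.self_symm_id _)

end FramedLocalSystem

end FramedLocalSystems

section BipartiteGraphs

/-- A bipartite graph; multiple edges are allowed. -/
structure BipartiteGraph where
  White : Type
  Black : Type
  Edge : Type
  white : Edge → White
  black : Edge → Black

/-- A one-dimensional local system (flat line bundle) on a bipartite graph: a line for every vertex
and, for every edge, an isomorphism between the lines at its ends. -/
structure LineSystem (R : Type u) [DivisionRing R] (G : BipartiteGraph) where
  atWhite : G.White → ModuleCat.{u} R
  atBlack : G.Black → ModuleCat.{u} R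
  finrank_white : ∀ w, Module.finrank R (atWhite w) = 1
  finrank_black : ∀ b, Module.finrank R (atBlack b) = 1
  along : ∀ e, atWhite (G.white e) ≅ atBlack (G.black e)

namespace LineSystem

variable {R : Type u} [DivisionRing R] {G : BipartiteGraph}

/-- An isomorphism of one-dimensional local systems on a bipartite graph. -/
@[ext]
structure Hom (X Y : LineSystem R G) where
  onWhite : ∀ w, X.atWhite w ≅ Y.atWhite w
  onBlack : ∀ b, X.atBlack b ≅ Y.atBlack b
  comm : ∀ e, (X.along e).hom ≫ (onBlack (G.black e)).hom =
    (onWhite (G.white e)).hom ≫ (Y.along e).hom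

instance : Groupoid (LineSystem R G) where
  Hom X Y := Hom X Y
  id X := ⟨fun _ => Iso.refl _, fun _ => Iso.refl _, fun e => by simp⟩
  comp f g := ⟨fun w => f.onWhite w ≪≫ g.onWhite w, fun b => f.onBlack b ≪≫ g.onBlack b, fun e => by
    have h₁ := f.comm e
    have h₂ := g.comm e
    simp only [Iso.trans_hom, Category.assoc]
    rw [← h₂, reassoc_of% h₁]⟩
  inv f := ⟨fun w => (f.onWhite w).symm, fun b => (f.onBlack b).symm, fun e => by
    have h := f.comm e
    simp only [Iso.symm_hom]
    rw [Iso.comp_inv_eq, Category.assoc, h, Iso.inv_hom_id_assoc]⟩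
  id_comp f := by apply Hom.ext <;> funext <;> simp
  comp_id f := by apply Hom.ext <;> funext <;> simp
  assoc f g h := by apply Hom.ext <;> funext <;> simp
  inv_comp f := by apply Hom.ext <;> funext <;> simp
  comp_inv f := by apply Hom.ext <;> funext <;> simp

end LineSystem

end BipartiteGraphs

namespace GluedTriangles

/-- The `∘`-triangles of the `m`-triangulation of a triangle: the lattice points of the
`m`-triangulation are the `v : Fin 3 → ℕ` with sum `m`, and `p` stands for the little triangle with
vertices `p + e₀`, `p + e₁`, `p + e₂`. -/
abbrev WhiteCell (m : ℕ) : Type := {p : Fin 3 → ℕ // p 0 + p 1 + p 2 + 1 = m}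

/-- The `•`-triangles of the `m`-triangulation of a triangle: `q` stands for the little triangle with
vertices `q + e₁ + e₂`, `q + e₀ + e₂`, `q + e₀ + e₁`. -/
abbrev BlackCell (m : ℕ) : Type := {q : Fin 3 → ℕ // q 0 + q 1 + q 2 + 2 = m}

/-- The `∘`-triangle `q + eᵢ`, which shares a side with the `•`-triangle `q`. -/
def BlackCell.neighbor {m : ℕ} (q : BlackCell m) (i : Fin 3) : WhiteCell m :=
  ⟨q.1 + Pi.single i 1, by
    have h := q.2
    fin_cases i <;> simp <;> omega⟩

variable (S : GluedTriangles)

theorem whiteCell_lt {m : ℕ} (p : WhiteCell m) (j : Fin 3) : p.1 j < m := by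
  have h := p.2
  fin_cases j <;> simp <;> omega

/-- The bipartite graph glued from one copy, for every triangle, of the dual graph of the
`m`-triangulation.  The `∘`-vertices are the `∘`-triangles.  The `•`-vertices are the `•`-triangles
inside the triangles, and the `m` segments of every edge of the surface (the black vertices on glued
sides are identified), numbered from the tail of the edge to its head.  There is a graph edge for
every common side of a `•`-triangle and a `∘`-triangle, and one for every side of a `∘`-triangle that
lies on a side of its big triangle. -/
def bipartiteGraph (m : ℕ) : BipartiteGraph where
  White := S.Tri × WhiteCell m
  Black := (S.Tri × BlackCell m) ⊕ (S.Edge × Fin m)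
  Edge := (S.Tri × BlackCell m × Fin 3) ⊕
    (S.Tri × {z : WhiteCell m × Fin 3 // z.1.1 z.2 = 0})
  white := Sum.elim (fun a => (a.1, a.2.1.neighbor a.2.2)) (fun a => (a.1, a.2.1.1))
  black := Sum.elim (fun a => Sum.inl (a.1, a.2.1))
    (fun a => Sum.inr (S.edge a.1 a.2.1.2,
      ⟨a.2.1.1.1 (S.head a.1 a.2.1.2), whiteCell_lt a.2.1.1 _⟩))

end GluedTriangles

/-! The equivalence is a composite of two, through the finite linear data of a `FlagComplex`.

Topology. Punctured triangles and open edges are simply connected, so a local system is determined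
by its fibres at the barycentres and at the midpoints of the edges, together with the transports
from each barycentre to the midpoints of its sides. The framing becomes three flags for every
triangle and two for every edge. The functor `restriction` is faithful because every point is joined
to a barycentre inside a triangle. It is full because the surface is covered by interiors of
triangles and stars of edges, both contracted along segments inside triangles; hence naturality
needs to be checked only on paths inside triangles (`path_property`). It is essentially surjective
because the gluing isomorphisms define a bundle with discrete fibre, that is a covering, whose
monodromy is the required local system (`gluedBundle`, `gluedSystem`).

Linear algebra. For a generic triple codimensions add (`finrank_flagInf`): the intersection of the
subspaces of codimensions a, b, c has dimension m - a - b - c. Sum m - 1 gives a line for every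
∘-triangle. Sum m - 2 gives, for every •-triangle, a plane containing the lines of its three
neighbours, pairwise distinct; the relations between these lines form a line that projects
isomorphically onto each of them. Along a side the third flag has index 0 and drops out: the lines
there are the decomposition attached to two opposite flags, and they determine both flags. Gluing
matches these decompositions. This is the functor `lines`.

Conversely, the lines of one side yield a basis, and the relations at the •-triangles determine the
remaining lines row by row. Hence `lines` is full and faithful (`exists_equiv_tri`). For essential
surjectivity, choose generators of all lines; the local system becomes a family of nonzero scalars.
Starting from the standard basis on one side and imposing the prescribed relations, one gets rows of
vectors of triangular shape, which forces the three flags to be generic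
(`exists_generic_relations`). The scalars at the segments are absorbed in the gluing maps. -/

open scoped unitInterval
open Topology

/-! ### Convex geometry of the punctured triangle -/

namespace PuncturedTriangle

theorem convex_coordinates :
    Convex ℝ {x : Fin 3 → ℝ | (∀ i, 0 ≤ x i) ∧ x 0 + x 1 + x 2 = 1 ∧ ∀ i, x i < 1} := by
  rintro x ⟨hx, hx1, hx'⟩ y ⟨hy, hy1, hy'⟩ a b ha hb hab
  refine ⟨fun i => ?_, ?_, fun i => ?_⟩
  · have := mul_nonneg ha (hx i)
    have := mul_nonneg hb (hy i)
    simp only [Pi.add_apply, Pi.smul_apply, smul_eq_mul]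
    linarith
  · simp only [Pi.add_apply, Pi.smul_apply, smul_eq_mul]
    linear_combination a * hx1 + b * hy1 + hab
  · exact convex_Iio (1 : ℝ) (hx' i) (hy' i) ha hb hab

theorem continuous_coord (i : Fin 3) : Continuous fun x : PuncturedTriangle => x.1 i :=
  (continuous_apply i).comp continuous_subtype_val

/-- The barycentre. -/
noncomputable def center : PuncturedTriangle :=
  ⟨fun _ => 1 / 3, fun _ => by norm_num, by norm_num, fun _ => by norm_num⟩

/-- A point near the vertex `i`. -/
noncomputable def corner (i : Fin 3) : PuncturedTriangle :=
  ⟨fun k => if k = i then 3 / 4 else 1 / 8, fun k => by dsimp only; split_ifs <;> norm_num,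
    by fin_cases i <;> norm_num [Fin.ext_iff], fun k => by dsimp only; split_ifs <;> norm_num⟩

theorem half_lt_corner (i : Fin 3) : (1 / 2 : ℝ) < (corner i).1 i := by
  simp [corner]; norm_num

instance : SimplyConnectedSpace PuncturedTriangle := by
  have : ContractibleSpace
      {x : Fin 3 → ℝ | (∀ i, 0 ≤ x i) ∧ x 0 + x 1 + x 2 = 1 ∧ ∀ i, x i < 1} :=
    convex_coordinates.contractibleSpace ⟨center.1, center.2⟩
  exact SimplyConnectedSpace.ofContractible
    {x : Fin 3 → ℝ | (∀ i, 0 ≤ x i) ∧ x 0 + x 1 + x 2 = 1 ∧ ∀ i, x i < 1}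

/-- The point that divides the segment from `a` to `b` in the ratio `s : 1 - s`. -/
def combo (a b : PuncturedTriangle) (s : I) : PuncturedTriangle :=
  ⟨(1 - (s : ℝ)) • a.1 + (s : ℝ) • b.1,
    convex_coordinates a.2 b.2 (sub_nonneg.2 s.2.2) s.2.1 (sub_add_cancel _ _)⟩

theorem combo_apply (a b : PuncturedTriangle) (s : I) (i : Fin 3) :
    (combo a b s).1 i = (1 - (s : ℝ)) * a.1 i + s * b.1 i := rfl

theorem combo_zero (a b : PuncturedTriangle) : combo a b 0 = a :=
  Subtype.ext (by simp [combo])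

theorem combo_one (a b : PuncturedTriangle) : combo a b 1 = b :=
  Subtype.ext (by simp [combo])

theorem continuous_combo :
    Continuous fun p : PuncturedTriangle × PuncturedTriangle × I => combo p.1 p.2.1 p.2.2 := by
  refine Continuous.subtype_mk ?_ _
  have h₁ : Continuous fun p : PuncturedTriangle × PuncturedTriangle × I => p.1.1 :=
    continuous_subtype_val.comp continuous_fst
  have h₂ : Continuous fun p : PuncturedTriangle × PuncturedTriangle × I => p.2.1.1 :=
    continuous_subtype_val.comp (continuous_fst.comp continuous_snd)
  have h₃ : Continuous fun p : PuncturedTriangle × PuncturedTriangle × I => (p.2.2 : ℝ) :=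
    continuous_subtype_val.comp (continuous_snd.comp continuous_snd)
  exact ((continuous_const.sub h₃).smul h₁).add (h₃.smul h₂)

theorem sum_coord (x : PuncturedTriangle) {i j k : Fin 3} (hij : i ≠ j) (hik : i ≠ k)
    (hjk : j ≠ k) : x.1 i + x.1 j + x.1 k = 1 := by
  have h := x.2.2.1
  fin_cases i <;> fin_cases j <;> fin_cases k <;> simp at hij hik hjk ⊢ <;> linarith

/-- The other two coordinates add up to 1, and each is less than 1 because the vertices are deleted.
Consequently a point lies on at most one side. -/
theorem pos_of_ne {x : PuncturedTriangle} {i j : Fin 3} (hi : x.1 i = 0) (hj : j ≠ i) :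
    0 < x.1 j := by
  obtain ⟨k, hki, hkj⟩ : ∃ k : Fin 3, k ≠ i ∧ k ≠ j := by
    clear * -
    decide +revert
  have h := sum_coord x hj hkj.symm hki.symm
  have := x.2.2.2 k
  linarith

theorem eq_of_zero {x : PuncturedTriangle} {i j : Fin 3} (hi : x.1 i = 0) (hj : x.1 j = 0) :
    j = i := by
  by_contra h
  exact (pos_of_ne hi h).ne' hj

theorem eq_of_half_lt {x : PuncturedTriangle} {i j : Fin 3} (hi : 1 / 2 < x.1 i)
    (hj : 1 / 2 < x.1 j) : i = j := by
  by_contra h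
  obtain ⟨k, hki, hkj⟩ : ∃ k : Fin 3, k ≠ i ∧ k ≠ j := by
    clear * -
    decide +revert
  have h := sum_coord x h hki.symm hkj.symm
  have := x.2.1 k
  linarith

/-- Keeps the region nearest to a side stable under the segments that contract the star of an edge.
-/
theorem combo_lt {x y : PuncturedTriangle} {i j : Fin 3} (hx : x.1 i < x.1 j)
    (hy : y.1 i < y.1 j) (s : I) : (combo x y s).1 i < (combo x y s).1 j := by
  rw [combo_apply, combo_apply]
  rcases eq_or_lt_of_le s.2.2 with h | h
  · rw [h]; simpa using hy
  · have := mul_lt_mul_of_pos_left hx (sub_pos.2 h)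
    have := mul_le_mul_of_nonneg_left hy.le s.2.1
    linarith

theorem lt_combo {x y : PuncturedTriangle} {c : ℝ} {i : Fin 3} (hx : c < x.1 i)
    (hy : c < y.1 i) (s : I) : c < (combo x y s).1 i :=
  convex_Ioi c hx hy (sub_nonneg.2 s.2.2) s.2.1 (sub_add_cancel _ _)

theorem isOpen_nearest (i : Fin 3) :
    IsOpen {x : PuncturedTriangle | ∀ k, k ≠ i → x.1 i < x.1 k} := by
  simp only [Set.ofPred_forall]
  exact isOpen_iInter_of_finite fun k => isOpen_iInter_of_finite fun _ =>
    isOpen_lt (continuous_coord i) (continuous_coord k)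

theorem isOpen_interior : IsOpen {x : PuncturedTriangle | ∀ k, 0 < x.1 k} := by
  simp only [Set.ofPred_forall]
  exact isOpen_iInter_of_finite fun k => isOpen_lt continuous_const (continuous_coord k)

end PuncturedTriangle

/-! ### Sides, edges and the gluing relation -/

open PuncturedTriangle

/-- The parameters along an edge: the coordinate at the head. -/
abbrev EdgeParam : Type := Set.Ioo (0 : ℝ) 1

instance : SimplyConnectedSpace EdgeParam := by
  have : ContractibleSpace EdgeParam :=
    (convex_Ioo (0 : ℝ) 1).contractibleSpace ⟨1 / 2, by norm_num⟩
  infer_instance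

/-- The middle of an edge. -/
noncomputable def EdgeParam.mid : EdgeParam := ⟨1 / 2, by norm_num⟩

/-- A parameter close to the head of an edge. -/
noncomputable def EdgeParam.nearHead : EdgeParam := ⟨3 / 4, by norm_num⟩

/-- A parameter close to the tail of an edge. -/
noncomputable def EdgeParam.nearTail : EdgeParam := ⟨1 / 4, by norm_num⟩

namespace GluedTriangles

variable (S : GluedTriangles)

/-- The vertex of the triangle `t` that lies at the tail of its side `i`. -/
def tail (t : S.Tri) (i : Fin 3) : Fin 3 := if S.flip t i then i + 1 else i + 2

theorem head_ne (t : S.Tri) (i : Fin 3) : S.head t i ≠ i := by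
  unfold head; split_ifs <;> clear * - <;> decide +revert

theorem tail_ne (t : S.Tri) (i : Fin 3) : S.tail t i ≠ i := by
  unfold tail; split_ifs <;> clear * - <;> decide +revert

theorem head_ne_tail (t : S.Tri) (i : Fin 3) : S.head t i ≠ S.tail t i := by
  unfold head tail; split_ifs <;> clear * - <;> decide +revert

theorem eq_head_or_eq_tail (t : S.Tri) {i k : Fin 3} (h : k ≠ i) :
    k = S.head t i ∨ k = S.tail t i := by
  unfold head tail; split_ifs <;> clear * - h <;> decide +revert

theorem side_sum (t : S.Tri) (i : Fin 3) (x : PuncturedTriangle) :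
    x.1 i + x.1 (S.head t i) + x.1 (S.tail t i) = 1 :=
  sum_coord x (S.head_ne t i).symm (S.tail_ne t i).symm (S.head_ne_tail t i)

/-- The point of the side `i` of the triangle `t` having coordinate `u` at the head. -/
noncomputable def sidePt (t : S.Tri) (i : Fin 3) (u : EdgeParam) : PuncturedTriangle :=
  ⟨fun k => if k = i then 0 else if k = S.head t i then u else 1 - u,
    fun k => by have := u.2.1; have := u.2.2; dsimp only; split_ifs <;> linarith,
    by
      have h := S.head_ne t i
      generalize S.head t i = j at h
      fin_cases i <;> fin_cases j <;> simp [Fin.ext_iff] at h ⊢,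
    fun k => by have := u.2.1; have := u.2.2; dsimp only; split_ifs <;> linarith⟩

theorem sidePt_self (t : S.Tri) (i : Fin 3) (u : EdgeParam) : (S.sidePt t i u).1 i = 0 := by
  simp [sidePt]

theorem sidePt_head (t : S.Tri) (i : Fin 3) (u : EdgeParam) :
    (S.sidePt t i u).1 (S.head t i) = u := by
  simp [sidePt, S.head_ne t i]

theorem sidePt_tail (t : S.Tri) (i : Fin 3) (u : EdgeParam) :
    (S.sidePt t i u).1 (S.tail t i) = 1 - u := by
  simp [sidePt, S.tail_ne t i, (S.head_ne_tail t i).symm]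

theorem continuous_sidePt (t : S.Tri) (i : Fin 3) : Continuous (S.sidePt t i) := by
  refine Continuous.subtype_mk (continuous_pi fun k => ?_) _
  have h : Continuous fun u : EdgeParam => (u : ℝ) := continuous_subtype_val
  split_ifs
  · exact continuous_const
  · exact h
  · exact continuous_const.sub h

theorem ext_side {t : S.Tri} {i : Fin 3} {x y : PuncturedTriangle} (hx : x.1 i = 0)
    (hy : y.1 i = 0) (h : x.1 (S.head t i) = y.1 (S.head t i)) : x = y := by
  refine Subtype.ext (funext fun k => ?_)
  by_cases hk : k = i
  · rw [hk, hx, hy]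
  · rcases S.eq_head_or_eq_tail t hk with rfl | rfl
    · exact h
    · have := S.side_sum t i x
      have := S.side_sum t i y
      linarith

theorem exists_sidePt (t : S.Tri) {i : Fin 3} {x : PuncturedTriangle} (hx : x.1 i = 0) :
    ∃ u, x = S.sidePt t i u :=
  ⟨⟨x.1 (S.head t i), pos_of_ne hx (S.head_ne t i), x.2.2.2 _⟩,
    S.ext_side hx (S.sidePt_self t i _)
      (S.sidePt_head t i ⟨x.1 (S.head t i), pos_of_ne hx (S.head_ne t i), x.2.2.2 _⟩).symm⟩

variable {S} in
theorem Glue.symm {p q : S.Pieces} (h : S.Glue p q) : S.Glue q p := by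
  obtain ⟨i, j, hi, hj, he, h⟩ := h
  exact ⟨j, i, hj, hi, he.symm, h.symm⟩

-- The middle point lies on only one side, so the two gluings meet on that side and compose.
variable {S} in
theorem Glue.trans {p q r : S.Pieces} (h : S.Glue p q) (h' : S.Glue q r) : S.Glue p r := by
  obtain ⟨i, j, hi, hj, he, h⟩ := h
  obtain ⟨j', k, hj', hk, he', h'⟩ := h'
  obtain rfl := eq_of_zero hj hj'
  exact ⟨i, k, hi, hk, he.trans he', h.trans h'⟩

/-- The canonical map from the disjoint union of the triangles to the surface. -/
def proj (p : S.Pieces) : S.Surface := Quot.mk S.Glue p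

theorem isQuotientMap_proj : IsQuotientMap S.proj := isQuotientMap_quot_mk

/-- Gluing is symmetric and transitive, and lacks only reflexivity at interior points; so adjoining
equality already gives the generated equivalence relation. -/
theorem proj_eq_iff {p q : S.Pieces} : S.proj p = S.proj q ↔ p = q ∨ S.Glue p q := by
  constructor
  · intro h
    have h' : Relation.EqvGen S.Glue p q := Quot.eqvGen_exact h
    clear h
    induction h' with
    | rel _ _ h => exact Or.inr h
    | refl _ => exact Or.inl rfl
    | symm _ _ _ ih =>
      rcases ih with h | h
      exacts [Or.inl h.symm, Or.inr h.symm]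
    | trans _ _ _ _ _ ih₁ ih₂ =>
      rcases ih₁ with rfl | h
      · exact ih₂
      · rcases ih₂ with rfl | h'
        exacts [Or.inr h, Or.inr (h.trans h')]
  · rintro (rfl | h)
    exacts [rfl, Quot.sound h]

theorem triMap_sidePt {t t' : S.Tri} {i i' : Fin 3} (h : S.edge t i = S.edge t' i')
    (u : EdgeParam) : S.triMap t (S.sidePt t i u) = S.triMap t' (S.sidePt t' i' u) :=
  Quot.sound ⟨i, i', S.sidePt_self t i u, S.sidePt_self t' i' u, h,
    (S.sidePt_head t i u).trans (S.sidePt_head t' i' u).symm⟩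

/-- The parametrization of an edge by the coordinate at its head. -/
noncomputable def edgeMap (e : S.Edge) : C(EdgeParam, S.Surface) where
  toFun u := S.triMap (S.edge_surjective e).choose
    (S.sidePt (S.edge_surjective e).choose (S.edge_surjective e).choose_spec.choose u)
  continuous_toFun := (S.continuous_triMap _).comp (S.continuous_sidePt _ _)

/-- The parametrization of a side of a triangle, as a curve in the surface. -/
noncomputable def sideMap (t : S.Tri) (i : Fin 3) : C(EdgeParam, S.Surface) where
  toFun u := S.triMap t (S.sidePt t i u)
  continuous_toFun := (S.continuous_triMap _).comp (S.continuous_sidePt _ _)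

theorem edgeMap_edge (t : S.Tri) (i : Fin 3) : S.edgeMap (S.edge t i) = S.sideMap t i :=
  ContinuousMap.ext fun u =>
    S.triMap_sidePt (S.edge_surjective (S.edge t i)).choose_spec.choose_spec u

/-! ### Reduction of properties of paths to an open cover -/

section Charts

variable {S}

/-- Let `U` be an open subset of the surface that is contracted to a point by segments inside the
triangles.  A property of paths that is invariant under homotopy and concatenation, and that holds
for the contracting segments, holds for all paths in `U`. -/
theorem path_property_of_contraction
    {P : ∀ {x y : S.Surface}, Path x y → Prop}
    (hom : ∀ {x y : S.Surface} {γ δ : Path x y}, γ.Homotopic δ → P γ → P δ)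
    (trans : ∀ {x y z : S.Surface} {γ : Path x y} {δ : Path y z}, P γ → P δ → P (γ.trans δ))
    {D : Set S.Pieces} (hD : IsOpen D) (sat : ∀ p q, S.Glue p q → p ∈ D → q ∈ D)
    {z : S.Pieces → PuncturedTriangle} (hz : ContinuousOn z D)
    (hmem : ∀ p ∈ D, ∀ s, (⟨p.1, combo p.2 (z p) s⟩ : S.Pieces) ∈ D)
    (hglue : ∀ p ∈ D, ∀ q ∈ D, S.Glue p q → ∀ s,
      S.triMap p.1 (combo p.2 (z p) s) = S.triMap q.1 (combo q.2 (z q) s))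
    (hcenter : ∀ p ∈ D, ∀ q ∈ D, S.triMap p.1 (z p) = S.triMap q.1 (z q))
    (hseg : ∀ p ∈ D, ∀ {x y : S.Surface} (δ : Path x y),
      (∀ s, δ s = S.triMap p.1 (combo p.2 (z p) s)) → P δ ∧ P δ.symm)
    {x y : S.Surface} (γ : Path x y) (hγ : ∀ s, γ s ∈ S.proj '' D) : P γ := by
  set U : Set S.Surface := S.proj '' D with hU
  have hpre : S.proj ⁻¹' U = D := by
    ext q
    constructor
    · rintro ⟨p, hp, h⟩
      rcases S.proj_eq_iff.1 h with rfl | h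
      exacts [hp, sat _ _ h hp]
    · exact fun h => ⟨q, h, rfl⟩
  have hq : IsQuotientMap S.proj := S.isQuotientMap_proj
  have hUo : IsOpen U := by rw [← hq.isOpen_preimage, hpre]; exact hD
  have hqU := hq.restrictPreimage_isOpen hUo
  have hmem' : ∀ p : S.proj ⁻¹' U, p.1 ∈ D := fun p => hpre ▸ p.2
  have hind : ∀ p ∈ D, ∀ q ∈ D, S.proj p = S.proj q → ∀ s,
      S.triMap p.1 (combo p.2 (z p) s) = S.triMap q.1 (combo q.2 (z q) s) := by
    intro p hp q hq h s
    rcases S.proj_eq_iff.1 h with rfl | h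
    exacts [rfl, hglue p hp q hq h s]
  -- The contraction is defined through an arbitrary representative in `D`; `hind` makes it
  -- independent of the choice.
  let K : U × I → U := fun a => ⟨S.triMap a.1.2.choose.1
    (combo a.1.2.choose.2 (z a.1.2.choose) a.2), _, hmem _ a.1.2.choose_spec.1 _, rfl⟩
  have hK : ∀ p (hp : p ∈ D) s,
      (K (⟨S.proj p, p, hp, rfl⟩, s) : S.Surface) =
        S.triMap p.1 (combo p.2 (z p) s) := fun p hp s => by
    have h : S.proj p ∈ U := ⟨p, hp, rfl⟩
    exact hind _ h.choose_spec.1 p hp h.choose_spec.2 s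
  have hKc : Continuous K := by
    -- As `I` is locally compact, the product of a quotient map with `I` is again a quotient map,
    -- and continuity can be tested before gluing.
    refine hqU.continuous_lift_prod_left (Continuous.subtype_mk ?_ _)
    have hz' : Continuous fun p : S.proj ⁻¹' U => z p.1 :=
      continuousOn_iff_continuous_domRestrict.1 (hpre ▸ hz)
    have h : Continuous fun a : (S.proj ⁻¹' U) × I =>
        (S.proj (⟨a.1.1.1, combo a.1.1.2 (z a.1.1) a.2⟩ : S.Pieces) : S.Surface) := by
      have h₁ : Continuous fun a : S.Pieces × PuncturedTriangle × I =>
          (⟨a.1.1, combo a.1.2 a.2.1 a.2.2⟩ : S.Pieces) := by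
        have : Continuous fun a : (PuncturedTriangle × I) × S.Pieces =>
            (⟨a.2.1, combo a.2.2 a.1.1 a.1.2⟩ : S.Pieces) := by
          rw [continuous_def]
          intro V hV
          rw [isOpen_iff_mem_nhds]
          rintro ⟨⟨b, s⟩, ⟨t, a⟩⟩ hm
          have hc : Continuous fun c : (PuncturedTriangle × I) × PuncturedTriangle =>
              (⟨t, combo c.2 c.1.1 c.1.2⟩ : S.Pieces) :=
            continuous_sigmaMk.comp (continuous_combo.comp
              (continuous_snd.prodMk continuous_fst))
          -- Continuity on the disjoint union is local, and the copy of each triangle is open in it.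
          have hemb : IsOpenEmbedding fun c : (PuncturedTriangle × I) × PuncturedTriangle =>
              ((c.1, ⟨t, c.2⟩) : (PuncturedTriangle × I) × S.Pieces) :=
            IsOpenEmbedding.prodMap IsOpenEmbedding.id IsOpenEmbedding.sigmaMk
          have := hemb.map_nhds_eq ((b, s), a)
          rw [← this]
          exact hc.continuousAt.preimage_mem_nhds (hV.mem_nhds hm)
        exact this.comp (continuous_snd.prodMk continuous_fst)
      exact S.isQuotientMap_proj.continuous.comp (h₁.comp
        ((continuous_subtype_val.comp continuous_fst).prodMk
          ((hz'.comp continuous_fst).prodMk continuous_snd)))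
    refine h.congr fun a => ?_
    exact (hK a.1.1 (hmem' a.1) a.2).symm
  obtain ⟨p₀, hp₀, hx⟩ : γ 0 ∈ U := hγ 0
  have hc : S.triMap p₀.1 (z p₀) ∈ U :=
    ⟨_, by simpa only [combo_one] using hmem p₀ hp₀ 1, rfl⟩
  let H : (ContinuousMap.id U).Homotopy (ContinuousMap.const U ⟨_, hc⟩) :=
    { toFun := fun a => K (a.2, a.1)
      continuous_toFun := hKc.comp continuous_swap
      map_zero_left := by
        rintro ⟨_, p, hp, rfl⟩
        apply Subtype.ext
        rw [hK p hp, combo_zero]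
        rfl
      map_one_left := by
        rintro ⟨_, p, hp, rfl⟩
        apply Subtype.ext
        rw [hK p hp, combo_one]
        exact hcenter p hp p₀ hp₀ }
  have : ContractibleSpace U := (contractible_iff_id_nullhomotopic U).2 ⟨_, ⟨H⟩⟩
  have hPH : ∀ w : U, P ((H.evalAt w).map continuous_subtype_val) ∧
      P ((H.evalAt w).map continuous_subtype_val).symm := by
    rintro ⟨_, p, hp, rfl⟩
    refine hseg p hp _ fun s => ?_
    exact hK p hp s
  have hx' : x ∈ U := γ.source ▸ hγ 0
  have hy' : y ∈ U := γ.target ▸ hγ 1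
  let γ' : Path (⟨x, hx'⟩ : U) ⟨y, hy'⟩ :=
    { toFun := fun s => ⟨γ s, hγ s⟩
      continuous_toFun := γ.continuous.subtype_mk _
      source' := Subtype.ext γ.source
      target' := Subtype.ext γ.target }
  -- Since `U` is contractible, the path is homotopic to the contracting track of its source
  -- followed by the reversed track of its target.
  have hhom := SimplyConnectedSpace.paths_homotopic
    ((H.evalAt ⟨x, hx'⟩).trans (H.evalAt ⟨y, hy'⟩).symm) γ'
  have h₂ := hhom.map (⟨Subtype.val, continuous_subtype_val⟩ : C(U, S.Surface))
  refine hom h₂ ?_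
  erw [Path.map_trans]
  exact trans (hPH ⟨x, hx'⟩).1 (hPH ⟨y, hy'⟩).2

/-- A property of paths that is invariant under homotopy and concatenation holds for a path as soon
as it holds for all paths that lie in a member of an open cover. -/
theorem path_property_of_cover {X : Type*} [TopologicalSpace X]
    {P : ∀ {x y : X}, Path x y → Prop}
    (hom : ∀ {x y : X} {γ δ : Path x y}, γ.Homotopic δ → P γ → P δ)
    (trans : ∀ {x y z : X} {γ : Path x y} {δ : Path y z}, P γ → P δ → P (γ.trans δ))
    {ι : Type*} {U : ι → Set X} (hU : ∀ i, IsOpen (U i))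
    (hP : ∀ i {x y : X} (γ : Path x y), (∀ s, γ s ∈ U i) → P γ)
    {x y : X} (γ : Path x y) (hγ : ∀ s, ∃ i, γ s ∈ U i) : P γ := by
  -- Lebesgue number argument: finitely many subpaths, each inside one member of the cover, are then
  -- concatenated.
  obtain ⟨t, t0, tm, ⟨n, hn⟩, ht⟩ := exists_monotone_Icc_subset_open_cover_unitInterval
    (c := fun i => γ ⁻¹' U i) (fun i => (hU i).preimage γ.continuous)
    (fun s _ => Set.mem_iUnion.2 (hγ s))
  have hsub : ∀ a b i, a ≤ b → Set.Icc a b ⊆ γ ⁻¹' U i → P (γ.subpath a b) := by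
    intro a b i hab h
    refine hP i _ fun s => ?_
    have : γ.subpath a b s ∈ γ '' Set.Icc a b := by
      rw [← Path.range_subpath_of_le γ a b hab]; exact ⟨s, rfl⟩
    obtain ⟨r, hr, h'⟩ := this
    rw [← h']
    exact h hr
  have key : ∀ k, P (γ.subpath (t 0) (t k)) := by
    intro k
    induction k with
    | zero =>
      obtain ⟨i, hi⟩ := ht 0
      exact hsub _ _ i le_rfl fun s hs => hi ⟨hs.1, hs.2.trans (tm (Nat.zero_le 1))⟩
    | succ k ih =>
      obtain ⟨i, hi⟩ := ht k
      exact hom ⟨Path.Homotopy.subpathTransSubpath γ _ _ _⟩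
        (trans ih (hsub _ _ i (tm k.le_succ) hi))
  have hcast : ∀ {x y x' y' : X} (δ : Path x y) (hx : x' = x) (hy : y' = y),
      P (δ.cast hx hy) → P δ := by
    rintro x y _ _ δ rfl rfl h
    exact h
  have h := key n
  rw [t0, hn n le_rfl, Path.subpath_zero_one] at h
  exact hcast _ _ _ h

end Charts

end GluedTriangles

open PuncturedTriangle

namespace PuncturedTriangle

/-- The segment from `a` to `b`. -/
def segment (a b : PuncturedTriangle) : Path a b where
  toFun := combo a b
  continuous_toFun := continuous_combo.comp
    (continuous_const.prodMk (continuous_const.prodMk continuous_id))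
  source' := combo_zero a b
  target' := combo_one a b

theorem eq_of_nearest {x : PuncturedTriangle} {i j : Fin 3} (hi : ∀ k, k ≠ i → x.1 i < x.1 k)
    (hj : ∀ k, k ≠ j → x.1 j < x.1 k) : i = j := by
  by_contra h
  exact lt_asymm (hi j (Ne.symm h)) (hj i h)

theorem nearest_of_zero {x : PuncturedTriangle} {i : Fin 3} (hi : x.1 i = 0) (k : Fin 3)
    (hk : k ≠ i) : x.1 i < x.1 k := by rw [hi]; exact pos_of_ne hi hk

theorem exists_zero_of_not_interior {x : PuncturedTriangle} (h : ¬ ∀ k, 0 < x.1 k) :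
    ∃ i, x.1 i = 0 := by
  push Not at h
  obtain ⟨i, hi⟩ := h
  exact ⟨i, le_antisymm hi (x.2.1 i)⟩

end PuncturedTriangle

/-! ### Charts of the surface: interiors of triangles and stars of edges -/

namespace GluedTriangles

variable {S : GluedTriangles}

/-- The points of the interior of the triangle `t` with coordinates in `Q`. -/
def interiorChart (t : S.Tri) (Q : Set (Fin 3 → ℝ)) : Set S.Pieces :=
  {p | p.1 = t ∧ (∀ k, 0 < p.2.1 k) ∧ p.2.1 ∈ Q}

/-- The points that are nearest to a side glued to the edge `e` and whose coordinates at the head and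
the tail of this side are in `Q`. -/
def starChart (e : S.Edge) (Q : Set (ℝ × ℝ)) : Set S.Pieces :=
  {p | ∃ i, S.edge p.1 i = e ∧ (∀ k, k ≠ i → p.2.1 i < p.2.1 k) ∧
    (p.2.1 (S.head p.1 i), p.2.1 (S.tail p.1 i)) ∈ Q}

theorem isOpen_interiorChart (t : S.Tri) {Q : Set (Fin 3 → ℝ)} (hQ : IsOpen Q) :
    IsOpen (interiorChart t Q) := by
  have h : interiorChart t Q = Sigma.mk t '' {x | (∀ k, 0 < x.1 k) ∧ x.1 ∈ Q} := by
    ext ⟨t', x⟩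
    constructor
    · rintro ⟨rfl, h⟩
      exact ⟨x, h, rfl⟩
    · rintro ⟨x, h, ⟨⟩⟩
      exact ⟨rfl, h⟩
  rw [h]
  exact isOpenMap_sigmaMk _ (isOpen_interior.inter (hQ.preimage continuous_subtype_val))

theorem interiorChart_saturated (t : S.Tri) (Q : Set (Fin 3 → ℝ)) (p q : S.Pieces)
    (h : S.Glue p q) (hp : p ∈ interiorChart t Q) : q ∈ interiorChart t Q := by
  obtain ⟨i, -, hi, -⟩ := h
  exact absurd hi (hp.2.1 i).ne'

theorem isOpen_starChart (e : S.Edge) {Q : Set (ℝ × ℝ)} (hQ : IsOpen Q) :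
    IsOpen (starChart e Q) := by
  rw [isOpen_sigma_iff]
  intro t
  have h : Sigma.mk t ⁻¹' starChart e Q = ⋃ i : {i // S.edge t i = e},
      {x | ∀ k, k ≠ i.1 → x.1 i.1 < x.1 k} ∩
        (fun x : PuncturedTriangle => (x.1 (S.head t i.1), x.1 (S.tail t i.1))) ⁻¹' Q := by
    ext x
    simp only [Set.mem_iUnion, Subtype.exists]
    constructor
    · rintro ⟨i, hi, h⟩
      exact ⟨i, hi, h⟩
    · rintro ⟨i, hi, h⟩
      exact ⟨i, hi, h⟩
  rw [h]
  exact isOpen_iUnion fun i => (isOpen_nearest i.1).inter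
    (hQ.preimage ((continuous_coord _).prodMk (continuous_coord _)))

/-- Neither point lies on a second side, so the given sides are the glued ones; the tail coordinate
is the complement of the head coordinate. -/
theorem head_eq_of_glue {p q : S.Pieces} {i j : Fin 3} (h : S.Glue p q) (hi : p.2.1 i = 0)
    (hj : q.2.1 j = 0) :
    S.edge p.1 i = S.edge q.1 j ∧ p.2.1 (S.head p.1 i) = q.2.1 (S.head q.1 j) ∧
      p.2.1 (S.tail p.1 i) = q.2.1 (S.tail q.1 j) := by
  obtain ⟨i', j', hi', hj', he, h⟩ := h
  obtain rfl := eq_of_zero hi hi'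
  obtain rfl := eq_of_zero hj hj'
  have h₁ := S.side_sum p.1 i' p.2
  have h₂ := S.side_sum q.1 j' q.2
  exact ⟨he, h, by linarith⟩

theorem starChart_saturated (e : S.Edge) (Q : Set (ℝ × ℝ)) (p q : S.Pieces)
    (h : S.Glue p q) (hp : p ∈ starChart e Q) : q ∈ starChart e Q := by
  obtain ⟨i, he, hi, hQ⟩ := hp
  obtain ⟨i', j, hi', hj, -⟩ := id h
  obtain rfl := eq_of_nearest (nearest_of_zero hi') hi
  obtain ⟨h₁, h₂, h₃⟩ := head_eq_of_glue h hi' hj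
  exact ⟨j, h₁ ▸ he, nearest_of_zero hj, h₂ ▸ h₃ ▸ hQ⟩

theorem isOpen_image_proj {D : Set S.Pieces} (hD : IsOpen D)
    (sat : ∀ p q, S.Glue p q → p ∈ D → q ∈ D) : IsOpen (S.proj '' D) := by
  rw [← S.isQuotientMap_proj.isOpen_preimage]
  convert hD
  ext q
  constructor
  · rintro ⟨p, hp, h⟩
    rcases S.proj_eq_iff.1 h with rfl | h
    exacts [hp, sat _ _ h hp]
  · exact fun h => ⟨q, h, rfl⟩

section PathProperty

variable {P : ∀ {x y : S.Surface}, Path x y → Prop}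
  (hom : ∀ {x y : S.Surface} {γ δ : Path x y}, γ.Homotopic δ → P γ → P δ)
  (trans : ∀ {x y z : S.Surface} {γ : Path x y} {δ : Path y z}, P γ → P δ → P (γ.trans δ))

-- The interior points with coordinates in `Q` form a convex set, star-shaped about `c`, and no
-- gluing takes place there.
include hom trans in
theorem path_property_interiorChart {t : S.Tri} {Q : Set (Fin 3 → ℝ)} (hQ : IsOpen Q)
    (hQc : Convex ℝ Q) {c : PuncturedTriangle} (hc : ∀ k, 0 < c.1 k) (hcQ : c.1 ∈ Q)
    (tri : ∀ {a b : PuncturedTriangle} (ε : Path a b), (∀ s, (ε s).1 ∈ Q) →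
      ∀ {x y : S.Surface} (δ : Path x y), (∀ s, δ s = S.triMap t (ε s)) → P δ)
    {x y : S.Surface} (γ : Path x y) (hγ : ∀ s, γ s ∈ S.proj '' interiorChart t Q) : P γ := by
  have hmem : ∀ p ∈ interiorChart t Q, ∀ s, (⟨p.1, combo p.2 c s⟩ : S.Pieces) ∈
      interiorChart t Q := fun p hp s => ⟨hp.1, fun k => lt_combo (hp.2.1 k) (hc k) s,
        hQc hp.2.2 hcQ (sub_nonneg.2 s.2.2) s.2.1 (sub_add_cancel _ _)⟩
  refine path_property_of_contraction hom trans (isOpen_interiorChart t hQ)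
    (interiorChart_saturated t Q) (z := fun _ => c) continuousOn_const hmem
    (fun p hp q _ h s => ?_) (fun p hp q hq => by rw [hp.1, hq.1]) (fun p hp x y δ hδ => ?_) γ hγ
  · obtain ⟨i, -, hi, -⟩ := h
    exact absurd hi (hp.2.1 i).ne'
  · have h : ∀ s, ((segment p.2 c) s).1 ∈ Q := fun s => (hmem p hp s).2.2
    obtain rfl := hp.1
    refine ⟨tri (segment p.2 c) h δ hδ, tri (segment p.2 c).symm (fun s => ?_) δ.symm fun s => ?_⟩
    · exact h _
    · exact hδ _

-- Each sector of the star contracts along segments to the point of parameter `u` on its side. These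
-- points coincide in the surface, and on the edge itself the segments in different triangles agree,
-- so the contractions fit together. Convexity of `Q` keeps them inside the chart.
include hom trans in
theorem path_property_starChart {e : S.Edge} {Q : Set (ℝ × ℝ)} (hQ : IsOpen Q)
    (hQc : Convex ℝ Q) (u : EdgeParam) (hu : ((u : ℝ), (1 - u : ℝ)) ∈ Q)
    (tri : ∀ t i {a b : PuncturedTriangle} (ε : Path a b),
      (∀ s, ((ε s).1 (S.head t i), (ε s).1 (S.tail t i)) ∈ Q) →
      ∀ {x y : S.Surface} (δ : Path x y), (∀ s, δ s = S.triMap t (ε s)) → P δ)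
    {x y : S.Surface} (γ : Path x y) (hγ : ∀ s, γ s ∈ S.proj '' starChart e Q) : P γ := by
  classical
  -- The value outside the star is never used.
  let z : S.Pieces → PuncturedTriangle := fun p =>
    if h : p ∈ starChart e Q then S.sidePt p.1 h.choose u else center
  have hz : ∀ p ∈ starChart e Q, ∀ i, (∀ k, k ≠ i → p.2.1 i < p.2.1 k) →
      z p = S.sidePt p.1 i u := by
    intro p hp i hi
    simp only [z, dif_pos hp]
    rw [eq_of_nearest hp.choose_spec.2.1 hi]
  have key : ∀ p ∈ starChart e Q, ∀ i, (∀ k, k ≠ i → p.2.1 i < p.2.1 k) → ∀ s,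
      S.edge p.1 i = e ∧ (∀ k, k ≠ i → (combo p.2 (z p) s).1 i < (combo p.2 (z p) s).1 k) ∧
      ((combo p.2 (z p) s).1 (S.head p.1 i), (combo p.2 (z p) s).1 (S.tail p.1 i)) ∈ Q := by
    intro p hp i hi s
    obtain ⟨j, he, hj, hjQ⟩ := id hp
    obtain rfl := eq_of_nearest hi hj
    rw [hz p hp i hi]
    refine ⟨he, fun k hk => combo_lt (hi k hk)
      (nearest_of_zero (S.sidePt_self _ _ _) k hk) s, ?_⟩
    have := hQc hjQ hu (sub_nonneg.2 s.2.2) s.2.1 (sub_add_cancel _ _)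
    simpa only [combo_apply, sidePt_head, sidePt_tail, Prod.smul_mk, Prod.mk_add_mk,
      smul_eq_mul] using this
  refine path_property_of_contraction hom trans (isOpen_starChart e hQ)
    (starChart_saturated e Q) (z := z) ?_ (fun p hp s => ?_)
    (fun p hp q hq h s => ?_) (fun p hp q hq => ?_) (fun p hp x y δ hδ => ?_) γ hγ
  · intro p hp
    obtain ⟨i, he, hi, -⟩ := id hp
    refine ContinuousAt.continuousWithinAt ?_
    -- The target of the contraction is constant on each sector, and the sectors are open.
    have hcont : ContinuousAt (fun q : S.Pieces => S.sidePt p.1 i u) p := continuousAt_const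
    refine hcont.congr ?_
    have hside : IsOpen ((fun x => (⟨p.1, x⟩ : S.Pieces)) '' {x | ∀ k, k ≠ i → x.1 i < x.1 k}) :=
      isOpenMap_sigmaMk _ (isOpen_nearest i)
    have hopen := hside.inter (isOpen_starChart e hQ)
    filter_upwards [hopen.mem_nhds ⟨⟨p.2, hi, rfl⟩, hp⟩]
    rintro q ⟨⟨x, hx, rfl⟩, hq⟩
    exact (hz _ hq i hx).symm
  · obtain ⟨i, he, hi, -⟩ := id hp
    exact ⟨i, key p hp i hi s⟩
  · obtain ⟨i, j, hi, hj, he, h'⟩ := id h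
    rw [hz p hp i (nearest_of_zero hi), hz q hq j (nearest_of_zero hj)]
    refine Quot.sound ⟨i, j, ?_, ?_, he, ?_⟩
    · simp [combo_apply, hi, sidePt_self]
    · simp [combo_apply, hj, sidePt_self]
    · simp only [combo_apply, sidePt_head, h']
  · obtain ⟨i, he, hi, -⟩ := id hp
    obtain ⟨j, he', hj, -⟩ := id hq
    rw [hz p hp i hi, hz q hq j hj]
    exact S.triMap_sidePt (he.trans he'.symm) u
  · obtain ⟨i, he, hi, -⟩ := id hp
    have h := fun s => (key p hp i hi s).2.2
    exact ⟨tri p.1 i (segment p.2 (z p)) h δ hδ,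
      tri p.1 i (segment p.2 (z p)).symm (fun s => h _) δ.symm fun s => hδ _⟩

include hom trans in
/-- A property of paths that is invariant under homotopy and concatenation, and that holds for the
paths inside the triangles, holds for all paths in the surface. -/
theorem path_property
    (tri : ∀ t {a b : PuncturedTriangle} (ε : Path a b) {x y : S.Surface} (δ : Path x y),
      (∀ s, δ s = S.triMap t (ε s)) → P δ)
    {x y : S.Surface} (γ : Path x y) : P γ := by
  -- A point with all coordinates positive is in the interior of a triangle; any other lies on a
  -- side, hence in the star of its edge.
  refine path_property_of_cover hom trans
    (U := fun a : S.Tri ⊕ S.Edge => a.elim (fun t => S.proj '' interiorChart t Set.univ)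
      (fun e => S.proj '' starChart e Set.univ)) ?_ ?_ γ fun s => ?_
  · rintro (t | e)
    · exact isOpen_image_proj (isOpen_interiorChart t isOpen_univ) (interiorChart_saturated t _)
    · exact isOpen_image_proj (isOpen_starChart e isOpen_univ) (starChart_saturated e _)
  · rintro (t | e) x y γ hγ
    · exact path_property_interiorChart hom trans isOpen_univ convex_univ (c := center)
        (fun k => by simp [center]) trivial (fun ε _ _ _ δ hδ => tri t ε δ hδ) γ hγ
    · exact path_property_starChart hom trans isOpen_univ convex_univ EdgeParam.mid trivial
        (fun t i _ _ ε _ _ _ δ hδ => tri t ε δ hδ) γ hγ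
  · obtain ⟨p, hp⟩ := S.isQuotientMap_proj.surjective (γ s)
    by_cases h : ∀ k, 0 < p.2.1 k
    · exact ⟨Sum.inl p.1, p, ⟨rfl, h, trivial⟩, hp⟩
    · obtain ⟨i, hi⟩ := exists_zero_of_not_interior h
      exact ⟨Sum.inr (S.edge p.1 i), p, ⟨i, rfl, nearest_of_zero hi, trivial⟩, hp⟩

include hom trans in
/-- A property of paths that is invariant under homotopy and concatenation, and that holds for the
paths inside a corner of a triangle, holds for all paths near the punctures. -/
theorem path_property_nearPunctures
    (tri : ∀ t i {a b : PuncturedTriangle} (ε : Path a b), (∀ s, 1 / 2 < (ε s).1 i) →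
      ∀ {x y : S.Surface} (δ : Path x y), (∀ s, δ s = S.triMap t (ε s)) → P δ)
    {x y : S.Surface} (γ : Path x y) (hγ : ∀ s, γ s ∈ S.nearPunctures) : P γ := by
  have o₁ : ∀ i : Fin 3, IsOpen {x : Fin 3 → ℝ | 1 / 2 < x i} := fun i =>
    isOpen_lt continuous_const (continuous_apply i)
  have o₂ : IsOpen {x : ℝ × ℝ | 1 / 2 < x.1} := isOpen_lt continuous_const continuous_fst
  have o₃ : IsOpen {x : ℝ × ℝ | 1 / 2 < x.2} := isOpen_lt continuous_const continuous_snd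
  have c₁ : ∀ i : Fin 3, Convex ℝ {x : Fin 3 → ℝ | 1 / 2 < x i} := fun i =>
    convex_halfSpace_gt (LinearMap.proj (R := ℝ) (φ := fun _ : Fin 3 => ℝ) i).isLinear _
  have c₂ : Convex ℝ {x : ℝ × ℝ | 1 / 2 < x.1} :=
    convex_halfSpace_gt (LinearMap.fst ℝ ℝ ℝ).isLinear _
  have c₃ : Convex ℝ {x : ℝ × ℝ | 1 / 2 < x.2} :=
    convex_halfSpace_gt (LinearMap.snd ℝ ℝ ℝ).isLinear _
  refine path_property_of_cover hom trans
    (U := fun a : (S.Tri × Fin 3) ⊕ S.Edge ⊕ S.Edge => a.elim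
      (fun t => S.proj '' interiorChart t.1 {x | 1 / 2 < x t.2})
      (fun e => e.elim (fun e => S.proj '' starChart e {x | 1 / 2 < x.1})
        (fun e => S.proj '' starChart e {x | 1 / 2 < x.2}))) ?_ ?_ γ fun s => ?_
  · rintro (⟨t, i⟩ | e | e)
    · exact isOpen_image_proj (isOpen_interiorChart t (o₁ i)) (interiorChart_saturated t _)
    · exact isOpen_image_proj (isOpen_starChart e o₂) (starChart_saturated e _)
    · exact isOpen_image_proj (isOpen_starChart e o₃) (starChart_saturated e _)
  · rintro (⟨t, i⟩ | e | e) x y γ hγ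
    · exact path_property_interiorChart hom trans (o₁ i) (c₁ i) (c := corner i)
        (fun k => by simp only [corner]; split_ifs <;> norm_num) (half_lt_corner i)
        (fun ε h _ _ δ hδ => tri t i ε h δ hδ) γ hγ
    -- The contraction points have parameters 3/4 and 1/4: the coordinate at the head, respectively
    -- at the tail, is then 3/4, above the threshold 1/2.
    · exact path_property_starChart hom trans o₂ c₂ EdgeParam.nearHead
        (by simp only [Set.mem_ofPred_eq, EdgeParam.nearHead]; norm_num)
        (fun t i _ _ ε h _ _ δ hδ => tri t (S.head t i) ε h δ hδ) γ hγ
    · exact path_property_starChart hom trans o₃ c₃ EdgeParam.nearTail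
        (by simp only [Set.mem_ofPred_eq, EdgeParam.nearTail]; norm_num)
        (fun t i _ _ ε h _ _ δ hδ => tri t (S.tail t i) ε h δ hδ) γ hγ
  · obtain ⟨t, x, i, hs, hi⟩ := hγ s
    by_cases h : ∀ k, 0 < x.1 k
    · exact ⟨Sum.inl (t, i), ⟨t, x⟩, ⟨rfl, h, hi⟩, hs.symm⟩
    · obtain ⟨j, hj⟩ := exists_zero_of_not_interior h
      have hij : i ≠ j := by
        rintro rfl
        rw [hj] at hi
        norm_num at hi
      rcases S.eq_head_or_eq_tail t hij with rfl | rfl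
      · exact ⟨Sum.inr (Sum.inl (S.edge t j)), ⟨t, x⟩, ⟨j, rfl, nearest_of_zero hj, hi⟩, hs.symm⟩
      · exact ⟨Sum.inr (Sum.inr (S.edge t j)), ⟨t, x⟩, ⟨j, rfl, nearest_of_zero hj, hi⟩, hs.symm⟩

end PathProperty

end GluedTriangles

/-! ### Parallel transport along simply connected pieces -/

section Transport

variable {R : Type u} [DivisionRing R] {X : Type} [TopologicalSpace X]
  (L : FundamentalGroupoid X ⥤ ModuleCat.{u} R)

theorem transport_congr {x y : X} {γ δ : Path x y} (h : γ.Homotopic δ) :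
    transport L γ = transport L δ := by
  unfold transport
  rw [Path.Homotopic.Quotient.eq.2 h]

theorem transport_trans {x y z : X} (γ : Path x y) (δ : Path y z) :
    transport L (γ.trans δ) = transport L δ ∘ₗ transport L γ := by
  have := L.map_comp (FundamentalGroupoid.fromPath (Path.Homotopic.Quotient.mk γ))
    (FundamentalGroupoid.fromPath (Path.Homotopic.Quotient.mk δ))
  exact congrArg ModuleCat.Hom.hom this

theorem transport_refl (x : X) : transport L (Path.refl x) = LinearMap.id :=
  congrArg ModuleCat.Hom.hom (L.map_id ⟨x⟩)

theorem transport_symm_comp {x y : X} (γ : Path x y) :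
    transport L γ.symm ∘ₗ transport L γ = LinearMap.id := by
  rw [← transport_trans, ← transport_refl]
  exact transport_congr L (Path.Homotopic.trans_symm γ)

theorem transport_comp_symm {x y : X} (γ : Path x y) :
    transport L γ ∘ₗ transport L γ.symm = LinearMap.id := by
  rw [← transport_trans, ← transport_refl]
  exact transport_congr L (Path.Homotopic.symm_trans γ)

theorem transport_naturality {L L' : FundamentalGroupoid X ⥤ ModuleCat.{u} R} (f : L ⟶ L')
    {x y : X} (γ : Path x y) (v : L.obj ⟨x⟩) :
    (f.app ⟨y⟩).hom (transport L γ v) = transport L' γ ((f.app ⟨x⟩).hom v) :=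
  congrArg (fun g => g.hom v)
    (f.naturality (FundamentalGroupoid.fromPath (Path.Homotopic.Quotient.mk γ)))

variable {A B : Type} [TopologicalSpace A] [TopologicalSpace B] [SimplyConnectedSpace A]
  [SimplyConnectedSpace B] (f : C(A, X))

/-- Parallel transport along a continuous map from a simply connected space. -/
noncomputable def transportAlong (a b : A) : L.obj ⟨f a⟩ ≃ₗ[R] L.obj ⟨f b⟩ :=
  LinearEquiv.ofLinearMap (transport L ((PathConnectedSpace.somePath a b).map f.continuous))
    (transport L ((PathConnectedSpace.somePath a b).map f.continuous).symm)
    (transport_comp_symm L _) (transport_symm_comp L _)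

/-- Any two paths with the same ends are homotopic in the simply connected source, so the path
chosen to define `transportAlong` is immaterial. -/
theorem transport_map {a b : A} (γ : Path a b) :
    transport L (γ.map f.continuous) = (transportAlong L f a b : _ →ₗ[R] _) :=
  transport_congr L ((SimplyConnectedSpace.paths_homotopic γ _).map f)

theorem transportAlong_self (a : A) (v : L.obj ⟨f a⟩) : transportAlong L f a a v = v := by
  have h := transport_map L f (Path.refl a)
  have h' := LinearMap.congr_fun h v
  refine h'.symm.trans ?_
  exact LinearMap.congr_fun (transport_refl L (f a)) v

theorem transportAlong_transportAlong (a b c : A) (v : L.obj ⟨f a⟩) :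
    transportAlong L f b c (transportAlong L f a b v) = transportAlong L f a c v := by
  have h := transport_map L f
    ((PathConnectedSpace.somePath a b).trans (PathConnectedSpace.somePath b c))
  rw [Path.map_trans, transport_trans] at h
  exact LinearMap.congr_fun h v

theorem transportAlong_comp (g : C(B, A)) (a b : B) :
    transportAlong L (f.comp g) a b = transportAlong L f (g a) (g b) := by
  ext v
  exact LinearMap.congr_fun
    (transport_map L f ((PathConnectedSpace.somePath a b).map g.continuous)) v

theorem transportAlong_naturality {L L' : FundamentalGroupoid X ⥤ ModuleCat.{u} R} (h : L ⟶ L')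
    (a b : A) (v : L.obj ⟨f a⟩) :
    (h.app ⟨f b⟩).hom (transportAlong L f a b v) =
      transportAlong L' f a b ((h.app ⟨f a⟩).hom v) :=
  transport_naturality h _ v

theorem map_transportAlong (a b c : A) (W : Submodule R (L.obj ⟨f a⟩)) :
    (W.map (transportAlong L f a b).toLinearMap).map (transportAlong L f b c).toLinearMap =
      W.map (transportAlong L f a c).toLinearMap := by
  rw [← Submodule.map_comp]
  congr 1
  ext v
  exact transportAlong_transportAlong L f a b c v

end Transport

/-! ### Flags under isomorphisms, and flag complexes -/

section Flags

variable {R : Type u} [DivisionRing R] {V W : Type*} [AddCommGroup V] [Module R V]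
  [AddCommGroup W] [Module R W] {m : ℕ}

theorem FullFlag.finrank_eq (F : FullFlag R V m) : Module.finrank R V = m := by
  have h := F.codim (Fin.last m)
  rw [F.space_last] at h
  exact (Submodule.quotEquivOfEqBot (⊥ : Submodule R V) rfl).finrank_eq.symm.trans h

theorem FullFlag.finite (F : FullFlag R V m) : Module.Finite R V := by
  -- A vanishing `finrank` does not imply finiteness; for `m = 0` the flag itself says that the
  -- space is zero.
  rcases Nat.eq_zero_or_pos m with rfl | hm
  · have h : (⊤ : Submodule R V) = ⊥ := F.space_zero.symm.trans F.space_last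
    have := (Submodule.subsingleton_iff R).1 (subsingleton_of_bot_eq_top h.symm)
    infer_instance
  · exact Module.finite_of_finrank_pos (F.finrank_eq ▸ hm)

/-- The image of a flag under a linear isomorphism. -/
def FullFlag.map (F : FullFlag R V m) (e : V ≃ₗ[R] W) : FullFlag R W m where
  space i := (F.space i).map (e : V →ₗ[R] W)
  antitone _ _ h := Submodule.map_mono (F.antitone h)
  space_zero := by
    rw [F.space_zero, Submodule.map_top]
    exact e.range
  space_last := by rw [F.space_last, Submodule.map_bot]
  codim i := by
    rw [← F.codim i]
    exact (Submodule.Quotient.equiv (F.space i) _ e rfl).finrank_eq.symm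

theorem GenericTriple.map {F : Fin 3 → Fin (m + 1) → Submodule R V} (h : GenericTriple R F)
    (e : V ≃ₗ[R] W) : GenericTriple R fun i a => (F i a).map (e : V →ₗ[R] W) := by
  intro a b c habc
  let q : ∀ U : Submodule R V, (V ⧸ U) ≃ₗ[R] W ⧸ U.map (e : V →ₗ[R] W) := fun U =>
    Submodule.Quotient.equiv U _ e rfl
  have h₁ := ((q (F 0 a)).prodCongr ((q (F 1 b)).prodCongr (q (F 2 c)))).bijective.comp
    ((h a b c habc).comp e.symm.bijective)
  convert h₁ using 1
  funext w
  obtain ⟨v, rfl⟩ := e.surjective w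
  simp only [Function.comp_apply, LinearEquiv.symm_apply_apply]
  rfl

end Flags

/-- The restriction of a framed local system to the barycentres of the triangles and the middles of
the edges: a vector space with a generic triple of flags for every triangle, a vector space with a
pair of flags for every edge, and an isomorphism for every side of a triangle. -/
structure FlagComplex (R : Type u) [DivisionRing R] (m : ℕ) (S : GluedTriangles) where
  onTri : S.Tri → ModuleCat.{u} R
  onEdge : S.Edge → ModuleCat.{u} R
  glue : ∀ t i, onTri t ≃ₗ[R] onEdge (S.edge t i)
  triFlag : ∀ t, Fin 3 → FullFlag R (onTri t) m
  headFlag : ∀ e, FullFlag R (onEdge e) m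
  tailFlag : ∀ e, FullFlag R (onEdge e) m
  generic : ∀ t, GenericTriple R fun i => (triFlag t i).space
  map_head : ∀ t i a, ((triFlag t (S.head t i)).space a).map (glue t i : _ →ₗ[R] _) =
    (headFlag (S.edge t i)).space a
  map_tail : ∀ t i a, ((triFlag t (S.tail t i)).space a).map (glue t i : _ →ₗ[R] _) =
    (tailFlag (S.edge t i)).space a

namespace FlagComplex

variable {R : Type u} [DivisionRing R] {m : ℕ} {S : GluedTriangles}

/-- An isomorphism of flag complexes. -/
@[ext]
structure Hom (X Y : FlagComplex R m S) where
  onTri : ∀ t, X.onTri t ≃ₗ[R] Y.onTri t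
  onEdge : ∀ e, X.onEdge e ≃ₗ[R] Y.onEdge e
  comm : ∀ t i v, onEdge (S.edge t i) (X.glue t i v) = Y.glue t i (onTri t v)
  map_flag : ∀ t i a, ((X.triFlag t i).space a).map (onTri t : _ →ₗ[R] _) =
    (Y.triFlag t i).space a

instance : Groupoid (FlagComplex R m S) where
  Hom X Y := Hom X Y
  id X := ⟨fun _ => LinearEquiv.refl R _, fun _ => LinearEquiv.refl R _, fun _ _ _ => rfl,
    fun _ _ _ => Submodule.map_id _⟩
  comp f g := ⟨fun t => (f.onTri t).trans (g.onTri t), fun e => (f.onEdge e).trans (g.onEdge e),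
    fun t i v => by simp only [LinearEquiv.trans_apply, f.comm, g.comm],
    fun t i a => by
      rw [← g.map_flag t i a, ← f.map_flag t i a, ← Submodule.map_comp]
      rfl⟩
  inv f := ⟨fun t => (f.onTri t).symm, fun e => (f.onEdge e).symm,
    fun t i v => by
      rw [LinearEquiv.symm_apply_eq, f.comm, LinearEquiv.apply_symm_apply],
    fun t i a => by
      rw [← f.map_flag t i a, ← Submodule.map_comp]
      convert Submodule.map_id _
      ext v
      exact (f.onTri t).symm_apply_apply v⟩
  inv_comp f := Hom.ext (funext fun t => LinearEquiv.symm_trans_self (f.onTri t))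
    (funext fun e => LinearEquiv.symm_trans_self (f.onEdge e))
  comp_inv f := Hom.ext (funext fun t => LinearEquiv.self_trans_symm (f.onTri t))
    (funext fun e => LinearEquiv.self_trans_symm (f.onEdge e))

end FlagComplex

/-! ### Restriction to barycentres and midpoints; it is full and faithful -/

namespace GluedTriangles

variable (S : GluedTriangles)

/-- The canonical map from the triangle `t` to the surface, as a bundled continuous map. -/
def tri (t : S.Tri) : C(PuncturedTriangle, S.Surface) := ⟨S.triMap t, S.continuous_triMap t⟩

/-- The parametrization of a side of a triangle, as a bundled continuous map. -/
noncomputable def side (t : S.Tri) (i : Fin 3) : C(EdgeParam, PuncturedTriangle) :=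
  ⟨S.sidePt t i, S.continuous_sidePt t i⟩

theorem tri_comp_side (t : S.Tri) (i : Fin 3) :
    (S.tri t).comp (S.side t i) = S.edgeMap (S.edge t i) :=
  (S.edgeMap_edge t i).symm

theorem edgeMap_mem_of_head (e : S.Edge) {u : EdgeParam} (h : (1 / 2 : ℝ) < u) :
    S.edgeMap e u ∈ S.nearPunctures :=
  ⟨_, _, _, rfl, h.trans_eq (S.sidePt_head _ _ u).symm⟩

theorem edgeMap_mem_of_tail (e : S.Edge) {u : EdgeParam} (h : (1 / 2 : ℝ) < 1 - u) :
    S.edgeMap e u ∈ S.nearPunctures :=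
  ⟨_, _, _, rfl, h.trans_eq (S.sidePt_tail _ _ u).symm⟩

end GluedTriangles

section SideTransport

variable {R : Type u} [DivisionRing R] {S : GluedTriangles}
  (L : FundamentalGroupoid S.Surface ⥤ ModuleCat.{u} R)

/-- Parallel transport from the barycentre of a triangle to the middle of a side. -/
noncomputable def sideTransport (t : S.Tri) (i : Fin 3) (f : C(EdgeParam, S.Surface))
    (hf : (S.tri t).comp (S.side t i) = f) :
    L.obj ⟨S.tri t center⟩ ≃ₗ[R] L.obj ⟨f EdgeParam.mid⟩ :=
  hf ▸ transportAlong L (S.tri t) center (S.side t i EdgeParam.mid)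

theorem sideTransport_rfl (t : S.Tri) (i : Fin 3) :
    sideTransport L t i _ rfl =
      transportAlong L (S.tri t) center (S.side t i EdgeParam.mid) := rfl

end SideTransport

namespace FramedLocalSystem

variable {R : Type u} [DivisionRing R] {m : ℕ} {S : GluedTriangles} (X : FramedLocalSystem R m S)

/-- The corner is convex, so the segment stays near the puncture and flatness of the framing applies
to it. -/
theorem map_flag_corner (t : S.Tri) {i : Fin 3} {x y : PuncturedTriangle} (hx : 1 / 2 < x.1 i)
    (hy : 1 / 2 < y.1 i) (a : Fin (m + 1)) :
    ((X.flag (S.tri t x) (S.triMap_mem_nearPunctures t hx)).space a).map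
      (transportAlong X.sys (S.tri t) x y : _ →ₗ[R] _) =
    (X.flag (S.tri t y) (S.triMap_mem_nearPunctures t hy)).space a := by
  rw [← transport_map X.sys (S.tri t) (segment x y)]
  exact X.flat _ _ _ (fun s => S.triMap_mem_nearPunctures t (lt_combo hx hy s)) a

/-- The flag at the point `f a`, transported along `f` to the point `f b`. -/
noncomputable def flagAlong {A : Type} [TopologicalSpace A] [SimplyConnectedSpace A]
    (f : C(A, S.Surface)) (a b : A) (h : f a ∈ S.nearPunctures) :
    FullFlag R (X.sys.obj ⟨f b⟩) m :=
  (X.flag (f a) h).map (transportAlong X.sys f a b)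

/-- The two flags start from two points of the same corner, where the framing is flat, and transport
inside the triangle does not depend on the path. -/
theorem map_sideTransport_flagAlong (t : S.Tri) (i : Fin 3) {k : Fin 3} {u : EdgeParam}
    (h : 1 / 2 < (S.side t i u).1 k) (f : C(EdgeParam, S.Surface))
    (hf : (S.tri t).comp (S.side t i) = f) (hu : f u ∈ S.nearPunctures) (a : Fin (m + 1)) :
    ((X.flagAlong (S.tri t) (corner k) center
      (S.triMap_mem_nearPunctures t (half_lt_corner k))).space a).map
        (sideTransport X.sys t i f hf : _ →ₗ[R] _) =
      (X.flagAlong f u EdgeParam.mid hu).space a := by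
  subst hf
  rw [sideTransport_rfl]
  unfold flagAlong FullFlag.map
  dsimp only
  rw [transportAlong_comp]
  refine (map_transportAlong X.sys (S.tri t) (corner k) center (S.side t i EdgeParam.mid) _).trans ?_
  refine Eq.trans ?_ (congrArg _ (X.map_flag_corner t (half_lt_corner k) h a))
  exact (map_transportAlong X.sys (S.tri t) _ _ _ _).symm

/-- The restriction of a framed local system to the barycentres of the triangles and the middles of
the edges. -/
noncomputable def toFlagComplex : FlagComplex R m S where
  onTri t := X.sys.obj ⟨S.tri t center⟩
  onEdge e := X.sys.obj ⟨S.edgeMap e EdgeParam.mid⟩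
  glue t i := sideTransport X.sys t i _ (S.tri_comp_side t i)
  triFlag t i := X.flagAlong (S.tri t) (corner i) center
    (S.triMap_mem_nearPunctures t (half_lt_corner i))
  headFlag e := X.flagAlong (S.edgeMap e) EdgeParam.nearHead EdgeParam.mid
    (S.edgeMap_mem_of_head e (by norm_num [EdgeParam.nearHead]))
  tailFlag e := X.flagAlong (S.edgeMap e) EdgeParam.nearTail EdgeParam.mid
    (S.edgeMap_mem_of_tail e (by norm_num [EdgeParam.nearTail]))
  generic t := by
    have h := X.generic t corner half_lt_corner center
      fun i => PathConnectedSpace.somePath (corner i) center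
    exact h
  map_head t i a := X.map_sideTransport_flagAlong t i
    (by
      refine lt_of_lt_of_eq ?_ (S.sidePt_head t i _).symm
      norm_num [EdgeParam.nearHead]) _ _ _ a
  map_tail t i a := X.map_sideTransport_flagAlong t i
    (by
      refine lt_of_lt_of_eq ?_ (S.sidePt_tail t i _).symm
      norm_num [EdgeParam.nearTail]) _ _ _ a

variable (R m S) in
/-- Restriction to the barycentres of the triangles and the middles of the edges. -/
noncomputable def restriction : FramedLocalSystem R m S ⥤ FlagComplex R m S where
  obj X := X.toFlagComplex
  map {X Y} f :=
    { onTri := fun t => (f.iso.app ⟨S.tri t center⟩).toLinearEquiv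
      onEdge := fun e => (f.iso.app ⟨S.edgeMap e EdgeParam.mid⟩).toLinearEquiv
      comm := fun t i v => by
        -- `edgeMap` is built from a chosen side, so it agrees with the given side only up to a
        -- proved equality. For an arbitrary curve `g` that equality can be substituted.
        have key : ∀ (g : C(EdgeParam, S.Surface)) (hg : (S.tri t).comp (S.side t i) = g),
            (f.iso.hom.app ⟨g EdgeParam.mid⟩).hom (sideTransport X.sys t i g hg v) =
              sideTransport Y.sys t i g hg ((f.iso.hom.app ⟨S.tri t center⟩).hom v) := by
          rintro _ rfl
          exact transportAlong_naturality (S.tri t) f.iso.hom center (S.side t i EdgeParam.mid) v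
        exact key _ (S.tri_comp_side t i)
      map_flag := fun t i a => by
        have h := f.map_flag (S.tri t (corner i))
          (S.triMap_mem_nearPunctures t (half_lt_corner i)) a
        change Submodule.map (f.iso.hom.app ⟨S.tri t center⟩).hom (Submodule.map _ _) =
          Submodule.map _ _
        rw [← h, ← Submodule.map_comp, ← Submodule.map_comp]
        congr 1
        ext v
        exact transportAlong_naturality (S.tri t) f.iso.hom (corner i) center v }

/-- Every point is joined to a barycentre inside a triangle, and naturality along that path
determines the morphism there. -/
instance : (restriction R m S).Faithful where
  map_injective {X Y f g} h := by
    refine Hom.ext (Iso.ext (NatTrans.ext (funext ?_)))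
    rintro ⟨s⟩
    obtain ⟨⟨t, x⟩, rfl⟩ := S.isQuotientMap_proj.surjective s
    ext v
    have h₁ := congrFun (congrArg FlagComplex.Hom.onTri h) t
    have h₂ : ∀ w, (f.iso.hom.app ⟨S.tri t center⟩).hom w =
        (g.iso.hom.app ⟨S.tri t center⟩).hom w := fun w => LinearEquiv.congr_fun h₁ w
    obtain ⟨w, rfl⟩ := (transportAlong X.sys (S.tri t) center x).surjective v
    have hf := transportAlong_naturality (S.tri t) f.iso.hom center x w
    have hg := transportAlong_naturality (S.tri t) g.iso.hom center x w
    exact hf.trans ((congrArg _ (h₂ w)).trans hg.symm)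

section Full

variable {X} {Y : FramedLocalSystem R m S}

/-- The extension of an isomorphism at the barycentre to the whole triangle. -/
noncomputable def extendTri (t : S.Tri)
    (h : X.sys.obj ⟨S.tri t center⟩ ≃ₗ[R] Y.sys.obj ⟨S.tri t center⟩) (x : PuncturedTriangle) :
    X.sys.obj ⟨S.tri t x⟩ ≃ₗ[R] Y.sys.obj ⟨S.tri t x⟩ :=
  (transportAlong X.sys (S.tri t) x center).trans
    (h.trans (transportAlong Y.sys (S.tri t) center x))

/-- The extension of an isomorphism at the middle of an edge to the whole edge. -/
noncomputable def extendEdge (f : C(EdgeParam, S.Surface))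
    (h : X.sys.obj ⟨f EdgeParam.mid⟩ ≃ₗ[R] Y.sys.obj ⟨f EdgeParam.mid⟩) (u : EdgeParam) :
    X.sys.obj ⟨f u⟩ ≃ₗ[R] Y.sys.obj ⟨f u⟩ :=
  (transportAlong X.sys f u EdgeParam.mid).trans (h.trans (transportAlong Y.sys f EdgeParam.mid u))

theorem extendTri_apply (t : S.Tri)
    (h : X.sys.obj ⟨S.tri t center⟩ ≃ₗ[R] Y.sys.obj ⟨S.tri t center⟩) (x : PuncturedTriangle)
    (v : X.sys.obj ⟨S.tri t x⟩) :
    extendTri t h x v = transportAlong Y.sys (S.tri t) center x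
      (h (transportAlong X.sys (S.tri t) x center v)) := rfl

theorem extendEdge_apply (f : C(EdgeParam, S.Surface))
    (h : X.sys.obj ⟨f EdgeParam.mid⟩ ≃ₗ[R] Y.sys.obj ⟨f EdgeParam.mid⟩) (u : EdgeParam)
    (v : X.sys.obj ⟨f u⟩) :
    extendEdge f h u v = transportAlong Y.sys f EdgeParam.mid u
      (h (transportAlong X.sys f u EdgeParam.mid v)) := rfl

theorem extendTri_eq_extendEdge (t : S.Tri) (i : Fin 3)
    (h : X.sys.obj ⟨S.tri t center⟩ ≃ₗ[R] Y.sys.obj ⟨S.tri t center⟩)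
    (k : X.sys.obj ⟨S.tri t (S.side t i EdgeParam.mid)⟩ ≃ₗ[R]
      Y.sys.obj ⟨S.tri t (S.side t i EdgeParam.mid)⟩)
    (hk : ∀ v, k (transportAlong X.sys (S.tri t) center (S.side t i EdgeParam.mid) v) =
      transportAlong Y.sys (S.tri t) center (S.side t i EdgeParam.mid) (h v))
    (u : EdgeParam) (v : X.sys.obj ⟨S.tri t (S.side t i u)⟩) :
    extendTri t h (S.side t i u) v =
      transportAlong Y.sys (S.tri t) (S.side t i EdgeParam.mid) (S.side t i u)
        (k (transportAlong X.sys (S.tri t) (S.side t i u) (S.side t i EdgeParam.mid) v)) := by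
  have h₁ := hk (transportAlong X.sys (S.tri t) (S.side t i u) center v)
  rw [transportAlong_transportAlong] at h₁
  rw [h₁, transportAlong_transportAlong, extendTri_apply]

/-- The fibres lie over points identified only through `hf`, whence the heterogeneous equality.
After substitution it says that the extension from the barycentre may pass through the midpoint of
the side. -/
theorem extendTri_heq_extendEdge (t : S.Tri) (i : Fin 3)
    (h : X.sys.obj ⟨S.tri t center⟩ ≃ₗ[R] Y.sys.obj ⟨S.tri t center⟩)
    (f : C(EdgeParam, S.Surface)) (hf : (S.tri t).comp (S.side t i) = f)
    (k : X.sys.obj ⟨f EdgeParam.mid⟩ ≃ₗ[R] Y.sys.obj ⟨f EdgeParam.mid⟩)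
    (hk : ∀ v, k (sideTransport X.sys t i f hf v) = sideTransport Y.sys t i f hf (h v))
    (u : EdgeParam) : HEq (extendTri t h (S.side t i u)) (extendEdge f k u) := by
  subst hf
  refine heq_of_eq (LinearEquiv.ext fun v => ?_)
  refine (extendTri_eq_extendEdge t i h k hk u v).trans ?_
  refine Eq.trans ?_ (extendEdge_apply _ k u v).symm
  rw [transportAlong_comp, transportAlong_comp]

theorem extendTri_transport (t : S.Tri)
    (h : X.sys.obj ⟨S.tri t center⟩ ≃ₗ[R] Y.sys.obj ⟨S.tri t center⟩) (a b : PuncturedTriangle)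
    (v : X.sys.obj ⟨S.tri t a⟩) :
    extendTri t h b (transportAlong X.sys (S.tri t) a b v) =
      transportAlong Y.sys (S.tri t) a b (extendTri t h a v) := by
  rw [extendTri_apply, extendTri_apply, transportAlong_transportAlong,
    transportAlong_transportAlong]

theorem extendTri_center (t : S.Tri)
    (h : X.sys.obj ⟨S.tri t center⟩ ≃ₗ[R] Y.sys.obj ⟨S.tri t center⟩) :
    extendTri t h center = h := by
  ext v
  rw [extendTri_apply, transportAlong_self, transportAlong_self]

theorem extendEdge_mid (f : C(EdgeParam, S.Surface))
    (h : X.sys.obj ⟨f EdgeParam.mid⟩ ≃ₗ[R] Y.sys.obj ⟨f EdgeParam.mid⟩) :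
    extendEdge f h EdgeParam.mid = h := by
  ext v
  rw [extendEdge_apply, transportAlong_self, transportAlong_self]

theorem map_extendTri (t : S.Tri)
    (h : X.sys.obj ⟨S.tri t center⟩ ≃ₗ[R] Y.sys.obj ⟨S.tri t center⟩) (x y : PuncturedTriangle)
    (W : Submodule R (X.sys.obj ⟨S.tri t x⟩)) (W' : Submodule R (Y.sys.obj ⟨S.tri t x⟩))
    (hW : (W.map (transportAlong X.sys (S.tri t) x center).toLinearMap).map h.toLinearMap =
      W'.map (transportAlong Y.sys (S.tri t) x center).toLinearMap) :
    (W.map (transportAlong X.sys (S.tri t) x y).toLinearMap).map (extendTri t h y).toLinearMap =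
      W'.map (transportAlong Y.sys (S.tri t) x y).toLinearMap := by
  rw [← map_transportAlong Y.sys (S.tri t) x center y, ← hW, ← Submodule.map_comp,
    ← Submodule.map_comp, ← Submodule.map_comp]
  congr 1
  ext v
  change extendTri t h y (transportAlong X.sys (S.tri t) x y v) =
    transportAlong Y.sys (S.tri t) center y (h (transportAlong X.sys (S.tri t) x center v))
  rw [extendTri_apply, transportAlong_transportAlong]

/-- On a glued side both extensions agree with the extension of the isomorphism at the midpoint of
the common edge. -/
theorem extendTri_heq (h : X.toFlagComplex ⟶ Y.toFlagComplex) (p q : S.Pieces) (hpq : S.Glue p q) :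
    HEq (extendTri p.1 (h.onTri p.1) p.2) (extendTri q.1 (h.onTri q.1) q.2) := by
  obtain ⟨t, x⟩ := p
  obtain ⟨t', x'⟩ := q
  obtain ⟨i, j, hi, hj, he, hh⟩ := hpq
  dsimp only at hi hj he hh ⊢
  obtain ⟨u, rfl⟩ := S.exists_sidePt t hi
  obtain ⟨u', rfl⟩ := S.exists_sidePt t' hj
  obtain rfl : u = u' := by
    rw [S.sidePt_head, S.sidePt_head] at hh
    exact Subtype.ext hh
  have h₁ := extendTri_heq_extendEdge t i (h.onTri t) _ (S.tri_comp_side t i)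
    (h.onEdge (S.edge t i)) (h.comm t i) u
  have h₂ := extendTri_heq_extendEdge t' j (h.onTri t') _ (S.tri_comp_side t' j)
    (h.onEdge (S.edge t' j)) (h.comm t' j) u
  have h₃ : ∀ e e', e = e' → HEq (extendEdge (S.edgeMap e) (h.onEdge e) u)
      (extendEdge (S.edgeMap e') (h.onEdge e') u) := by
    rintro e _ rfl
    rfl
  exact h₁.trans ((h₃ _ _ he).trans h₂.symm)

/-- The extension of an isomorphism of flag complexes to the whole surface. -/
noncomputable def extend (h : X.toFlagComplex ⟶ Y.toFlagComplex) (s : S.Surface) :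
    X.sys.obj ⟨s⟩ ≃ₗ[R] Y.sys.obj ⟨s⟩ :=
  Quot.hrecOn (motive := fun s : S.Surface => X.sys.obj ⟨s⟩ ≃ₗ[R] Y.sys.obj ⟨s⟩) s
    (fun p => extendTri p.1 (h.onTri p.1) p.2) (extendTri_heq h)

/-- Commuting with transport is invariant under homotopy and concatenation, so only paths inside one
triangle matter; there the extension was defined by transport. -/
theorem extend_transport (h : X.toFlagComplex ⟶ Y.toFlagComplex) {x y : S.Surface}
    (γ : Path x y) : ∀ v, extend h y (transport X.sys γ v) = transport Y.sys γ (extend h x v) := by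
  refine GluedTriangles.path_property (P := fun {x y} γ => ∀ v,
    extend h y (transport X.sys γ v) = transport Y.sys γ (extend h x v)) ?_ ?_ ?_ γ
  · intro x y γ δ hγ h₁ v
    rw [← transport_congr X.sys hγ, ← transport_congr Y.sys hγ, h₁]
  · intro x y z γ δ hγ hδ v
    rw [transport_trans, transport_trans, LinearMap.comp_apply, LinearMap.comp_apply, hδ, hγ]
  · intro t a b ε x y δ hδ v
    obtain rfl : x = S.tri t a := by
      have := hδ 0; rwa [δ.source, ε.source] at this
    obtain rfl : y = S.tri t b := by
      have := hδ 1; rwa [δ.target, ε.target] at this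
    obtain rfl : δ = ε.map (S.tri t).continuous := Path.ext (funext hδ)
    rw [transport_map, transport_map]
    exact extendTri_transport t (h.onTri t) a b v

theorem extend_edge (h : X.toFlagComplex ⟶ Y.toFlagComplex) (e : S.Edge) (u : EdgeParam) :
    extend h (S.edgeMap e u) = extendEdge (S.edgeMap e) (h.onEdge e) u := by
  obtain ⟨t, i, rfl⟩ := S.edge_surjective e
  have key : ∀ (f : C(EdgeParam, S.Surface)) (hf : (S.tri t).comp (S.side t i) = f)
      (k : X.sys.obj ⟨f EdgeParam.mid⟩ ≃ₗ[R] Y.sys.obj ⟨f EdgeParam.mid⟩),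
      (∀ v, k (sideTransport X.sys t i f hf v) = sideTransport Y.sys t i f hf (h.onTri t v)) →
      extend h (f u) = extendEdge f k u := by
    rintro _ rfl k hk
    exact eq_of_heq (extendTri_heq_extendEdge t i (h.onTri t) _ rfl k hk u)
  exact key _ (S.tri_comp_side t i) _ (h.comm t i)

end Full

instance : (restriction R m S).Full where
  map_surjective {X Y} h := by
    refine ⟨⟨NatIso.ofComponents (fun s => (extend h s.as).toModuleIso) ?_, ?_⟩, ?_⟩
    · rintro ⟨x⟩ ⟨y⟩ f
      induction f using Quotient.ind with | _ γ =>
      ext v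
      exact extend_transport h γ v
    · rintro _ ⟨t, x, i, rfl, hx⟩ a
      have h₁ := X.map_flag_corner t (half_lt_corner i) hx a
      have h₂ := Y.map_flag_corner t (half_lt_corner i) hx a
      refine Eq.trans (congrArg _ h₁.symm) (Eq.trans ?_ h₂)
      exact map_extendTri t (h.onTri t) (corner i) x _ _ (h.map_flag t i a)
    · refine FlagComplex.Hom.ext (funext fun t => extendTri_center t (h.onTri t))
        (funext fun e => ?_)
      exact (extend_edge h e EdgeParam.mid).trans (extendEdge_mid _ (h.onEdge e))

end FramedLocalSystem

/-! ### Gluing a local system as a covering with discrete fibre -/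

namespace GluedTriangles

variable {S : GluedTriangles}

theorem proj_mem_image_iff {D : Set S.Pieces} (sat : ∀ p q, S.Glue p q → p ∈ D → q ∈ D)
    {p : S.Pieces} : S.proj p ∈ S.proj '' D ↔ p ∈ D := by
  constructor
  · rintro ⟨q, hq, h⟩
    rcases S.proj_eq_iff.1 h with rfl | h
    exacts [hq, sat _ _ h hq]
  · exact fun h => ⟨p, h, rfl⟩

theorem tri_mem_interiorChart {t t' : S.Tri} {x : PuncturedTriangle} {Q : Set (Fin 3 → ℝ)} :
    S.tri t x ∈ S.proj '' interiorChart t' Q ↔ t = t' ∧ (∀ k, 0 < x.1 k) ∧ x.1 ∈ Q :=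
  proj_mem_image_iff (p := ⟨t, x⟩) (interiorChart_saturated t' Q)

theorem tri_mem_starChart {t : S.Tri} {e : S.Edge} {x : PuncturedTriangle} :
    S.tri t x ∈ S.proj '' starChart e Set.univ ↔
      ∃ i, S.edge t i = e ∧ ∀ k, k ≠ i → x.1 i < x.1 k := by
  refine (proj_mem_image_iff (p := ⟨t, x⟩) (starChart_saturated e Set.univ)).trans ?_
  simp [starChart]

theorem exists_tri (s : S.Surface) : ∃ t x, S.tri t x = s := by
  obtain ⟨⟨t, x⟩, h⟩ := S.isQuotientMap_proj.surjective s
  exact ⟨t, x, h⟩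

/-- The part of the interior of the triangle `t` that is nearest to the side `i`. -/
def sector (t : S.Tri) (i : Fin 3) : Set S.Surface :=
  S.proj '' interiorChart t {x | ∀ k, k ≠ i → x i < x k}

theorem tri_mem_sector {t t' : S.Tri} {i : Fin 3} {x : PuncturedTriangle} :
    S.tri t x ∈ sector t' i ↔ t = t' ∧ (∀ k, 0 < x.1 k) ∧ ∀ k, k ≠ i → x.1 i < x.1 k :=
  tri_mem_interiorChart

theorem isOpen_sector (t : S.Tri) (i : Fin 3) : IsOpen (sector t i) := by
  refine isOpen_image_proj (isOpen_interiorChart t ?_) (interiorChart_saturated t _)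
  simp only [Set.ofPred_forall]
  exact isOpen_iInter_of_finite fun k => isOpen_iInter_of_finite fun _ =>
    isOpen_lt (continuous_apply i) (continuous_apply k)

end GluedTriangles

open GluedTriangles

section Bundle

variable {R : Type u} [DivisionRing R] {S : GluedTriangles} {F : Type u} [AddCommGroup F]
  [Module R F] (φ : S.Tri → Fin 3 → F ≃ₗ[R] F)

open Classical in
/-- The gluing isomorphism of the nearest side, at the points inside the triangles. -/
noncomputable def nearestGlue (s : S.Surface) : F ≃ₗ[R] F :=
  if h : ∃ a : S.Tri × Fin 3, s ∈ sector a.1 a.2 then φ h.choose.1 h.choose.2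
  else LinearEquiv.refl R F

/-- Distinct sectors are disjoint: the triangle of an interior point is unique, and so is a strictly
nearest side. -/
theorem nearestGlue_of_mem {s : S.Surface} {t : S.Tri} {i : Fin 3} (h : s ∈ sector t i) :
    nearestGlue φ s = φ t i := by
  have h' : ∃ a : S.Tri × Fin 3, s ∈ sector a.1 a.2 := ⟨(t, i), h⟩
  rw [nearestGlue, dif_pos h']
  obtain ⟨t₀, x, rfl⟩ := exists_tri s
  obtain ⟨h₁, -, h₂⟩ := tri_mem_sector.1 h
  obtain ⟨h₃, -, h₄⟩ := tri_mem_sector.1 h'.choose_spec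
  exact congrArg₂ φ (h₃.symm.trans h₁) (eq_of_nearest h₄ h₂)

/-- Here the default value matters: on an edge the standard coordinate is already that of the star.
-/
theorem nearestGlue_of_zero {t : S.Tri} {i : Fin 3} {x : PuncturedTriangle} (h : x.1 i = 0) :
    nearestGlue φ (S.tri t x) = LinearEquiv.refl R F := by
  rw [nearestGlue, dif_neg]
  rintro ⟨a, ha⟩
  exact ((tri_mem_sector.1 ha).2.1 i).ne' h

/-- The change of coordinates from a chart to the standard chart. -/
noncomputable def chartGlue (a : S.Tri ⊕ S.Edge) (s : S.Surface) : F ≃ₗ[R] F :=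
  a.elim (fun _ => LinearEquiv.refl R F) (fun _ => nearestGlue φ s)

/-- The base sets of the charts. -/
def chartSet (a : S.Tri ⊕ S.Edge) : Set S.Surface :=
  a.elim (fun t => S.proj '' interiorChart t Set.univ) (fun e => S.proj '' starChart e Set.univ)

theorem isOpen_chartSet (a : S.Tri ⊕ S.Edge) : IsOpen (chartSet a) := by
  rcases a with t | e
  · exact isOpen_image_proj (isOpen_interiorChart t isOpen_univ) (interiorChart_saturated t _)
  · exact isOpen_image_proj (isOpen_starChart e isOpen_univ) (starChart_saturated e _)

/-- Preferring interiors fixes the standard coordinate: that of the triangle at interior points,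
that of the star at points of edges. -/
theorem exists_mem_chartSet (s : S.Surface) : ∃ a, s ∈ chartSet a ∧
    ((∃ t, s ∈ S.proj '' interiorChart t Set.univ) → a.isLeft) := by
  by_cases h : ∃ t, s ∈ S.proj '' interiorChart t Set.univ
  · obtain ⟨t, ht⟩ := h
    exact ⟨Sum.inl t, ht, fun _ => rfl⟩
  · obtain ⟨t, x, rfl⟩ := exists_tri s
    have hx : ¬ ∀ k, 0 < x.1 k := fun hx => h ⟨t, tri_mem_interiorChart.2 ⟨rfl, hx, trivial⟩⟩
    obtain ⟨i, hi⟩ := exists_zero_of_not_interior hx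
    exact ⟨Sum.inr (S.edge t i), tri_mem_starChart.2 ⟨i, rfl, nearest_of_zero hi⟩,
      fun h' => absurd h' h⟩

/-- A chart around a point, which is the interior of a triangle whenever possible. -/
noncomputable def surfaceChart (s : S.Surface) : S.Tri ⊕ S.Edge := (exists_mem_chartSet s).choose

theorem mem_surfaceChart (s : S.Surface) : s ∈ chartSet (surfaceChart s) :=
  (exists_mem_chartSet s).choose_spec.1

theorem surfaceChart_of_interior {t : S.Tri} {x : PuncturedTriangle} (hx : ∀ k, 0 < x.1 k) :
    ∃ t', surfaceChart (S.tri t x) = Sum.inl t' := by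
  have h := (exists_mem_chartSet (S.tri t x)).choose_spec.2
    ⟨t, tri_mem_interiorChart.2 ⟨rfl, hx, trivial⟩⟩
  exact Sum.isLeft_iff.1 h

theorem surfaceChart_of_zero {t : S.Tri} {i : Fin 3} {x : PuncturedTriangle} (hi : x.1 i = 0) :
    ∃ e, surfaceChart (S.tri t x) = Sum.inr e := by
  rcases h : surfaceChart (S.tri t x) with t' | e
  · have := mem_surfaceChart (S.tri t x)
    rw [h] at this
    exact absurd hi ((tri_mem_interiorChart.1 this).2.1 i).ne'
  · exact ⟨e, rfl⟩

theorem chartGlue_surfaceChart (s : S.Surface) :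
    chartGlue φ (surfaceChart s) s = LinearEquiv.refl R F := by
  obtain ⟨t, x, rfl⟩ := exists_tri s
  by_cases hx : ∀ k, 0 < x.1 k
  · obtain ⟨t', h⟩ := surfaceChart_of_interior (t := t) hx
    rw [h]
    rfl
  · obtain ⟨i, hi⟩ := exists_zero_of_not_interior hx
    obtain ⟨e, h⟩ := surfaceChart_of_zero (t := t) hi
    rw [h]
    exact nearestGlue_of_zero φ hi

/-- Only a triangle and a star give a nontrivial transition. A common point lies in an open sector,
where the transition is the constant gluing map or its inverse. Local constancy is what continuity
requires for a discrete fibre. -/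
theorem eventually_chartGlue (a b : S.Tri ⊕ S.Edge) {s₀ : S.Surface} (ha : s₀ ∈ chartSet a)
    (hb : s₀ ∈ chartSet b) : ∃ g : F ≃ₗ[R] F, ∀ᶠ s in 𝓝 s₀, ∀ v,
      chartGlue φ b s ((chartGlue φ a s).symm v) = g v := by
  have key : ∀ t e, s₀ ∈ chartSet (Sum.inl t : S.Tri ⊕ S.Edge) → s₀ ∈ chartSet (Sum.inr e) →
      ∃ i, ∀ᶠ s in 𝓝 s₀, nearestGlue φ s = φ t i := by
    intro t e ht he
    obtain ⟨t', x, rfl⟩ := exists_tri s₀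
    obtain ⟨rfl, hx, -⟩ := tri_mem_interiorChart.1 ht
    obtain ⟨i, -, hi⟩ := tri_mem_starChart.1 he
    refine ⟨i, ?_⟩
    filter_upwards [(isOpen_sector t' i).mem_nhds (tri_mem_sector.2 ⟨rfl, hx, hi⟩)] with s hs
    exact nearestGlue_of_mem φ hs
  rcases a with t | e <;> rcases b with t' | e'
  · exact ⟨LinearEquiv.refl R F, Filter.Eventually.of_forall fun _ _ => rfl⟩
  · obtain ⟨i, h⟩ := key t e' ha hb
    refine ⟨φ t i, h.mono fun s hs v => ?_⟩
    rw [← hs]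
    rfl
  · obtain ⟨i, h⟩ := key t' e hb ha
    refine ⟨(φ t' i).symm, h.mono fun s hs v => ?_⟩
    rw [← hs]
    rfl
  · exact ⟨LinearEquiv.refl R F, Filter.Eventually.of_forall fun s v =>
      (nearestGlue φ s).apply_symm_apply v⟩

/-- The flat trivialization of the glued local system on a triangle. -/
noncomputable def flatFrame (t : S.Tri) (x : PuncturedTriangle) : F ≃ₗ[R] F :=
  if h : ∃ i, x.1 i = 0 then φ t h.choose else LinearEquiv.refl R F

theorem flatFrame_of_zero (t : S.Tri) {x : PuncturedTriangle} {i : Fin 3} (h : x.1 i = 0) :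
    flatFrame φ t x = φ t i := by
  have h' : ∃ i, x.1 i = 0 := ⟨i, h⟩
  rw [flatFrame, dif_pos h', eq_of_zero h h'.choose_spec]

theorem flatFrame_of_interior (t : S.Tri) {x : PuncturedTriangle} (h : ∀ k, 0 < x.1 k) :
    flatFrame φ t x = LinearEquiv.refl R F := by
  rw [flatFrame, dif_neg]
  rintro ⟨i, hi⟩
  exact (h i).ne' hi

variable [TopologicalSpace F] [DiscreteTopology F]

/-- The bundle with discrete fibre glued by the isomorphisms `φ`. -/
noncomputable def gluedBundle : FiberBundleCore (S.Tri ⊕ S.Edge) S.Surface F where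
  baseSet := chartSet
  isOpen_baseSet := isOpen_chartSet
  indexAt := surfaceChart
  mem_baseSet_at := mem_surfaceChart
  coordChange a b s v := chartGlue φ b s ((chartGlue φ a s).symm v)
  coordChange_self a s _ v := (chartGlue φ a s).apply_symm_apply v
  coordChange_comp a b c s _ v := by rw [LinearEquiv.symm_apply_apply]
  continuousOn_coordChange a b := by
    rintro ⟨s₀, v₀⟩ ⟨⟨ha, hb⟩, -⟩
    obtain ⟨g, hg⟩ := eventually_chartGlue φ a b ha hb
    refine ContinuousAt.continuousWithinAt ?_
    have h : ContinuousAt (fun p : S.Surface × F => g p.2) (s₀, v₀) :=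
      (continuous_of_discreteTopology.comp continuous_snd).continuousAt
    refine h.congr ?_
    filter_upwards [(continuous_fst.tendsto (s₀, v₀)).eventually hg] with p hp
    exact (hp p.2).symm

/-- The point of the total space with given fibre coordinate. -/
noncomputable def bundlePoint (s : S.Surface) (v : F) : (gluedBundle φ).TotalSpace := ⟨s, v⟩

/-- The fibre coordinate of `bundlePoint` is the standard one, and by `chartGlue_surfaceChart` the
change from the chart selected at a point to the standard one is trivial at that point. -/
theorem continuousAt_bundlePoint_iff {A : Type*} [TopologicalSpace A] {f : A → S.Surface}
    {v : A → F} {a₀ : A} : ContinuousAt (fun a => bundlePoint φ (f a) (v a)) a₀ ↔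
      ContinuousAt f a₀ ∧ ContinuousAt (fun a => chartGlue φ (surfaceChart (f a₀)) (f a) (v a)) a₀ := by
  rw [FiberBundle.continuousAt_totalSpace]
  refine and_congr Iff.rfl (iff_of_eq ?_)
  congr 1
  funext a
  change chartGlue φ (surfaceChart (f a₀)) (f a) ((chartGlue φ (surfaceChart (f a)) (f a)).symm (v a)) = _
  rw [chartGlue_surfaceChart]
  rfl

/-- Sums of lifts of a path are lifts; with the analogous fact for multiples this makes the
monodromy linear. -/
theorem continuous_bundlePoint_add {A : Type*} [TopologicalSpace A] {f : A → S.Surface}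
    {v w : A → F} (hv : Continuous fun a => bundlePoint φ (f a) (v a))
    (hw : Continuous fun a => bundlePoint φ (f a) (w a)) :
    Continuous fun a => bundlePoint φ (f a) (v a + w a) := by
  rw [continuous_iff_continuousAt] at hv hw ⊢
  intro a₀
  obtain ⟨hf, hv'⟩ := (continuousAt_bundlePoint_iff φ).1 (hv a₀)
  obtain ⟨-, hw'⟩ := (continuousAt_bundlePoint_iff φ).1 (hw a₀)
  refine (continuousAt_bundlePoint_iff φ).2 ⟨hf, ?_⟩
  simp only [map_add]
  have : ContinuousAdd F := ⟨continuous_of_discreteTopology⟩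
  exact hv'.add hw'

theorem continuous_bundlePoint_smul {A : Type*} [TopologicalSpace A] {f : A → S.Surface}
    {v : A → F} (c : R) (hv : Continuous fun a => bundlePoint φ (f a) (v a)) :
    Continuous fun a => bundlePoint φ (f a) (c • v a) := by
  rw [continuous_iff_continuousAt] at hv ⊢
  intro a₀
  obtain ⟨hf, hv'⟩ := (continuousAt_bundlePoint_iff φ).1 (hv a₀)
  refine (continuousAt_bundlePoint_iff φ).2 ⟨hf, ?_⟩
  simp only [map_smul]
  exact (continuous_of_discreteTopology (f := fun v : F => c • v)).continuousAt.comp hv'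

theorem isCoveringMap_gluedBundle :
    IsCoveringMap (Bundle.TotalSpace.proj : (gluedBundle φ).TotalSpace → S.Surface) :=
  FiberBundle.isCoveringMap (F := F) (E := (gluedBundle φ).Fiber)

theorem bundlePoint_snd {z : (gluedBundle φ).TotalSpace} {s : S.Surface} (h : z.1 = s) :
    bundlePoint φ s z.2 = z := by
  subst h
  rfl

/-- The monodromy of the glued bundle, as a map of the fibre. -/
noncomputable def fiberMonodromy {x y : S.Surface} (γ : Path.Homotopic.Quotient x y) (v : F) : F :=
  ((isCoveringMap_gluedBundle φ).monodromy γ ⟨bundlePoint φ x v, rfl⟩).1.2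

theorem monodromy_eq {x y : S.Surface} (γ : Path.Homotopic.Quotient x y) (v : F) :
    (isCoveringMap_gluedBundle φ).monodromy γ ⟨bundlePoint φ x v, rfl⟩ =
      ⟨bundlePoint φ y (fiberMonodromy φ γ v), rfl⟩ :=
  Subtype.ext (bundlePoint_snd φ ((isCoveringMap_gluedBundle φ).monodromy γ _).2).symm

/-- Uniqueness of path lifting: any continuous lift computes the monodromy. -/
theorem fiberMonodromy_of_lift {x y : S.Surface} (γ : Path x y) (w : I → F)
    (hw : Continuous fun s => bundlePoint φ (γ s) (w s)) :
    fiberMonodromy φ (Path.Homotopic.Quotient.mk γ) (w 0) = w 1 := by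
  have h : (fun s => bundlePoint φ (γ s) (w s)) = (isCoveringMap_gluedBundle φ).liftPath γ
      (bundlePoint φ x (w 0)) γ.source :=
    ((isCoveringMap_gluedBundle φ).eq_liftPath_iff γ.source).2 ⟨hw, rfl, by simp only [γ.source]⟩
  have h₁ := congrFun h 1
  exact congrArg (fun z : (gluedBundle φ).TotalSpace => (z.2 : F)) h₁.symm

theorem exists_lift {x y : S.Surface} (γ : Path x y) (v : F) :
    ∃ w : I → F, w 0 = v ∧ Continuous fun s => bundlePoint φ (γ s) (w s) := by
  let Γ := (isCoveringMap_gluedBundle φ).liftPath γ (bundlePoint φ x v) γ.source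
  have h := (isCoveringMap_gluedBundle φ).liftPath_lifts γ (bundlePoint φ x v) γ.source
  have h₀ := (isCoveringMap_gluedBundle φ).liftPath_zero γ (bundlePoint φ x v) γ.source
  refine ⟨fun s => (Γ s).2, congrArg (fun z : (gluedBundle φ).TotalSpace => (z.2 : F)) h₀, ?_⟩
  refine Γ.continuous.congr fun s => ?_
  exact (bundlePoint_snd φ (congrFun h s)).symm

/-- The monodromy of the glued bundle, as a linear map. -/
noncomputable def fiberTransport {x y : S.Surface} (γ : Path.Homotopic.Quotient x y) :
    F →ₗ[R] F where
  toFun := fiberMonodromy φ γ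
  map_add' v v' := by
    induction γ using Quotient.ind with | _ γ =>
    obtain ⟨w, rfl, hw⟩ := exists_lift φ γ v
    obtain ⟨w', rfl, hw'⟩ := exists_lift φ γ v'
    have h₁ := fiberMonodromy_of_lift φ γ w hw
    have h₂ := fiberMonodromy_of_lift φ γ w' hw'
    have h₃ := fiberMonodromy_of_lift φ γ _ (continuous_bundlePoint_add φ hw hw')
    exact h₃.trans (congrArg₂ _ h₁.symm h₂.symm)
  map_smul' c v := by
    induction γ using Quotient.ind with | _ γ =>
    obtain ⟨w, rfl, hw⟩ := exists_lift φ γ v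
    have h₁ := fiberMonodromy_of_lift φ γ w hw
    have h₃ := fiberMonodromy_of_lift φ γ _ (continuous_bundlePoint_smul φ c hw)
    exact h₃.trans (congrArg _ h₁.symm)

/-- The local system glued by the isomorphisms `φ`. -/
noncomputable def gluedSystem : FundamentalGroupoid S.Surface ⥤ ModuleCat.{u} R where
  obj _ := ModuleCat.of R F
  map γ := ModuleCat.ofHom (fiberTransport φ γ)
  map_id x := by
    ext v
    have h := congrFun ((isCoveringMap_gluedBundle φ).monodromy_refl (x := x.as))
      ⟨bundlePoint φ x.as v, rfl⟩
    exact congrArg (fun z : (gluedBundle φ).TotalSpace => (z.2 : F)) (congrArg Subtype.val h)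
  map_comp {x y z} γ δ := by
    ext v
    have h := (isCoveringMap_gluedBundle φ).monodromy_trans_apply γ δ ⟨bundlePoint φ x.as v, rfl⟩
    rw [monodromy_eq φ γ v] at h
    exact congrArg (fun z : (gluedBundle φ).TotalSpace => (z.2 : F)) (congrArg Subtype.val h)

/-- Near a point of the side `i`, the coordinate in the star is constantly `φ t i v`: at interior
points the factor `φ t i` comes from the chart, on the side it comes from the frame. -/
theorem continuous_flatFrame (t : S.Tri) (v : F) :
    Continuous fun x => bundlePoint φ (S.tri t x) (flatFrame φ t x v) := by
  rw [continuous_iff_continuousAt]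
  intro x₀
  refine (continuousAt_bundlePoint_iff φ).2 ⟨(S.tri t).continuous.continuousAt, ?_⟩
  by_cases hx : ∀ k, 0 < x₀.1 k
  · obtain ⟨t', ht⟩ := surfaceChart_of_interior (t := t) hx
    rw [ht]
    refine ContinuousAt.congr (continuousAt_const (y := v)) ?_
    filter_upwards [isOpen_interior.mem_nhds hx] with x hx
    rw [flatFrame_of_interior φ t hx]
    rfl
  · obtain ⟨i, hi⟩ := exists_zero_of_not_interior hx
    obtain ⟨e, he⟩ := surfaceChart_of_zero (t := t) hi
    rw [he]
    refine ContinuousAt.congr (continuousAt_const (y := φ t i v)) ?_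
    filter_upwards [(isOpen_nearest i).mem_nhds (nearest_of_zero hi)] with x hx
    change φ t i v = nearestGlue φ (S.tri t x) (flatFrame φ t x v)
    by_cases hx' : ∀ k, 0 < x.1 k
    · rw [flatFrame_of_interior φ t hx', nearestGlue_of_mem φ (tri_mem_sector.2 ⟨rfl, hx', hx⟩)]
      rfl
    · obtain ⟨j, hj⟩ := exists_zero_of_not_interior hx'
      obtain rfl := eq_of_nearest hx (nearest_of_zero hj)
      rw [flatFrame_of_zero φ t hj, nearestGlue_of_zero φ hj]
      rfl

theorem transport_gluedSystem (t : S.Tri) {a b : PuncturedTriangle} (γ : Path a b) (v : F) :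
    transport (gluedSystem φ) (γ.map (S.tri t).continuous) (flatFrame φ t a v) =
      flatFrame φ t b v := by
  have h := fiberMonodromy_of_lift φ (γ.map (S.tri t).continuous)
    (fun s => flatFrame φ t (γ s) v) ((continuous_flatFrame φ t v).comp γ.continuous)
  simp only [γ.source, γ.target] at h
  exact h

end Bundle

/-! ### The framing of the glued local system -/

section GluedFraming

variable {R : Type u} [DivisionRing R] {m : ℕ} {S : GluedTriangles} {F : Type u} [AddCommGroup F]
  [Module R F] (φ : S.Tri → Fin 3 → F ≃ₗ[R] F) (A : S.Tri → Fin 3 → FullFlag R F m)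

/-- The flag at a point near a puncture in the glued local system. -/
noncomputable def gluedFlag (s : S.Surface) (h : s ∈ S.nearPunctures) : FullFlag R F m :=
  (A h.choose h.choose_spec.choose_spec.choose).map
    (flatFrame φ h.choose h.choose_spec.choose)

/-- The flags at the vertices of the triangles agree along the edges. -/
def FlagsCompatible : Prop :=
  ∀ t i t' i', S.edge t i = S.edge t' i' → ∀ a,
    ((A t (S.head t i)).space a).map (φ t i).toLinearMap =
      ((A t' (S.head t' i')).space a).map (φ t' i').toLinearMap ∧
    ((A t (S.tail t i)).space a).map (φ t i).toLinearMap =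
      ((A t' (S.tail t' i')).space a).map (φ t' i').toLinearMap

variable {φ A} (hA : FlagsCompatible φ A)
include hA

/-- Makes the flag independent of the representative. A glued point near a puncture lies on a side
and its large coordinate is at the head or at the tail; gluing preserves which, and compatibility of
the flags at that end applies. -/
theorem map_flatFrame_eq {t t' : S.Tri} {x x' : PuncturedTriangle} {i i' : Fin 3}
    (h : S.triMap t x = S.triMap t' x') (hi : 1 / 2 < x.1 i) (hi' : 1 / 2 < x'.1 i')
    (a : Fin (m + 1)) :
    ((A t i).space a).map (flatFrame φ t x).toLinearMap =
      ((A t' i').space a).map (flatFrame φ t' x').toLinearMap := by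
  rcases S.proj_eq_iff.1 h with h | h
  · obtain ⟨⟩ := h
    rw [eq_of_half_lt hi hi']
  · obtain ⟨j, j', hj, hj', -⟩ := id h
    obtain ⟨he, hh, ht⟩ := head_eq_of_glue h hj hj'
    dsimp only at hj hj' he hh ht
    rw [flatFrame_of_zero φ t hj, flatFrame_of_zero φ t' hj']
    have hij : i ≠ j := by
      rintro rfl
      rw [hj] at hi
      norm_num at hi
    rcases S.eq_head_or_eq_tail t hij with rfl | rfl
    · obtain rfl := eq_of_half_lt hi' (hi.trans_eq hh)
      exact (hA t j t' j' he a).1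
    · obtain rfl := eq_of_half_lt hi' (hi.trans_eq ht)
      exact (hA t j t' j' he a).2

theorem gluedFlag_tri (t : S.Tri) {x : PuncturedTriangle} {i : Fin 3} (hi : 1 / 2 < x.1 i)
    (h : S.triMap t x ∈ S.nearPunctures) (a : Fin (m + 1)) :
    (gluedFlag φ A (S.triMap t x) h).space a =
      ((A t i).space a).map (flatFrame φ t x).toLinearMap := by
  have h₁ := h.choose_spec.choose_spec.choose_spec
  exact (map_flatFrame_eq hA h₁.1 hi h₁.2 a).symm

variable [TopologicalSpace F] [DiscreteTopology F]

omit hA in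
theorem map_transport_gluedSystem (t : S.Tri) {x y : PuncturedTriangle} (γ : Path x y)
    (W : Submodule R F) :
    (W.map (flatFrame φ t x).toLinearMap).map
      (transport (gluedSystem φ) (γ.map (S.tri t).continuous)) =
    W.map (flatFrame φ t y).toLinearMap := by
  have h : (transport (gluedSystem φ) (γ.map (S.tri t).continuous) : F →ₗ[R] F) ∘ₗ
      (flatFrame φ t x).toLinearMap = (flatFrame φ t y).toLinearMap :=
    LinearMap.ext (transport_gluedSystem φ t γ)
  rw [← h]
  exact (Submodule.map_comp _ _ _).symm

theorem map_transport_gluedFlag {x y : S.Surface} (hx : x ∈ S.nearPunctures)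
    (hy : y ∈ S.nearPunctures) (γ : Path x y) (hγ : ∀ s, γ s ∈ S.nearPunctures)
    (a : Fin (m + 1)) :
    Submodule.map (transport (gluedSystem φ) γ) ((gluedFlag φ A x hx).space a) =
      (gluedFlag φ A y hy).space a := by
  -- The membership proofs are quantified inside, so that the property depends on the path alone, as
  -- `path_property_nearPunctures` requires.
  have key : ∃ hx hy, Submodule.map (transport (gluedSystem φ) γ) ((gluedFlag φ A x hx).space a) =
      (gluedFlag φ A y hy).space a := by
    refine path_property_nearPunctures (P := fun {x y} γ => ∃ hx hy,
      Submodule.map (transport (gluedSystem φ) γ) ((gluedFlag φ A x hx).space a) =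
        (gluedFlag φ A y hy).space a) ?_ ?_ ?_ γ hγ
    · rintro x y γ δ h ⟨hx, hy, h'⟩
      exact ⟨hx, hy, by rw [← transport_congr _ h, h']⟩
    · rintro x y z γ δ ⟨hx, hy, h₁⟩ ⟨_, hz, h₂⟩
      refine ⟨hx, hz, ?_⟩
      rw [transport_trans, ← h₂, ← h₁]
      exact Submodule.map_comp _ _ _
    · intro t i p q ε hε x y δ hδ
      obtain rfl : x = S.tri t p := by
        have := hδ 0; rwa [δ.source, ε.source] at this
      obtain rfl : y = S.tri t q := by
        have := hδ 1; rwa [δ.target, ε.target] at this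
      obtain rfl : δ = ε.map (S.tri t).continuous := Path.ext (funext hδ)
      have hp : 1 / 2 < p.1 i := by simpa using hε 0
      have hq : 1 / 2 < q.1 i := by simpa using hε 1
      refine ⟨S.triMap_mem_nearPunctures t hp, S.triMap_mem_nearPunctures t hq, ?_⟩
      refine (congrArg _ (gluedFlag_tri hA t hp _ a)).trans
        (Eq.trans ?_ (gluedFlag_tri hA t hq _ a).symm)
      exact map_transport_gluedSystem t ε _
  obtain ⟨_, _, h⟩ := key
  exact h

/-- The glued local system, with its framing. -/
noncomputable def gluedFramedSystem [Module.Finite R F] (hF : Module.finrank R F = m)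
    (hgen : ∀ t, GenericTriple R fun i => (A t i).space) : FramedLocalSystem R m S where
  sys := gluedSystem φ
  finite _ := inferInstanceAs (Module.Finite R F)
  finrank _ := hF
  flag x hx := gluedFlag φ A x hx
  flat hx hy γ h i := map_transport_gluedFlag hA hx hy γ h i
  generic t x hx y γ := by
    have h := (hgen t).map (flatFrame φ t y)
    refine (congrArg (GenericTriple (V := F) R) ?_).mpr h
    funext i a
    refine (congrArg _ (gluedFlag_tri hA t (hx i) _ a)).trans ?_
    exact map_transport_gluedSystem t (γ i) _

omit hA in
theorem transportAlong_gluedSystem (t : S.Tri) (x y : PuncturedTriangle) (v : F) :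
    transportAlong (gluedSystem φ) (S.tri t) x y (flatFrame φ t x v) = flatFrame φ t y v :=
  transport_gluedSystem φ t _ v

-- The flat frame is the identity at the barycentre and `φ t i` on the side, so the glued system
-- gives back the prescribed gluing.
omit hA in
theorem sideTransport_gluedSystem (t : S.Tri) (i : Fin 3) (f : C(EdgeParam, S.Surface))
    (hf : (S.tri t).comp (S.side t i) = f) (v : F) :
    sideTransport (gluedSystem φ) t i f hf v = φ t i v := by
  subst hf
  have h := transportAlong_gluedSystem (φ := φ) t center (S.side t i EdgeParam.mid) v
  rw [flatFrame_of_interior φ t (x := center) (fun k => by simp [center]),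
    flatFrame_of_zero φ t (x := S.side t i EdgeParam.mid) (S.sidePt_self t i _)] at h
  exact h

end GluedFraming

section EssSurj

variable {R : Type u} [DivisionRing R] {m : ℕ} {S : GluedTriangles}

instance : (FramedLocalSystem.restriction R m S).EssSurj where
  mem_essImage D := by
    let F := Fin m → R
    have hF : Module.finrank R F = m := Module.finrank_fin_fun R
    let _ : TopologicalSpace F := ⊥
    have : DiscreteTopology F := ⟨rfl⟩
    have ht : ∀ t, Nonempty (D.onTri t ≃ₗ[R] F) := fun t => by
      have := (D.triFlag t 0).finite
      exact ⟨LinearEquiv.ofFinrankEq _ _ ((D.triFlag t 0).finrank_eq.trans hF.symm)⟩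
    have he : ∀ e, Nonempty (D.onEdge e ≃ₗ[R] F) := fun e => by
      have := (D.headFlag e).finite
      exact ⟨LinearEquiv.ofFinrankEq _ _ ((D.headFlag e).finrank_eq.trans hF.symm)⟩
    let α := fun t => (ht t).some
    let β := fun e => (he e).some
    -- The gluing maps of `D`, read in coordinates chosen once for every triangle and every edge.
    let φ : S.Tri → Fin 3 → F ≃ₗ[R] F := fun t i =>
      ((α t).symm.trans (D.glue t i)).trans (β (S.edge t i))
    let A : S.Tri → Fin 3 → FullFlag R F m := fun t i => (D.triFlag t i).map (α t)
    have hφ : ∀ t i k a, ((A t k).space a).map (φ t i).toLinearMap =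
        (((D.triFlag t k).space a).map (D.glue t i).toLinearMap).map
          (β (S.edge t i)).toLinearMap := by
      intro t i k a
      change Submodule.map _ (Submodule.map _ _) = _
      rw [← Submodule.map_comp, ← Submodule.map_comp]
      congr 1
      ext v
      simp [φ]
    have hA : FlagsCompatible φ A := by
      intro t i t' i' h a
      simp only [hφ]
      constructor
      · rw [D.map_head, D.map_head, h]
      · rw [D.map_tail, D.map_tail, h]
    have hgen : ∀ t, GenericTriple R fun i => (A t i).space := fun t => (D.generic t).map (α t)
    let X := gluedFramedSystem hA hF hgen
    have hcenter : ∀ t, flatFrame φ t center = LinearEquiv.refl R F := fun t =>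
      flatFrame_of_interior φ t (x := center) (fun k => by simp [center])
    let f : D ⟶ (FramedLocalSystem.restriction R m S).obj X :=
      { onTri := α
        onEdge := β
        comm := fun t i v => by
          refine Eq.trans ?_ (sideTransport_gluedSystem t i _ (S.tri_comp_side t i) (α t v)).symm
          exact (congrArg (fun w => β (S.edge t i) (D.glue t i w))
            ((α t).symm_apply_apply v)).symm
        map_flag := fun t i a => by
          refine Eq.symm ?_
          change Submodule.map (transport (gluedSystem φ)
            ((PathConnectedSpace.somePath (corner i) center).map (S.tri t).continuous))
              ((gluedFlag φ A (S.triMap t (corner i)) _).space a) = _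
          refine (congrArg _ (gluedFlag_tri hA t (half_lt_corner i) _ a)).trans ?_
          refine (map_transport_gluedSystem t _ _).trans ?_
          rw [hcenter]
          exact Submodule.map_id _ }
    exact ⟨X, ⟨((Groupoid.isoEquivHom _ _).symm f).symm⟩⟩

instance : (FramedLocalSystem.restriction R m S).IsEquivalence where

end EssSurj

/-! ### Opposite pairs and generic triples of flags -/

section FlagSub

variable {R : Type u} [DivisionRing R] {V W : Type*} [AddCommGroup V] [Module R V]
  [AddCommGroup W] [Module R W] {m : ℕ}

/-- The subspace of codimension `k` of a flag; it is `0` for `k ≥ m`. -/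
def FullFlag.sub (F : FullFlag R V m) (k : ℕ) : Submodule R V :=
  F.space ⟨min k m, Nat.lt_succ_of_le (min_le_right k m)⟩

namespace FullFlag

variable (F : FullFlag R V m)

theorem sub_coe (a : Fin (m + 1)) : F.sub a = F.space a :=
  congrArg F.space (Fin.ext (min_eq_left (Nat.le_of_lt_succ a.2)))

theorem sub_zero : F.sub 0 = ⊤ :=
  (F.sub_coe 0).trans F.space_zero

theorem sub_eq_bot {k : ℕ} (h : m ≤ k) : F.sub k = ⊥ := by
  rw [← F.space_last]
  exact congrArg F.space (Fin.ext (min_eq_right h))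

theorem sub_antitone : Antitone F.sub := fun _ _ h => F.antitone (min_le_min_right m h)

theorem finrank_sub (k : ℕ) : Module.finrank R (F.sub k) = m - k := by
  have := F.finite
  have h₁ := (F.sub k).finrank_quotient_add_finrank
  have h₂ : Module.finrank R (V ⧸ F.sub k) = min k m := F.codim _
  rw [F.finrank_eq] at h₁
  omega

theorem map_sub_of_map_space {F : FullFlag R V m} {G : FullFlag R W m} {e : V →ₗ[R] W}
    (h : ∀ a, (F.space a).map e = G.space a) (k : ℕ) : (F.sub k).map e = G.sub k := h _

/-- Two flags are opposite if their subspaces of complementary dimension intersect trivially. -/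
def Opposite (G H : FullFlag R V m) : Prop := ∀ a b, a + b = m → G.sub a ⊓ H.sub b = ⊥

theorem Opposite.symm {G H : FullFlag R V m} (h : Opposite G H) : Opposite H G :=
  fun a b hab => by rw [inf_comm, h b a (by omega)]

section Adapted

variable {G H : FullFlag R V m} (hGH : Opposite G H) {b : Fin m → V} (hb : ∀ k, b k ≠ 0)
  (hG : ∀ k : Fin m, b k ∈ G.sub k) (hH : ∀ k : Fin m, b k ∈ H.sub (m - 1 - k))

include hGH hb hG hH

/-- Descending induction on `a`. The vector `b a` lies in `H.sub (m - 1 - a)`, which meets `G.sub (a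
+ 1)` only in 0; so it is a new vector in `G.sub a` and accounts for the one missing dimension. -/
theorem sub_eq_span (a : ℕ) : G.sub a = Submodule.span R (b '' {k : Fin m | a ≤ k}) := by
  have := G.finite
  induction h : m - a generalizing a with
  | zero =>
    rw [G.sub_eq_bot (by omega), eq_comm, Submodule.span_eq_bot]
    rintro _ ⟨k, hk, rfl⟩
    have := k.2
    simp only [Set.mem_ofPred_eq] at hk
    omega
  | succ n ih =>
    have ham : a < m := by omega
    have hmem : b ⟨a, ham⟩ ∉ G.sub (a + 1) := fun h' => by
      have h₁ : b ⟨a, ham⟩ ∈ G.sub (a + 1) ⊓ H.sub (m - 1 - a) := ⟨h', hH ⟨a, ham⟩⟩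
      rw [hGH _ _ (by omega), Submodule.mem_bot] at h₁
      exact hb _ h₁
    have hle : Submodule.span R {b ⟨a, ham⟩} ⊔ G.sub (a + 1) ≤ G.sub a :=
      sup_le ((Submodule.span_singleton_le_iff_mem _ _).2 (hG ⟨a, ham⟩))
        (G.sub_antitone a.le_succ)
    have hlt : G.sub (a + 1) < Submodule.span R {b ⟨a, ham⟩} ⊔ G.sub (a + 1) := by
      refine lt_of_le_of_ne le_sup_right fun h' => hmem ?_
      rw [h']
      exact Submodule.mem_sup_left (Submodule.mem_span_singleton_self _)
    have h₁ := Submodule.finrank_lt_finrank_of_lt hlt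
    have h₂ : Submodule.span R {b ⟨a, ham⟩} ⊔ G.sub (a + 1) = G.sub a := by
      refine Submodule.eq_of_le_of_finrank_le hle ?_
      rw [G.finrank_sub] at h₁ ⊢
      omega
    rw [← h₂, ih (a + 1) (by omega), ← Submodule.span_union]
    congr 1
    ext v
    constructor
    · rintro (rfl | ⟨k, hk, rfl⟩)
      · exact ⟨⟨a, ham⟩, le_refl a, rfl⟩
      · exact ⟨k, (Nat.le_succ a).trans hk, rfl⟩
    · rintro ⟨k, hk, rfl⟩
      rcases Nat.eq_or_lt_of_le hk with rfl | hk
      · exact Or.inl rfl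
      · exact Or.inr ⟨k, hk, rfl⟩

/-- Reversing the order of the vectors exchanges the two flags. -/
theorem sub_eq_span' (a : ℕ) : H.sub a = Submodule.span R (b '' {k : Fin m | a ≤ m - 1 - k}) := by
  have h := sub_eq_span (b := fun k => b k.rev) hGH.symm (fun k => hb _)
    (fun k => by
      have := hH k.rev
      rw [Fin.val_rev] at this
      convert this using 2
      have := k.2
      omega)
    (fun k => by
      have := hG k.rev
      rw [Fin.val_rev] at this
      convert this using 2
      have := k.2
      omega) a
  rw [h]
  congr 1
  ext v
  constructor
  · rintro ⟨k, hk, rfl⟩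
    refine ⟨k.rev, ?_, rfl⟩
    simp only [Set.mem_ofPred_eq, Fin.val_rev] at hk ⊢
    have := k.2
    omega
  · rintro ⟨k, hk, rfl⟩
    refine ⟨k.rev, ?_, by simp⟩
    simp only [Set.mem_ofPred_eq, Fin.val_rev] at hk ⊢
    have := k.2
    omega

theorem top_le_span : ⊤ ≤ Submodule.span R (Set.range b) := by
  rw [← G.sub_zero, sub_eq_span hGH hb hG hH]
  exact Submodule.span_mono (Set.image_subset_range _ _)

/-- The basis adapted to a pair of opposite flags. -/
noncomputable def adaptedBasis : Module.Basis (Fin m) R V :=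
  basisOfTopLeSpanOfCardEqFinrank b (top_le_span hGH hb hG hH)
    (by rw [Fintype.card_fin, G.finrank_eq])

theorem adaptedBasis_apply (k : Fin m) : adaptedBasis hGH hb hG hH k = b k := by
  rw [adaptedBasis, coe_basisOfTopLeSpanOfCardEqFinrank]

end Adapted

end FullFlag

/-- The intersection of the subspaces of codimension `p j` of the flags `F j`. -/
def flagInf (F : Fin 3 → FullFlag R V m) (p : Fin 3 → ℕ) : Submodule R V :=
  ⨅ j, (F j).sub (p j)

theorem mem_flagInf {F : Fin 3 → FullFlag R V m} {p : Fin 3 → ℕ} {v : V} :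
    v ∈ flagInf F p ↔ ∀ j, v ∈ (F j).sub (p j) := Submodule.mem_iInf _

theorem flagInf_antitone (F : Fin 3 → FullFlag R V m) : Antitone (flagInf F) :=
  fun _ _ h => iInf_mono fun j => (F j).sub_antitone (h j)

theorem map_flagInf {F : Fin 3 → FullFlag R V m} {G : Fin 3 → FullFlag R W m} {e : V ≃ₗ[R] W}
    (h : ∀ j a, ((F j).space a).map e.toLinearMap = (G j).space a) (p : Fin 3 → ℕ) :
    (flagInf F p).map e.toLinearMap = flagInf G p := by
  ext w
  obtain ⟨v, rfl⟩ := e.surjective w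
  have h' : ∀ U : Submodule R V, e v ∈ U.map e.toLinearMap ↔ v ∈ U := fun U =>
    (Submodule.mem_map_equiv (p := U)).trans (by rw [e.symm_apply_apply])
  rw [h', mem_flagInf, mem_flagInf]
  exact forall_congr' fun j => by
    rw [← FullFlag.map_sub_of_map_space (h j) (p j), h']

section Generic

variable {F : Fin 3 → FullFlag R V m} (hF : GenericTriple R fun i => (F i).space)
include hF

/-- The intersection is the kernel of the map to the three quotients. Genericity makes that map
surjective, so the codimensions add. -/
theorem finrank_flagInf {p : Fin 3 → ℕ} (hp : p 0 + p 1 + p 2 ≤ m) :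
    Module.finrank R (flagInf F p) = m - (p 0 + p 1 + p 2) := by
  have := (F 0).finite
  let f := ((F 0).sub (p 0)).mkQ.prod (((F 1).sub (p 1)).mkQ.prod ((F 2).sub (p 2)).mkQ)
  have hker : LinearMap.ker f = flagInf F p := by
    ext v
    simp only [f, LinearMap.ker_prod, Submodule.ker_mkQ, Submodule.mem_inf, mem_flagInf,
      Fin.forall_fin_succ, Fin.succ_zero_eq_one, Fin.succ_one_eq_two]
    simp
  have hsurj : LinearMap.range f = ⊤ := by
    refine LinearMap.range_eq_top.2 ?_
    rintro ⟨x, y, z⟩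
    obtain ⟨x, rfl⟩ := ((F 0).sub (p 0)).mkQ_surjective x
    -- Genericity requires total codimension `m`: the first index is raised from `p 0` to `m - p 1 -
    -- p 2`, and a preimage for the finer quotient also serves for the coarser one. The minima only
    -- supply the bounds.
    have h := (hF ⟨min (m - p 1 - p 2) m, by omega⟩ ⟨min (p 1) m, by omega⟩
      ⟨min (p 2) m, by omega⟩ (by dsimp only; omega)).2
    obtain ⟨v, hv⟩ := h (((F 0).sub (m - p 1 - p 2)).mkQ x, y, z)
    obtain ⟨h₁, h₂⟩ := Prod.mk.inj hv
    refine ⟨v, Prod.ext ?_ h₂⟩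
    have h₃ := (Submodule.Quotient.eq _).1 h₁
    exact (Submodule.Quotient.eq _).2 ((F 0).sub_antitone (by omega) h₃)
  have h := f.finrank_range_add_finrank_ker
  have hc : ∀ i, Module.finrank R (V ⧸ (F i).sub (p i)) = min (p i) m := fun i => (F i).codim _
  rw [hsurj, hker, finrank_top, (F 0).finrank_eq, Module.finrank_prod, Module.finrank_prod,
    hc, hc, hc] at h
  omega

theorem flagInf_eq_bot {p : Fin 3 → ℕ} (hp : p 0 + p 1 + p 2 = m) : flagInf F p = ⊥ := by
  have := (F 0).finite
  refine Submodule.finrank_eq_zero.1 ?_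
  rw [finrank_flagInf hF hp.le, hp, Nat.sub_self]

/-- Give the third flag index 0, where it imposes no condition. -/
theorem opposite_of_generic {i j : Fin 3} (hij : i ≠ j) : FullFlag.Opposite (F i) (F j) := by
  intro a b hab
  rw [eq_bot_iff, ← flagInf_eq_bot hF (p := Pi.single i a + Pi.single j b)]
  · rintro v ⟨hi, hj⟩
    refine mem_flagInf.2 fun k => ?_
    by_cases hk : k = i
    · subst hk
      simpa [Pi.single_eq_of_ne hij] using hi
    · by_cases hk' : k = j
      · subst hk'
        simpa [Pi.single_eq_of_ne hk] using hj
      · simp [Pi.single_eq_of_ne hk, Pi.single_eq_of_ne hk', FullFlag.sub_zero]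
  · fin_cases i <;> fin_cases j <;> simp at hij ⊢ <;> omega

theorem finrank_flagInf_add_single {q : Fin 3 → ℕ} (hq : q 0 + q 1 + q 2 + 2 = m) (i : Fin 3) :
    Module.finrank R (flagInf F (q + Pi.single i 1)) = 1 := by
  have h : (q + Pi.single i 1 : Fin 3 → ℕ) 0 + (q + Pi.single i 1 : Fin 3 → ℕ) 1 +
      (q + Pi.single i 1 : Fin 3 → ℕ) 2 = q 0 + q 1 + q 2 + 1 := by
    fin_cases i <;> simp <;> omega
  rw [finrank_flagInf hF (by omega), h]
  omega

/-- A common vector satisfies both raised conditions, whose indices add up to `m`. -/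
theorem disjoint_flagInf {q : Fin 3 → ℕ} (hq : q 0 + q 1 + q 2 + 2 = m) {i j : Fin 3}
    (hij : i ≠ j) : Disjoint (flagInf F (q + Pi.single i 1)) (flagInf F (q + Pi.single j 1)) := by
  rw [disjoint_iff_inf_le, ← flagInf_eq_bot hF (p := q + Pi.single i 1 + Pi.single j 1)]
  · rintro v ⟨hi, hj⟩
    rw [SetLike.mem_coe, mem_flagInf] at hi hj
    refine mem_flagInf.2 fun k => ?_
    by_cases hk : k = j
    · subst hk
      have := hj k
      simpa [Pi.single_eq_of_ne hij.symm] using this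
    · simpa [Pi.single_eq_of_ne hk] using hi k
  · fin_cases i <;> fin_cases j <;> simp at hij ⊢ <;> omega

theorem flagInf_sup_flagInf {q : Fin 3 → ℕ} (hq : q 0 + q 1 + q 2 + 2 = m) {i j : Fin 3}
    (hij : i ≠ j) :
    flagInf F (q + Pi.single i 1) ⊔ flagInf F (q + Pi.single j 1) = flagInf F q := by
  have := (F 0).finite
  have hle : ∀ i : Fin 3, flagInf F (q + Pi.single i 1) ≤ flagInf F q := fun i =>
    flagInf_antitone F (le_add_of_nonneg_right (Pi.single_nonneg.2 zero_le_one))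
  refine Submodule.eq_of_le_of_finrank_eq (sup_le (hle i) (hle j)) ?_
  have h := Submodule.finrank_sup_add_finrank_inf_eq (flagInf F (q + Pi.single i 1))
    (flagInf F (q + Pi.single j 1))
  rw [(disjoint_flagInf hF hq hij).eq_bot, finrank_bot, finrank_flagInf_add_single hF hq,
    finrank_flagInf_add_single hF hq] at h
  rw [finrank_flagInf hF (by omega)]
  omega

end Generic

/-! ### Linear relations between three lines in a plane -/

section Relations

/-- The linear relations between vectors of three subspaces. -/
def relations (L : Fin 3 → Submodule R V) : Submodule R (Fin 3 → V) where
  carrier := {f | (∀ i, f i ∈ L i) ∧ ∑ i, f i = 0}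
  add_mem' {f g} hf hg := ⟨fun i => (L i).add_mem (hf.1 i) (hg.1 i), by
    simp only [Pi.add_apply, Finset.sum_add_distrib, hf.2, hg.2, add_zero]⟩
  zero_mem' := ⟨fun i => (L i).zero_mem, by simp⟩
  smul_mem' c f hf := ⟨fun i => (L i).smul_mem c (hf.1 i), by
    simp only [Pi.smul_apply, ← Finset.smul_sum, hf.2, smul_zero]⟩

theorem mem_relations {L : Fin 3 → Submodule R V} {f : Fin 3 → V} :
    f ∈ relations L ↔ (∀ i, f i ∈ L i) ∧ ∑ i, f i = 0 := Iff.rfl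

/-- The projection of a relation to one of the subspaces. -/
def relationsProj (L : Fin 3 → Submodule R V) (i : Fin 3) : relations L →ₗ[R] L i :=
  LinearMap.codRestrict (L i) (LinearMap.proj i ∘ₗ (relations L).subtype) fun f => f.2.1 i

theorem sum_fin_three {A : Type*} [AddCommMonoid A] (f : Fin 3 → A) {i j k : Fin 3} (hij : i ≠ j)
    (hik : i ≠ k) (hjk : j ≠ k) : ∑ l, f l = f i + f j + f k := by
  have h : (Finset.univ : Finset (Fin 3)) = {i, j, k} := by
    clear * - hij hik hjk
    decide +revert
  rw [h, Finset.sum_insert (by simp [hij, hik]), Finset.sum_pair hjk, add_assoc]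

/-- If the `i`-th term vanishes, the other two are opposite vectors of disjoint subspaces, hence
zero. Conversely `v = a + b` with `a`, `b` in the other two subspaces gives the relation `(v, -a,
-b)`. -/
theorem relationsProj_bijective {L : Fin 3 → Submodule R V}
    (hd : ∀ i j, i ≠ j → Disjoint (L i) (L j))
    (hs : ∀ i j k, i ≠ j → i ≠ k → j ≠ k → L i ≤ L j ⊔ L k) (i : Fin 3) :
    Function.Bijective (relationsProj L i) := by
  obtain ⟨j, k, hij, hik, hjk⟩ : ∃ j k : Fin 3, i ≠ j ∧ i ≠ k ∧ j ≠ k := by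
    clear * -
    decide +revert
  constructor
  · rw [injective_iff_map_eq_zero]
    rintro ⟨f, hf⟩ h
    have hi : f i = 0 := congrArg Subtype.val h
    have hsum := hf.2
    rw [sum_fin_three f hij hik hjk, hi, zero_add] at hsum
    have hj : f j = 0 := by
      refine Submodule.disjoint_def.1 (hd j k hjk) _ (hf.1 j) ?_
      rw [eq_neg_of_add_eq_zero_left hsum]
      exact (L k).neg_mem (hf.1 k)
    rw [hj, zero_add] at hsum
    refine Subtype.ext (funext fun l => ?_)
    have hl : l = i ∨ l = j ∨ l = k := by
      clear * - hij hik hjk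
      decide +revert
    rcases hl with rfl | rfl | rfl
    exacts [hi, hj, hsum]
  · rintro ⟨v, hv⟩
    obtain ⟨a, ha, b, hb, rfl⟩ := Submodule.mem_sup.1 (hs i j k hij hik hjk hv)
    refine ⟨⟨Function.update (Function.update (fun _ => a + b) j (-a)) k (-b), ?_, ?_⟩, ?_⟩
    · intro l
      have hl : l = i ∨ l = j ∨ l = k := by
        clear * - hij hik hjk
        decide +revert
      rcases hl with rfl | rfl | rfl
      · simpa [Function.update_of_ne hij, Function.update_of_ne hik] using hv
      · simpa [Function.update_of_ne hjk] using ha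
      · simpa using hb
    · rw [sum_fin_three _ hij hik hjk]
      simp only [Function.update_of_ne hij, Function.update_of_ne hik, Function.update_of_ne hjk,
        Function.update_self]
      abel
    · refine Subtype.ext ?_
      change Function.update (Function.update (fun _ => a + b) j (-a)) k (-b) i = a + b
      rw [Function.update_of_ne hik, Function.update_of_ne hij]

/-- The isomorphism of spaces of relations induced by a linear isomorphism. -/
def relationsEquiv {L : Fin 3 → Submodule R V} {L' : Fin 3 → Submodule R W} (e : V ≃ₗ[R] W)
    (h : ∀ i, (L i).map e.toLinearMap = L' i) : relations L ≃ₗ[R] relations L' :=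
  (LinearEquiv.piCongrRight fun _ : Fin 3 => e).ofSubmodules _ _ (by
    ext g
    obtain ⟨f, rfl⟩ := (LinearEquiv.piCongrRight fun _ : Fin 3 => e).surjective g
    refine (Submodule.mem_map_equiv (p := _)).trans ?_
    rw [LinearEquiv.symm_apply_apply, mem_relations, mem_relations]
    refine and_congr (forall_congr' fun i => ?_) ?_
    · rw [← h i]
      refine Iff.symm ((Submodule.mem_map_equiv (p := _)).trans ?_)
      simp
    · simp only [LinearEquiv.piCongrRight_apply, ← map_sum]
      exact (map_eq_zero_iff e e.injective).symm)

end Relations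

end FlagSub

/-! ### The functor from flag complexes to local systems of lines -/

namespace GluedTriangles

variable {S : GluedTriangles} {m : ℕ}

theorem WhiteCell.sum_side (p : WhiteCell m) (t : S.Tri) (i : Fin 3) :
    p.1 i + p.1 (S.head t i) + p.1 (S.tail t i) + 1 = m := by
  rw [← sum_fin_three p.1 (S.head_ne t i).symm (S.tail_ne t i).symm (S.head_ne_tail t i),
    Fin.sum_univ_three]
  exact p.2

variable (S) in
/-- The `∘`-triangle on the side `i` of the triangle `t`, at the position `k`. -/
def sideCell (t : S.Tri) (i : Fin 3) (k : Fin m) : WhiteCell m :=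
  ⟨fun l => if l = i then 0 else if l = S.head t i then k else m - 1 - k, by
    have hk := k.2
    refine (congrArg (· + 1) ((Fin.sum_univ_three fun l : Fin 3 => if l = i then 0 else
      if l = S.head t i then (k : ℕ) else m - 1 - k).symm.trans (sum_fin_three _
      (S.head_ne t i).symm (S.tail_ne t i).symm (S.head_ne_tail t i)))).trans ?_
    simp only [if_true, if_neg (S.head_ne t i), if_neg (S.tail_ne t i),
      if_neg (S.head_ne_tail t i).symm]
    omega⟩

theorem sideCell_self (t : S.Tri) (i : Fin 3) (k : Fin m) : (S.sideCell t i k).1 i = 0 := by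
  simp [sideCell]

theorem sideCell_head (t : S.Tri) (i : Fin 3) (k : Fin m) :
    (S.sideCell t i k).1 (S.head t i) = k := by
  simp [sideCell, S.head_ne t i]

theorem sideCell_tail (t : S.Tri) (i : Fin 3) (k : Fin m) :
    (S.sideCell t i k).1 (S.tail t i) = m - 1 - k := by
  simp [sideCell, S.tail_ne t i, (S.head_ne_tail t i).symm]

theorem eq_sideCell {p : WhiteCell m} (t : S.Tri) {i : Fin 3} (h : p.1 i = 0) :
    p = S.sideCell t i ⟨p.1 (S.head t i), whiteCell_lt p _⟩ := by
  refine Subtype.ext (funext fun l => ?_)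
  by_cases hl : l = i
  · rw [hl, h, sideCell_self]
  · rcases S.eq_head_or_eq_tail t hl with rfl | rfl
    · rw [sideCell_head]
    · rw [sideCell_tail]
      have := WhiteCell.sum_side p t i
      dsimp only
      omega

end GluedTriangles

namespace FlagComplex

variable {R : Type u} [DivisionRing R] {m : ℕ} {S : GluedTriangles} (D : FlagComplex R m S)

/-- The line of a `∘`-triangle. -/
def whiteSpace (t : S.Tri) (p : WhiteCell m) : Submodule R (D.onTri t) :=
  flagInf (D.triFlag t) p.1

/-- The line of a `•`-triangle: the relations between the lines of its neighbours. -/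
def innerSpace (t : S.Tri) (q : BlackCell m) : Submodule R (Fin 3 → D.onTri t) :=
  relations fun i => D.whiteSpace t (q.neighbor i)

/-- The line of a segment of an edge. -/
def edgeSpace (e : S.Edge) (k : Fin m) : Submodule R (D.onEdge e) :=
  (D.headFlag e).sub k ⊓ (D.tailFlag e).sub (m - 1 - k)

theorem finrank_whiteSpace (t : S.Tri) (p : WhiteCell m) :
    Module.finrank R (D.whiteSpace t p) = 1 := by
  have h := p.2
  rw [whiteSpace, finrank_flagInf (D.generic t) (by omega)]
  omega

theorem relationsProj_bijective (t : S.Tri) (q : BlackCell m) (i : Fin 3) :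
    Function.Bijective (relationsProj (fun i => D.whiteSpace t (q.neighbor i)) i) := by
  refine _root_.relationsProj_bijective
    (fun i j hij => disjoint_flagInf (D.generic t) q.2 hij) (fun i j k hij hik hjk => ?_) i
  refine le_of_le_of_eq ?_ (flagInf_sup_flagInf (D.generic t) q.2 hjk).symm
  exact flagInf_antitone _ (le_add_of_nonneg_right (Pi.single_nonneg.2 zero_le_one))

/-- The line of a `•`-triangle is isomorphic to the line of any of its neighbours. -/
noncomputable def innerEquiv (t : S.Tri) (q : BlackCell m) (i : Fin 3) :
    D.innerSpace t q ≃ₗ[R] D.whiteSpace t (q.neighbor i) :=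
  LinearEquiv.ofBijective _ (D.relationsProj_bijective t q i)

theorem finrank_innerSpace (t : S.Tri) (q : BlackCell m) :
    Module.finrank R (D.innerSpace t q) = 1 :=
  (D.innerEquiv t q 0).finrank_eq.trans (D.finrank_whiteSpace t _)

/-- The flag at the opposite vertex has index 0 and imposes no condition; the other two indices add
up to `m - 1`. -/
theorem whiteSpace_side (t : S.Tri) {i : Fin 3} {p : WhiteCell m} (h : p.1 i = 0) :
    D.whiteSpace t p = (D.triFlag t (S.head t i)).sub (p.1 (S.head t i)) ⊓
      (D.triFlag t (S.tail t i)).sub (m - 1 - p.1 (S.head t i)) := by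
  have hs := WhiteCell.sum_side p t i
  have ht : p.1 (S.tail t i) = m - 1 - p.1 (S.head t i) := by omega
  rw [← ht]
  ext v
  refine mem_flagInf.trans ⟨fun hv => ⟨hv _, hv _⟩, fun hv l => ?_⟩
  by_cases hl : l = i
  · rw [hl, h, FullFlag.sub_zero]
    trivial
  · rcases S.eq_head_or_eq_tail t hl with rfl | rfl
    exacts [hv.1, hv.2]

theorem map_whiteSpace_glue (t : S.Tri) {i : Fin 3} {p : WhiteCell m} (h : p.1 i = 0) :
    (D.whiteSpace t p).map (D.glue t i).toLinearMap =
      D.edgeSpace (S.edge t i) ⟨p.1 (S.head t i), whiteCell_lt p _⟩ := by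
  rw [D.whiteSpace_side t h, Submodule.map_inf _ (D.glue t i).injective,
    FullFlag.map_sub_of_map_space (D.map_head t i),
    FullFlag.map_sub_of_map_space (D.map_tail t i)]
  rfl

/-- Gluing identifies the line of a `∘`-triangle on a side with the line of the segment. -/
noncomputable def edgeEquiv (t : S.Tri) {i : Fin 3} {p : WhiteCell m} (h : p.1 i = 0) :
    D.whiteSpace t p ≃ₗ[R] D.edgeSpace (S.edge t i) ⟨p.1 (S.head t i), whiteCell_lt p _⟩ :=
  (D.glue t i).ofSubmodules _ _ (D.map_whiteSpace_glue t h)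

theorem finrank_edgeSpace (e : S.Edge) (k : Fin m) : Module.finrank R (D.edgeSpace e k) = 1 := by
  obtain ⟨t, i, rfl⟩ := S.edge_surjective e
  have h := (D.edgeEquiv t (sideCell_self t i k)).finrank_eq
  have hk : (⟨(S.sideCell t i k).1 (S.head t i), whiteCell_lt _ _⟩ : Fin m) = k :=
    Fin.ext (sideCell_head t i k)
  rw [D.finrank_whiteSpace, hk] at h
  exact h.symm

theorem opposite_edge (e : S.Edge) : (D.headFlag e).Opposite (D.tailFlag e) := by
  obtain ⟨t, i, rfl⟩ := S.edge_surjective e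
  intro a b hab
  rw [← FullFlag.map_sub_of_map_space (D.map_head t i),
    ← FullFlag.map_sub_of_map_space (D.map_tail t i),
    ← Submodule.map_inf _ (D.glue t i).injective,
    opposite_of_generic (D.generic t) (S.head_ne_tail t i) a b hab, Submodule.map_bot]

/-- The local system of lines of a flag complex. -/
noncomputable def toLineSystem : LineSystem R (S.bipartiteGraph m) where
  atWhite w := ModuleCat.of R (D.whiteSpace w.1 w.2)
  atBlack := Sum.elim (fun b => ModuleCat.of R (D.innerSpace b.1 b.2))
    (fun a => ModuleCat.of R (D.edgeSpace a.1 a.2))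
  finrank_white w := D.finrank_whiteSpace w.1 w.2
  finrank_black := by
    rintro (b | a)
    exacts [D.finrank_innerSpace b.1 b.2, D.finrank_edgeSpace a.1 a.2]
  along
    | Sum.inl a => (D.innerEquiv a.1 a.2.1 a.2.2).symm.toModuleIso
    | Sum.inr a => (D.edgeEquiv a.1 a.2.2).toModuleIso

variable {D} {D' : FlagComplex R m S}

section Map

variable (f : D ⟶ D')

/-- Morphisms record only the flags of triangles. Every edge is a side of some triangle, and the
gluing carries the triangle's flags to those of the edge. -/
theorem map_headFlag (e : S.Edge) (a : Fin (m + 1)) :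
    ((D.headFlag e).space a).map (f.onEdge e).toLinearMap = (D'.headFlag e).space a := by
  obtain ⟨t, i, rfl⟩ := S.edge_surjective e
  rw [← D.map_head, ← D'.map_head, ← f.map_flag, ← Submodule.map_comp, ← Submodule.map_comp]
  congr 1
  ext v
  exact f.comm t i v

theorem map_tailFlag (e : S.Edge) (a : Fin (m + 1)) :
    ((D.tailFlag e).space a).map (f.onEdge e).toLinearMap = (D'.tailFlag e).space a := by
  obtain ⟨t, i, rfl⟩ := S.edge_surjective e
  rw [← D.map_tail, ← D'.map_tail, ← f.map_flag, ← Submodule.map_comp, ← Submodule.map_comp]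
  congr 1
  ext v
  exact f.comm t i v

theorem map_whiteSpace (t : S.Tri) (p : WhiteCell m) :
    (D.whiteSpace t p).map (f.onTri t).toLinearMap = D'.whiteSpace t p :=
  map_flagInf (f.map_flag t) p.1

theorem map_edgeSpace (e : S.Edge) (k : Fin m) :
    (D.edgeSpace e k).map (f.onEdge e).toLinearMap = D'.edgeSpace e k := by
  rw [edgeSpace, Submodule.map_inf _ (f.onEdge e).injective,
    FullFlag.map_sub_of_map_space (map_headFlag f e),
    FullFlag.map_sub_of_map_space (map_tailFlag f e)]
  rfl

/-- The map on the lines of the `∘`-triangles. -/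
noncomputable def mapWhite (t : S.Tri) (p : WhiteCell m) :
    D.whiteSpace t p ≃ₗ[R] D'.whiteSpace t p :=
  (f.onTri t).ofSubmodules _ _ (map_whiteSpace f t p)

/-- The map on the lines of the `•`-triangles. -/
noncomputable def mapInner (t : S.Tri) (q : BlackCell m) :
    D.innerSpace t q ≃ₗ[R] D'.innerSpace t q :=
  relationsEquiv (f.onTri t) fun i => map_whiteSpace f t (q.neighbor i)

theorem innerEquiv_symm_mapWhite (t : S.Tri) (q : BlackCell m) (i : Fin 3)
    (v : D.whiteSpace t (q.neighbor i)) :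
    mapInner f t q ((D.innerEquiv t q i).symm v) =
      (D'.innerEquiv t q i).symm (mapWhite f t (q.neighbor i) v) := by
  obtain ⟨g, rfl⟩ := (D.innerEquiv t q i).surjective v
  rw [LinearEquiv.symm_apply_apply, LinearEquiv.eq_symm_apply]
  rfl

/-- The isomorphisms of lines induced by an isomorphism of flag complexes. -/
noncomputable def mapLineSystem : D.toLineSystem ⟶ D'.toLineSystem where
  onWhite w := (mapWhite f w.1 w.2).toModuleIso
  onBlack
    | Sum.inl b => (mapInner f b.1 b.2).toModuleIso
    | Sum.inr a => ((f.onEdge a.1).ofSubmodules _ _ (map_edgeSpace f a.1 a.2)).toModuleIso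
  comm
    | Sum.inl a => by
      ext v
      exact innerEquiv_symm_mapWhite f a.1 a.2.1 a.2.2 v
    | Sum.inr a => by
      ext v
      exact Subtype.ext (f.comm a.1 a.2.1.2 v.1)

end Map

variable (R m S) in
/-- The functor that assigns to a flag complex its local system of lines. -/
noncomputable def lines : FlagComplex R m S ⥤ LineSystem R (S.bipartiteGraph m) where
  obj D := D.toLineSystem
  map f := mapLineSystem f
  map_id D := by
    refine LineSystem.Hom.ext (funext fun w => ?_) (funext ?_)
    · ext v
      rfl
    · rintro (b | a)
      · ext v
        rfl
      · ext v
        rfl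
  map_comp f g := by
    refine LineSystem.Hom.ext (funext fun w => ?_) (funext ?_)
    · ext v
      rfl
    · rintro (b | a)
      · ext v
        rfl
      · ext v
        rfl

end FlagComplex

/-! ### The functor of lines is full and faithful -/

namespace FullFlag

variable {R : Type u} [DivisionRing R] {V W : Type*} [AddCommGroup V] [Module R V]
  [AddCommGroup W] [Module R W] {m : ℕ} {G H : FullFlag R V m} {G' H' : FullFlag R W m}

/-- The line of codimension `k` in the decomposition given by two opposite flags. -/
def line (G H : FullFlag R V m) (k : Fin m) : Submodule R V := G.sub k ⊓ H.sub (m - 1 - k)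

/-- The dimensions `m - k` and `k + 1` add up to `m + 1`, more than the whole space admits. -/
theorem line_ne_bot (G H : FullFlag R V m) (k : Fin m) : G.line H k ≠ ⊥ := by
  have := G.finite
  intro h
  have h₁ := Submodule.finrank_sup_add_finrank_inf_eq (G.sub k) (H.sub (m - 1 - k))
  have h₂ := Submodule.finrank_le (G.sub k ⊔ H.sub (m - 1 - k))
  have h₃ : Module.finrank R ↥(G.sub k ⊓ H.sub (m - 1 - k)) = 0 := by
    rw [← finrank_bot R V, ← h]
    rfl
  rw [G.finrank_eq] at h₂
  rw [h₃, G.finrank_sub, H.finrank_sub] at h₁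
  have := k.2
  omega

theorem Opposite.exists_basis (h : Opposite G H) :
    ∃ b : Module.Basis (Fin m) R V, ∀ k, b k ∈ G.line H k := by
  have h' : ∀ k, ∃ v ∈ G.line H k, v ≠ 0 := fun k =>
    (Submodule.ne_bot_iff _).1 (line_ne_bot G H k)
  choose v hv hv' using h'
  exact ⟨adaptedBasis h hv' (fun k => (hv k).1) fun k => (hv k).2, fun k => by
    rw [adaptedBasis_apply]; exact hv k⟩

theorem Opposite.exists_basis_eq (h : Opposite G H) {v : Fin m → V} (hv : ∀ k, v k ∈ G.line H k)
    (hv' : ∀ k, v k ≠ 0) : ∃ b : Module.Basis (Fin m) R V, ∀ k, b k = v k :=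
  ⟨adaptedBasis h hv' (fun k => (hv k).1) fun k => (hv k).2, fun _ => adaptedBasis_apply ..⟩

section Map

variable (h : Opposite G H) (h' : Opposite G' H') (e : V ≃ₗ[R] W) (b : Module.Basis (Fin m) R V)
  (hb : ∀ k, b k ∈ G.line H k) (hb' : ∀ k, e (b k) ∈ G'.line H' k)
include h h' hb hb'

/-- Both flags are spanned by vectors of their lines, so matching the lines matches the flags. -/
theorem map_sub_of_mem_line (a : ℕ) : (G.sub a).map e.toLinearMap = G'.sub a := by
  have := nontrivial_of_ne (0 : R) 1 zero_ne_one
  rw [sub_eq_span h b.ne_zero (fun k => (hb k).1) fun k => (hb k).2,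
    sub_eq_span (b := fun k => e (b k)) h' (fun k => e.map_ne_zero_iff.2 (b.ne_zero k))
      (fun k => (hb' k).1) fun k => (hb' k).2, Submodule.map_span, Set.image_image]
  rfl

theorem map_sub_of_mem_line' (a : ℕ) : (H.sub a).map e.toLinearMap = H'.sub a := by
  rw [sub_eq_span' h b.ne_zero (fun k => (hb k).1) fun k => (hb k).2,
    sub_eq_span' (b := fun k => e (b k)) h' (fun k => e.map_ne_zero_iff.2 (b.ne_zero k))
      (fun k => (hb' k).1) fun k => (hb' k).2, Submodule.map_span, Set.image_image]
  rfl

end Map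

end FullFlag

theorem exists_smul_eq_of_mem_line {R : Type u} [DivisionRing R] {V : Type*} [AddCommGroup V]
    [Module R V] {L : Submodule R V} (hL : Module.finrank R L = 1) {v w : V} (hv : v ∈ L)
    (hv' : v ≠ 0) (hw : w ∈ L) : ∃ c : R, w = c • v := by
  obtain ⟨c, hc⟩ := (finrank_eq_one_iff_of_nonzero' (⟨v, hv⟩ : L)
    (fun h => hv' (congrArg Subtype.val h))).1 hL ⟨w, hw⟩
  exact ⟨c, (congrArg Subtype.val hc).symm⟩

namespace GluedTriangles

theorem BlackCell.exists_neighbor {m : ℕ} (p : WhiteCell m) (h : p.1 0 ≠ 0) :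
    ∃ q : BlackCell m, p = BlackCell.neighbor q 0 := by
  refine ⟨⟨p.1 - Pi.single 0 1, ?_⟩, Subtype.ext (funext fun i => ?_)⟩
  · have := p.2
    simp
    omega
  · fin_cases i <;> simp [BlackCell.neighbor]
    omega

theorem BlackCell.neighbor_zero {m : ℕ} (q : BlackCell m) :
    (BlackCell.neighbor q 0).1 0 = q.1 0 + 1 := by
  simp [BlackCell.neighbor]

theorem BlackCell.neighbor_of_ne {m : ℕ} (q : BlackCell m) {i j : Fin 3} (h : j ≠ i) :
    (BlackCell.neighbor q i).1 j = q.1 j := by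
  simp [BlackCell.neighbor, Pi.single_eq_of_ne h]

end GluedTriangles

namespace FlagComplex

variable {R : Type u} [DivisionRing R] {m : ℕ} {S : GluedTriangles} {D D' : FlagComplex R m S}

theorem opposite_side (D : FlagComplex R m S) (t : S.Tri) (i : Fin 3) :
    (D.triFlag t (S.head t i)).Opposite (D.triFlag t (S.tail t i)) :=
  opposite_of_generic (D.generic t) (S.head_ne_tail t i)

theorem line_side (D : FlagComplex R m S) (t : S.Tri) (i : Fin 3) (k : Fin m) :
    (D.triFlag t (S.head t i)).line (D.triFlag t (S.tail t i)) k =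
      D.whiteSpace t (S.sideCell t i k) := by
  rw [D.whiteSpace_side t (sideCell_self t i k), sideCell_head]
  rfl

theorem exists_basis_side (D : FlagComplex R m S) (t : S.Tri) (i : Fin 3) :
    ∃ b : Module.Basis (Fin m) R (D.onTri t), ∀ k, b k ∈ D.whiteSpace t (S.sideCell t i k) := by
  obtain ⟨b, hb⟩ := (D.opposite_side t i).exists_basis
  exact ⟨b, fun k => by rw [← line_side]; exact hb k⟩

/-- The lines along one side span the space of the triangle, and the gluing maps carry the
information on to the edges. -/
instance : (lines R m S).Faithful where
  map_injective {D D'} f g h := by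
    have h' : ∀ t p, ∀ v ∈ D.whiteSpace t p, f.onTri t v = g.onTri t v := fun t p v hv =>
      congrArg Subtype.val (LinearMap.congr_fun (congrArg ModuleCat.Hom.hom (congrArg Iso.hom
        (congrFun (congrArg LineSystem.Hom.onWhite h) (t, p)))) (⟨v, hv⟩ : D.whiteSpace t p))
    have ht : f.onTri = g.onTri := funext fun t => by
      obtain ⟨b, hb⟩ := D.exists_basis_side t 0
      exact b.ext' fun k => h' t _ _ (hb k)
    refine Hom.ext ht (funext fun e => ?_)
    obtain ⟨t, i, rfl⟩ := S.edge_surjective e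
    ext v
    obtain ⟨v, rfl⟩ := (D.glue t i).surjective v
    rw [f.comm, g.comm, ht]

section Extend

variable {t : S.Tri}

/-- The map is defined on a basis taken from the lines with `p 0 = 0`. Induction on `p 0` handles
the rest: the line `q + e₀` is tied by the relation at `q` to the lines `q + e₁` and `q + e₂`, whose
index 0 is one less, and `comm` says that relations go to relations. -/
theorem exists_equiv_tri (hW : ∀ p, D.whiteSpace t p ≃ₗ[R] D'.whiteSpace t p)
    (hI : ∀ q, D.innerSpace t q ≃ₗ[R] D'.innerSpace t q)
    (comm : ∀ q i f, (hI q f).1 i = hW _ (D.innerEquiv t q i f)) :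
    ∃ e : D.onTri t ≃ₗ[R] D'.onTri t, ∀ p (v : D.whiteSpace t p), e v = hW p v := by
  obtain ⟨b, hb⟩ := D.exists_basis_side t 0
  obtain ⟨b', hb'⟩ := (D'.opposite_side t 0).exists_basis_eq (v := fun k => hW _ ⟨b k, hb k⟩)
    (fun k => by rw [line_side]; exact Subtype.prop _)
    (fun k h => b.ne_zero k (congrArg Subtype.val
      ((hW _).map_eq_zero_iff.1 (Subtype.ext h : hW _ ⟨b k, hb k⟩ = 0))))
  refine ⟨b.equiv b' (Equiv.refl _), fun p => ?_⟩
  have he : ∀ k, b.equiv b' (Equiv.refl _) (b k) = hW _ ⟨b k, hb k⟩ := fun k =>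
    (b.equiv_apply k b' _).trans (hb' k)
  generalize b.equiv b' (Equiv.refl _) = e at he ⊢
  induction h : p.1 0 generalizing p with
  | zero =>
    obtain ⟨k, rfl⟩ : ∃ k, p = S.sideCell t 0 k := ⟨_, eq_sideCell t h⟩
    rintro ⟨v, hv⟩
    obtain ⟨c, rfl⟩ := exists_smul_eq_of_mem_line (D.finrank_whiteSpace t _) (hb k)
      (b.ne_zero k) hv
    have h₁ : (⟨c • b k, hv⟩ : D.whiteSpace t (S.sideCell t 0 k)) = c • ⟨b k, hb k⟩ := rfl
    rw [h₁, map_smul]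
    exact (e.map_smul c (b k)).trans (congrArg (c • ·) (he k))
  | succ n ih =>
    intro v
    obtain ⟨q, rfl⟩ := BlackCell.exists_neighbor p (by omega)
    obtain ⟨f, rfl⟩ := (D.innerEquiv t q 0).surjective v
    have hs : ∀ i : Fin 3, i ≠ 0 → e (f.1 i) = (hI q f).1 i := fun i hi => by
      rw [comm]
      refine ih _ ?_ (D.innerEquiv t q i f)
      rw [BlackCell.neighbor_zero] at h
      rw [BlackCell.neighbor_of_ne q hi.symm]
      omega
    -- Compare the image of the relation `f` with the relation `hI q f`: two terms agree by
    -- induction, so the third does too.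
    have h₁ : e (f.1 0 + f.1 1 + f.1 2) = 0 := by
      rw [← Fin.sum_univ_three, f.2.2, map_zero]
    have h₂ := (hI q f).2.2
    rw [Fin.sum_univ_three, ← hs 1 (by decide), ← hs 2 (by decide)] at h₂
    rw [map_add, map_add, ← h₂, add_left_inj, add_left_inj, comm] at h₁
    exact h₁

/-- An edge carries no further condition: its lines form a direct sum decomposition, so isomorphisms
between them may be prescribed freely. -/
theorem exists_equiv_edge {e : S.Edge} (hE : ∀ k, D.edgeSpace e k ≃ₗ[R] D'.edgeSpace e k) :
    ∃ f : D.onEdge e ≃ₗ[R] D'.onEdge e, ∀ k (v : D.edgeSpace e k), f v = hE k v := by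
  obtain ⟨b, hb⟩ := (D.opposite_edge e).exists_basis
  obtain ⟨b', hb'⟩ := (D'.opposite_edge e).exists_basis_eq (v := fun k => hE _ ⟨b k, hb k⟩)
    (fun k => Subtype.prop _)
    (fun k h => b.ne_zero k (congrArg Subtype.val
      ((hE _).map_eq_zero_iff.1 (Subtype.ext h : hE _ ⟨b k, hb k⟩ = 0))))
  refine ⟨b.equiv b' (Equiv.refl _), fun k => ?_⟩
  rintro ⟨v, hv⟩
  obtain ⟨c, rfl⟩ := exists_smul_eq_of_mem_line (D.finrank_edgeSpace e k) (hb k) (b.ne_zero k) hv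
  have h₁ : (⟨c • b k, hv⟩ : D.edgeSpace e k) = c • ⟨b k, hb k⟩ := rfl
  rw [h₁, map_smul]
  exact (map_smul _ c (b k)).trans
    (congrArg (c • ·) ((b.equiv_apply k b' _).trans (hb' k)))

/-- The vertex `j` is an end of the side `j + 1`, and the lines along that side determine its flag.
-/
theorem map_triFlag_of_whiteSpace (e : D.onTri t ≃ₗ[R] D'.onTri t)
    (he : ∀ p, ∀ v ∈ D.whiteSpace t p, e v ∈ D'.whiteSpace t p) (j : Fin 3) (a : ℕ) :
    ((D.triFlag t j).sub a).map e.toLinearMap = (D'.triFlag t j).sub a := by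
  obtain ⟨b, hb⟩ := D.exists_basis_side t (j + 1)
  have hb' : ∀ k, e (b k) ∈ (D'.triFlag t (S.head t (j + 1))).line
      (D'.triFlag t (S.tail t (j + 1))) k := fun k => by
    rw [line_side]
    exact he _ _ (hb k)
  simp only [← line_side] at hb
  rcases S.eq_head_or_eq_tail t (show j ≠ j + 1 by clear * -; decide +revert) with h | h
  · rw [h]
    exact FullFlag.map_sub_of_mem_line (D.opposite_side t _) (D'.opposite_side t _) e b hb hb' a
  · rw [h]
    exact FullFlag.map_sub_of_mem_line' (D.opposite_side t _) (D'.opposite_side t _) e b hb hb' a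

end Extend

instance : (lines R m S).Full where
  map_surjective {D D'} h := by
    let hW t p : D.whiteSpace t p ≃ₗ[R] D'.whiteSpace t p := (h.onWhite (t, p)).toLinearEquiv
    let hI t q : D.innerSpace t q ≃ₗ[R] D'.innerSpace t q :=
      (h.onBlack (Sum.inl (t, q))).toLinearEquiv
    let hE e k : D.edgeSpace e k ≃ₗ[R] D'.edgeSpace e k :=
      (h.onBlack (Sum.inr (e, k))).toLinearEquiv
    have hWI : ∀ t q i f, (hI t q f).1 i = hW t _ (D.innerEquiv t q i f) := fun t q i f => by
      have h₁ : hI t q ((D.innerEquiv t q i).symm (D.innerEquiv t q i f)) =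
          (D'.innerEquiv t q i).symm (hW t _ (D.innerEquiv t q i f)) :=
        LinearMap.congr_fun (congrArg ModuleCat.Hom.hom (h.comm (Sum.inl (t, q, i))))
          (D.innerEquiv t q i f)
      rw [LinearEquiv.symm_apply_apply, LinearEquiv.eq_symm_apply] at h₁
      exact congrArg Subtype.val h₁
    have hWE : ∀ t i p (hp : p.1 i = 0) v,
        hE _ _ (D.edgeEquiv t hp v) = D'.edgeEquiv t hp (hW t p v) := fun t i p hp v =>
      LinearMap.congr_fun (congrArg ModuleCat.Hom.hom (h.comm (Sum.inr (t, ⟨(p, i), hp⟩)))) v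
    choose fT hfT using fun t => exists_equiv_tri (hW t) (hI t) (hWI t)
    choose fE hfE using fun e => exists_equiv_edge (hE e)
    refine ⟨⟨fT, fE, fun t i v => ?_, fun t i a => ?_⟩, ?_⟩
    -- Compatibility with gluing is checked on a basis adapted to the side `i` itself, where it is
    -- the compatibility at the segments.
    · obtain ⟨b, hb⟩ := D.exists_basis_side t i
      refine LinearMap.congr_fun (b.ext (f₁ := (fE (S.edge t i)).toLinearMap ∘ₗ
        (D.glue t i).toLinearMap) (f₂ := (D'.glue t i).toLinearMap ∘ₗ (fT t).toLinearMap)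
        fun k => ?_) v
      have hp := sideCell_self t i k
      refine (hfE _ _ (D.edgeEquiv t hp ⟨b k, hb k⟩)).trans ?_
      rw [hWE]
      exact congrArg (D'.glue t i) (hfT t _ ⟨b k, hb k⟩).symm
    · rw [← FullFlag.sub_coe, ← FullFlag.sub_coe]
      refine map_triFlag_of_whiteSpace (fT t) (fun p v hv => ?_) i a
      rw [hfT t p ⟨v, hv⟩]
      exact Subtype.prop _
    · refine LineSystem.Hom.ext (funext fun w => ?_) (funext ?_)
      · ext v
        exact Subtype.ext (hfT w.1 w.2 v)
      · rintro (b | a)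
        · ext v
          refine Subtype.ext (funext fun i => ?_)
          exact (hfT b.1 _ (D.innerEquiv b.1 b.2 i v)).trans (hWI b.1 b.2 i v).symm
        · ext v
          exact Subtype.ext (hfE a.1 a.2 v)

end FlagComplex

/-! ### Flags from bases, and the standard opposite pair -/

namespace FullFlag

variable {R : Type u} [DivisionRing R] {V : Type*} [AddCommGroup V] [Module R V] {m : ℕ}

/-- The flag made of a decreasing sequence of subspaces of the right dimensions. -/
def ofFinrank (hV : Module.finrank R V = m) [Module.Finite R V] (F : ℕ → Submodule R V)
    (hF : Antitone F) (h : ∀ a ≤ m, Module.finrank R (F a) = m - a) : FullFlag R V m where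
  space a := F a
  antitone _ _ hab := hF hab
  space_zero := Submodule.eq_top_of_finrank_eq ((h 0 (Nat.zero_le m)).trans hV.symm)
  space_last := Submodule.finrank_eq_zero.1 ((h m le_rfl).trans (Nat.sub_self m))
  codim a := by
    have h₁ := (F a).finrank_quotient_add_finrank
    have h₂ := a.2
    rw [h a (by omega)] at h₁
    omega

/-- The flag given by an ordered basis. -/
noncomputable def ofBasis (b : Module.Basis (Fin m) R V) : FullFlag R V m :=
  have := Module.Finite.of_basis b
  ofFinrank (by rw [Module.finrank_eq_card_basis b, Fintype.card_fin])
    (fun a => Submodule.span R (b '' {k | a ≤ k}))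
    (fun a c hac => Submodule.span_mono (Set.image_mono fun k hk => hac.trans hk))
    (fun a ha => by
      have h : Set.range (fun k : Fin (m - a) => b ⟨a + k, by omega⟩) = b '' {k | a ≤ k} := by
        ext v
        constructor
        · rintro ⟨k, rfl⟩
          exact ⟨_, Nat.le_add_right a k, rfl⟩
        · rintro ⟨k, hk, rfl⟩
          have h₁ : a ≤ k := hk
          refine ⟨⟨k - a, by omega⟩, congrArg b (Fin.ext ?_)⟩
          dsimp only
          omega
      rw [← h, finrank_span_eq_card, Fintype.card_fin]
      refine b.linearIndependent.comp _ fun k l hkl => Fin.ext ?_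
      have := congrArg Fin.val hkl
      dsimp only at this
      omega)

theorem mem_ofBasis_sub {b : Module.Basis (Fin m) R V} {a : ℕ} {v : V} :
    v ∈ (ofBasis b).sub a ↔ ∀ k : Fin m, (k : ℕ) < a → b.repr v k = 0 := by
  refine Iff.trans (b.mem_span_image (s := {k : Fin m | min a m ≤ k})) ?_
  refine ⟨fun h k hk => ?_, fun h k hk => ?_⟩
  · by_contra hk'
    have h₁ : min a m ≤ (k : ℕ) := h (Finsupp.mem_support_iff.2 hk')
    have := k.2
    omega
  · by_contra hk'
    have h₁ : ¬ min a m ≤ (k : ℕ) := hk'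
    exact Finsupp.mem_support_iff.1 hk (h k (by omega))

end FullFlag

section Standard

variable (R : Type u) [DivisionRing R] (m : ℕ)

/-- The flag of vectors with vanishing first coordinates. -/
noncomputable def leadingFlag : FullFlag R (Fin m → R) m := .ofBasis (Pi.basisFun R (Fin m))

/-- The flag of vectors with vanishing last coordinates. -/
noncomputable def trailingFlag : FullFlag R (Fin m → R) m :=
  .ofBasis ((Pi.basisFun R (Fin m)).reindex Fin.revPerm)

variable {R m}

theorem mem_leadingFlag {a : ℕ} {v : Fin m → R} :
    v ∈ (leadingFlag R m).sub a ↔ ∀ k : Fin m, (k : ℕ) < a → v k = 0 :=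
  FullFlag.mem_ofBasis_sub.trans (by simp)

theorem mem_trailingFlag {a : ℕ} {v : Fin m → R} :
    v ∈ (trailingFlag R m).sub a ↔ ∀ k : Fin m, m ≤ k + a → v k = 0 := by
  refine FullFlag.mem_ofBasis_sub.trans ?_
  simp only [Module.Basis.repr_reindex_apply, Pi.basisFun_repr, Fin.revPerm_symm, Fin.revPerm_apply]
  refine ⟨fun h k hk => ?_, fun h k hk => h _ ?_⟩
  · rw [← Fin.rev_rev k]
    refine h _ ?_
    rw [Fin.val_rev]
    omega
  · rw [Fin.val_rev]
    omega

theorem opposite_leadingFlag_trailingFlag : (leadingFlag R m).Opposite (trailingFlag R m) := by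
  intro a b hab
  refine (Submodule.eq_bot_iff _).2 fun v hv => funext fun k => ?_
  rcases lt_or_ge (k : ℕ) a with h | h
  · exact mem_leadingFlag.1 hv.1 k h
  · exact mem_trailingFlag.1 hv.2 k (by omega)

theorem single_mem_line (k : Fin m) (c : R) :
    (Pi.single k c : Fin m → R) ∈ (leadingFlag R m).line (trailingFlag R m) k := by
  refine ⟨mem_leadingFlag.2 fun l hl => ?_, mem_trailingFlag.2 fun l hl => ?_⟩
  · exact Pi.single_eq_of_ne (fun h : l = k => by subst h; omega) _
  · exact Pi.single_eq_of_ne (fun h : l = k => by subst h; have := l.2; omega) _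

end Standard

/-- Source and target have the same dimension, so injectivity suffices. -/
theorem genericTriple_of_inf {R : Type u} [DivisionRing R] {V : Type*} [AddCommGroup V]
    [Module R V] {m : ℕ} {F : Fin 3 → FullFlag R V m}
    (h : ∀ a b c, a + b + c = m → ∀ v ∈ (F 0).sub a, v ∈ (F 1).sub b → v ∈ (F 2).sub c → v = 0) :
    GenericTriple R fun i => (F i).space := by
  intro a b c habc
  have := (F 0).finite
  have hinj : Function.Injective
      (((F 0).space a).mkQ.prod (((F 1).space b).mkQ.prod ((F 2).space c).mkQ)) := by
    rw [injective_iff_map_eq_zero]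
    intro v hv
    obtain ⟨h₀, h₁₂⟩ := Prod.mk.inj hv
    obtain ⟨h₁, h₂⟩ := Prod.mk.inj h₁₂
    refine h a b c habc v ?_ ?_ ?_ <;> rw [FullFlag.sub_coe]
    exacts [(Submodule.Quotient.mk_eq_zero _).1 h₀, (Submodule.Quotient.mk_eq_zero _).1 h₁,
      (Submodule.Quotient.mk_eq_zero _).1 h₂]
  refine ⟨hinj, (LinearMap.injective_iff_surjective_of_finrank_eq_finrank ?_).1 hinj⟩
  rw [Module.finrank_prod, Module.finrank_prod, (F 0).codim, (F 1).codim, (F 2).codim,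
    (F 0).finrank_eq]
  omega

/-! ### Triangular rows of vectors with prescribed relations -/

section Rows

variable {R : Type u} [DivisionRing R] (a b : ℕ → ℕ → R)

/-- The rows of vectors obtained from the standard one by taking repeatedly linear combinations of
neighbours, with the coefficients `a` and `b`. -/
def rows : ℕ → ℕ → ℕ → R
  | 0, k => Pi.single k 1
  | n + 1, k => a n k • rows n k + b n k • rows n (k + 1)

theorem rows_succ (n k : ℕ) : rows a b (n + 1) k = a n k • rows a b n k + b n k • rows a b n (k + 1) :=
  rfl

/-- The vector `k` of row `n` is supported on the interval from `k` to `k + n`. Together with the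
nonvanishing of both end entries, this triangular shape yields the genericity. -/
theorem rows_eq_zero {n k i : ℕ} (h : i < k ∨ k + n < i) : rows a b n k i = 0 := by
  induction n generalizing k with
  | zero => exact Pi.single_eq_of_ne (by omega) _
  | succ n ih =>
    rw [rows_succ, Pi.add_apply, Pi.smul_apply, Pi.smul_apply, ih (by omega), ih (by omega),
      smul_zero, smul_zero, add_zero]

variable {a b}

theorem rows_left_ne_zero (ha : ∀ n k, a n k ≠ 0) (n k : ℕ) : rows a b n k k ≠ 0 := by
  induction n generalizing k with
  | zero => simp [rows]
  | succ n ih =>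
    rw [rows_succ, Pi.add_apply, Pi.smul_apply, Pi.smul_apply,
      rows_eq_zero a b (Or.inl k.lt_succ_self), smul_zero, add_zero]
    exact smul_ne_zero (ha n k) (ih k)

theorem rows_right_ne_zero (hb : ∀ n k, b n k ≠ 0) (n k : ℕ) : rows a b n k (k + n) ≠ 0 := by
  induction n generalizing k with
  | zero => simp [rows]
  | succ n ih =>
    rw [rows_succ, Pi.add_apply, Pi.smul_apply, Pi.smul_apply,
      rows_eq_zero a b (k := k) (Or.inr (by omega)), smul_zero, zero_add]
    have := ih (k + 1)
    rw [add_right_comm] at this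
    exact smul_ne_zero (hb n k) this

/-- Triangular system solved from the left: at coordinate `k`, once the earlier coefficients vanish,
only the term with nonzero left end survives. -/
theorem eq_zero_of_leading (ha : ∀ n k, a n k ≠ 0) {n N c : ℕ} {x : Fin N → R}
    (h : ∀ i < min c N, ∑ k, x k * rows a b n k i = 0) (k : Fin N) (hk : (k : ℕ) < c) :
    x k = 0 := by
  obtain ⟨i, hi⟩ : ∃ i, i = (k : ℕ) := ⟨_, rfl⟩
  induction i using Nat.strong_induction_on generalizing k with
  | _ i ih =>
    subst hi
    have h₁ := h k (lt_min hk k.2)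
    rw [Finset.sum_eq_single k (fun j _ hj => ?_) (fun hk' => absurd (Finset.mem_univ k) hk')] at h₁
    · exact (mul_eq_zero.1 h₁).resolve_right (rows_left_ne_zero ha n k)
    · rcases lt_or_gt_of_ne hj with hj | hj
      · rw [ih j hj j (by omega) rfl, zero_mul]
      · rw [rows_eq_zero a b (Or.inl hj), mul_zero]

/-- The same system solved from the right, by induction on `N - k`, reading coordinate `k + n`,
where vector `k` has its nonzero right end. -/
theorem eq_zero_of_trailing (hb : ∀ n k, b n k ≠ 0) {n N c : ℕ} {x : Fin N → R}
    (h : ∀ i < N + n, c ≤ i → ∑ k, x k * rows a b n k i = 0) (k : Fin N) (hk : c ≤ k + n) :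
    x k = 0 := by
  obtain ⟨i, hi⟩ : ∃ i, i = N - (k : ℕ) := ⟨_, rfl⟩
  induction i using Nat.strong_induction_on generalizing k with
  | _ i ih =>
    subst hi
    have h₁ := h (k + n) (by omega) hk
    rw [Finset.sum_eq_single k (fun j _ hj => ?_) (fun hk' => absurd (Finset.mem_univ k) hk')] at h₁
    · exact (mul_eq_zero.1 h₁).resolve_right (rows_right_ne_zero hb n k)
    · rcases lt_or_gt_of_ne hj with hj | hj
      · rw [rows_eq_zero a b (Or.inr (by omega)), mul_zero]
      · have : (k : ℕ) < j := hj
        rw [ih _ (by omega) j (by omega) rfl, zero_mul]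

variable (a b) in
/-- The vectors of the `n`-th row, truncated. -/
def row (m n k : ℕ) (i : Fin m) : R := rows a b n k i

theorem row_ne_zero (ha : ∀ n k, a n k ≠ 0) {m k : ℕ} (n : ℕ) (hk : k < m) : row a b m n k ≠ 0 :=
  fun h => rows_left_ne_zero ha n k (congrFun h ⟨k, hk⟩)

variable (a b) in
/-- The span of the `n`-th row. -/
def rowSpan (m n : ℕ) : Submodule R (Fin m → R) :=
  Submodule.span R (Set.range fun k : Fin (m - n) => row a b m n k)

theorem row_mem_rowSpan {m n k : ℕ} (h : k + n < m) : row a b m n k ∈ rowSpan a b m n :=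
  Submodule.subset_span ⟨⟨k, by omega⟩, rfl⟩

theorem mem_rowSpan {m n : ℕ} {v : Fin m → R} :
    v ∈ rowSpan a b m n ↔
      ∃ x : Fin (m - n) → R, ∀ i : Fin m, v i = ∑ k : Fin (m - n), x k * rows a b n k i := by
  rw [rowSpan, Submodule.mem_span_range_iff_exists_fun]
  refine exists_congr fun x => eq_comm.trans (funext_iff.trans (forall_congr' fun i => ?_))
  rw [Finset.sum_apply]
  rfl

theorem antitone_rowSpan (m : ℕ) : Antitone (rowSpan a b m) := by
  refine antitone_nat_of_succ_le fun n => Submodule.span_le.2 ?_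
  rintro _ ⟨k, rfl⟩
  have := k.2
  exact (rowSpan a b m n).add_mem ((rowSpan a b m n).smul_mem (a n k) (row_mem_rowSpan (by omega)))
    ((rowSpan a b m n).smul_mem (b n k) (row_mem_rowSpan (by omega)))

theorem finrank_rowSpan (ha : ∀ n k, a n k ≠ 0) {m n : ℕ} :
    Module.finrank R (rowSpan a b m n) = m - n := by
  rw [rowSpan, finrank_span_eq_card, Fintype.card_fin]
  rw [Fintype.linearIndependent_iff]
  intro x hx k
  refine eq_zero_of_leading (b := b) ha (n := n) (c := m) (fun i hi => ?_) k (by omega)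
  have := congrFun hx ⟨i, by omega⟩
  rwa [Finset.sum_apply] at this

/-- The flag of the spans of the rows. -/
noncomputable def rowFlag (ha : ∀ n k, a n k ≠ 0) (m : ℕ) : FullFlag R (Fin m → R) m :=
  .ofFinrank (by simp) (rowSpan a b m) (antitone_rowSpan m) fun _ _ => finrank_rowSpan ha

theorem rowFlag_sub (ha : ∀ n k, a n k ≠ 0) {m n : ℕ} (h : n ≤ m) :
    (rowFlag (b := b) ha m).sub n = rowSpan a b m n :=
  congrArg (rowSpan a b m) (min_eq_left h)

end Rows

/-- The vector of the cell `p` is entry `p 1` of row `p 0`. The neighbours of `q` are then two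
consecutive vectors of one row and a vector of the next, so the wanted relation can be solved for
the latter and serves as the recursion. The flags are the spans of the rows and the two coordinate
flags. -/
theorem exists_generic_relations {R : Type u} [DivisionRing R] {m : ℕ}
    {r : BlackCell m → Fin 3 → R} (hr : ∀ q i, r q i ≠ 0) :
    ∃ (F : Fin 3 → FullFlag R (Fin m → R) m) (w : WhiteCell m → Fin m → R),
      (GenericTriple R fun i => (F i).space) ∧ (∀ p, w p ≠ 0) ∧ (∀ p, w p ∈ flagInf F p.1) ∧
      ∀ q : BlackCell m, ∑ i, (r q i)⁻¹ • w (q.neighbor i) = 0 := by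
  -- Solving the relation for the neighbour 0 gives these coefficients, in this order since scalars
  -- need not commute. Positions not coming from a •-triangle receive 1, so that the recursion is
  -- total with nonzero coefficients.
  have h : ∀ n k, ∃ a b : R, a ≠ 0 ∧ b ≠ 0 ∧ ∀ q : BlackCell m, q.1 0 = n → q.1 1 = k →
      a = -(r q 0 * (r q 2)⁻¹) ∧ b = -(r q 0 * (r q 1)⁻¹) := by
    intro n k
    by_cases hq : ∃ q : BlackCell m, q.1 0 = n ∧ q.1 1 = k
    · obtain ⟨q, rfl, rfl⟩ := hq
      refine ⟨-(r q 0 * (r q 2)⁻¹), -(r q 0 * (r q 1)⁻¹),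
        neg_ne_zero.2 (mul_ne_zero (hr q 0) (inv_ne_zero (hr q 2))),
        neg_ne_zero.2 (mul_ne_zero (hr q 0) (inv_ne_zero (hr q 1))), fun q' h₀ h₁ => ?_⟩
      have : q' = q := by
        have hq := q.2
        have hq' := q'.2
        refine Subtype.ext (funext fun i => ?_)
        fin_cases i
        · exact h₀
        · exact h₁
        · dsimp
          omega
      rw [this]
      exact ⟨rfl, rfl⟩
    · exact ⟨1, 1, one_ne_zero, one_ne_zero, fun q h₀ h₁ => absurd ⟨q, h₀, h₁⟩ hq⟩
  choose a b ha hb hab using h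
  refine ⟨![rowFlag (b := b) ha m, leadingFlag R m, trailingFlag R m],
    fun p => row a b m (p.1 0) (p.1 1), genericTriple_of_inf ?_, fun p => ?_, fun p => ?_,
    fun q => ?_⟩
  · intro n c d hm v hv hc hd
    simp only [Matrix.cons_val] at hv hc hd
    rw [rowFlag_sub ha (by omega)] at hv
    obtain ⟨x, hx⟩ := mem_rowSpan.1 hv
    rw [mem_leadingFlag] at hc
    rw [mem_trailingFlag] at hd
    refine funext fun i => (hx i).trans (Finset.sum_eq_zero fun k _ => mul_eq_zero_of_left ?_ _)
    -- A combination of the `c + d` vectors of row `n`: vanishing of the first `c` coordinates kills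
    -- the coefficients below `c`, vanishing of the last `d` kills the others.
    rcases lt_or_ge (k : ℕ) c with hk | hk
    · refine eq_zero_of_leading ha (b := b) (n := n) (c := c) (fun i hi => ?_) k hk
      rw [← hx ⟨i, by omega⟩]
      exact hc _ (by dsimp only; omega)
    · refine eq_zero_of_trailing (a := a) hb (n := n) (c := c + n) (fun i hi hi' => ?_) k (by omega)
      rw [← hx ⟨i, by omega⟩]
      exact hd _ (by dsimp only; omega)
  · exact row_ne_zero ha _ (whiteCell_lt p 1)
  · have hp := p.2
    rw [mem_flagInf, Fin.forall_fin_succ, Fin.forall_fin_two]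
    refine ⟨?_, ?_, ?_⟩
    · simp only [Matrix.cons_val]
      rw [rowFlag_sub ha (by omega)]
      exact row_mem_rowSpan (by omega)
    · exact mem_leadingFlag.2 fun k hk => rows_eq_zero a b (Or.inl hk)
    · exact mem_trailingFlag.2 fun k hk => rows_eq_zero a b (Or.inr (by
        simp at hk
        omega))
  · obtain ⟨h₂, h₁⟩ := hab _ _ q rfl rfl
    have h₀ : row a b m (q.1 0 + 1) (q.1 1) = a (q.1 0) (q.1 1) • row a b m (q.1 0) (q.1 1) +
      b (q.1 0) (q.1 1) • row a b m (q.1 0) (q.1 1 + 1) := rfl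
    have hq : (r q 0)⁻¹ * r q 0 = 1 := inv_mul_cancel₀ (hr q 0)
    rw [Fin.sum_univ_three]
    simp only [BlackCell.neighbor_zero, BlackCell.neighbor_of_ne q (show (0 : Fin 3) ≠ 1 by decide),
      BlackCell.neighbor_of_ne q (show (0 : Fin 3) ≠ 2 by decide),
      BlackCell.neighbor_of_ne q (show (1 : Fin 3) ≠ 2 by decide),
      BlackCell.neighbor_of_ne q (show (1 : Fin 3) ≠ 0 by decide)]
    have h₃ : (BlackCell.neighbor q 1).1 1 = q.1 1 + 1 := by simp [BlackCell.neighbor]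
    rw [h₃, h₀, h₁, h₂, smul_add, smul_smul, smul_smul, mul_neg, mul_neg, ← mul_assoc, ← mul_assoc,
      hq, one_mul, one_mul, neg_smul, neg_smul]
    abel

theorem exists_iso_of_finrank_eq_one {R : Type u} [DivisionRing R] {L M : ModuleCat.{u} R}
    (hL : Module.finrank R L = 1) (hM : Module.finrank R M = 1) {x : L} {y : M} (hx : x ≠ 0)
    (hy : y ≠ 0) : ∃ e : L ≅ M, e.hom x = y := by
  let b := FiniteDimensional.basisSingleton Unit hL x hx
  let c := FiniteDimensional.basisSingleton Unit hM y hy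
  refine ⟨(b.equiv c (Equiv.refl _)).toModuleIso, ?_⟩
  have h := b.equiv_apply () c (Equiv.refl _)
  simp only [b, c, FiniteDimensional.basisSingleton_apply] at h
  exact h

/-! ### Realization of every local system of lines -/

namespace LineSystem

variable {R : Type u} [DivisionRing R] {G : BipartiteGraph}

/-- Local systems of lines with the same coefficients, for some generators, are isomorphic. -/
theorem nonempty_iso_of_generators (X Y : LineSystem R G) {r : G.Edge → R}
    {xw : ∀ w, X.atWhite w} {xb : ∀ b, X.atBlack b} {yw : ∀ w, Y.atWhite w}
    {yb : ∀ b, Y.atBlack b} (hxw : ∀ w, xw w ≠ 0) (hxb : ∀ b, xb b ≠ 0) (hyw : ∀ w, yw w ≠ 0)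
    (hyb : ∀ b, yb b ≠ 0) (hx : ∀ e, (X.along e).hom (xw _) = r e • xb _)
    (hy : ∀ e, (Y.along e).hom (yw _) = r e • yb _) : Nonempty (X ≅ Y) := by
  choose fw hfw using fun w =>
    exists_iso_of_finrank_eq_one (X.finrank_white w) (Y.finrank_white w) (hxw w) (hyw w)
  choose fb hfb using fun b =>
    exists_iso_of_finrank_eq_one (X.finrank_black b) (Y.finrank_black b) (hxb b) (hyb b)
  let f : X ⟶ Y := ⟨fw, fb, fun e => by
    ext v
    obtain ⟨c, rfl⟩ := (finrank_eq_one_iff_of_nonzero' _ (hxw _)).1 (X.finrank_white _) v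
    rw [map_smul, map_smul]
    refine congrArg (c • ·) ?_
    change (fb _).hom ((X.along e).hom (xw _)) = (Y.along e).hom ((fw _).hom (xw _))
    rw [hx, hfw, hy, map_smul, hfb]⟩
  exact ⟨(Groupoid.isoEquivHom X Y).symm f⟩

end LineSystem

namespace FlagComplex

variable {R : Type u} [DivisionRing R] {m : ℕ} {S : GluedTriangles}

/-- After a choice of generators the local system is a family of nonzero scalars on the graph edges.
Scalars at •-triangles are realized by the relations inside each triangle separately, scalars at
segments by the gluing maps. -/
instance : (lines R m S).EssSurj where
  mem_essImage L := by
    have hne : ∀ M : ModuleCat.{u} R, Module.finrank R M = 1 → ∃ x : M, x ≠ 0 := fun M hM =>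
      have := Module.nontrivial_of_finrank_pos (R := R) (M := M) (by omega)
      exists_ne 0
    choose xw hxw using fun w => hne _ (L.finrank_white w)
    choose xb hxb using fun b => hne _ (L.finrank_black b)
    choose r hr using fun e => (finrank_eq_one_iff_of_nonzero' _ (hxb ((S.bipartiteGraph m).black e))).1
      (L.finrank_black _) ((L.along e).hom (xw _))
    have hr₀ : ∀ e, r e ≠ 0 := fun e he => by
      have h := hr e
      rw [he, zero_smul] at h
      exact hxw _ ((L.along e).toLinearEquiv.map_eq_zero_iff.1 h.symm)
    choose F w hF hw hwF hrel using fun t => exists_generic_relations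
      (r := fun q i => r (Sum.inl (t, q, i))) fun q i => hr₀ _
    have hop t i := opposite_of_generic (hF t) (S.head_ne_tail t i)
    have hline : ∀ t i k, w t (S.sideCell t i k) ∈
        (F t (S.head t i)).line (F t (S.tail t i)) k := fun t i k => by
      have h := mem_flagInf.1 (hwF t (S.sideCell t i k))
      have h₁ := h (S.head t i)
      have h₂ := h (S.tail t i)
      rw [sideCell_head] at h₁
      rw [sideCell_tail] at h₂
      exact ⟨h₁, h₂⟩
    choose bT hbT using fun t i => (hop t i).exists_basis_eq (hline t i) fun k => hw t _
    -- The gluing sends the generator at position `k` of the side to the `k`-th standard vector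
    -- scaled by the prescribed coefficient. Any nonzero scaling respects the flags.
    let c t i (k : Fin m) : R := r (Sum.inr (t, ⟨(S.sideCell t i k, i), sideCell_self t i k⟩))
    choose bE hbE using fun t i => opposite_leadingFlag_trailingFlag.exists_basis_eq
      (fun k => single_mem_line k (c t i k)) fun k h => hr₀ _ (Pi.single_eq_zero_iff.1 h)
    let glue t i : (Fin m → R) ≃ₗ[R] (Fin m → R) := (bT t i).equiv (bE t i) (Equiv.refl _)
    have hglue : ∀ t i k, glue t i (bT t i k) = bE t i k := fun t i k => (bT t i).equiv_apply ..
    have hT : ∀ t i k, bT t i k ∈ (F t (S.head t i)).line (F t (S.tail t i)) k := fun t i k => by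
      rw [hbT]
      exact hline t i k
    have hE : ∀ t i k, glue t i (bT t i k) ∈ (leadingFlag R m).line (trailingFlag R m) k :=
      fun t i k => by
        rw [hglue, hbE]
        exact single_mem_line k _
    let D : FlagComplex R m S :=
      { onTri := fun _ => ModuleCat.of R (Fin m → R)
        onEdge := fun _ => ModuleCat.of R (Fin m → R)
        glue := glue
        triFlag := F
        headFlag := fun _ => leadingFlag R m
        tailFlag := fun _ => trailingFlag R m
        generic := hF
        map_head := fun t i a => by
          rw [← FullFlag.sub_coe, ← FullFlag.sub_coe]
          exact FullFlag.map_sub_of_mem_line (hop t i) opposite_leadingFlag_trailingFlag _ _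
            (hT t i) (hE t i) a
        map_tail := fun t i a => by
          rw [← FullFlag.sub_coe, ← FullFlag.sub_coe]
          exact FullFlag.map_sub_of_mem_line' (hop t i) opposite_leadingFlag_trailingFlag _ _
            (hT t i) (hE t i) a }
    -- The components are divided by the coefficients because the graph edge is the inverse of the
    -- projection: the relation projects to `r⁻¹ • w`, so `w` goes to `r` times the relation.
    let yi (b : S.Tri × BlackCell m) : D.innerSpace b.1 b.2 :=
      ⟨fun i => (r (Sum.inl (b.1, b.2, i)))⁻¹ • w b.1 (b.2.neighbor i),
        fun i => Submodule.smul_mem _ _ (hwF b.1 _), hrel b.1 b.2⟩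
    let ye (a : S.Edge × Fin m) : D.edgeSpace a.1 a.2 := ⟨Pi.single a.2 1, single_mem_line a.2 1⟩
    refine ⟨D, LineSystem.nonempty_iso_of_generators D.toLineSystem L (r := r)
      (xw := fun a => (⟨w a.1 a.2, hwF a.1 a.2⟩ : D.whiteSpace a.1 a.2))
      (xb := fun | Sum.inl b => yi b | Sum.inr a => ye a) (yw := xw) (yb := xb)
      (fun a h => hw a.1 a.2 (congrArg Subtype.val h))
      (by
        rintro (b | a) h
        · have h₁ := congrFun (congrArg Subtype.val h) 0
          exact smul_ne_zero (inv_ne_zero (hr₀ _)) (hw _ _) h₁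
        · exact one_ne_zero (Pi.single_eq_zero_iff.1 (congrArg Subtype.val h)))
      hxw hxb ?_ (fun e => (hr e).symm)⟩
    rintro (⟨t, q, i⟩ | ⟨t, ⟨⟨p, i⟩, hp⟩⟩)
    · refine (D.innerEquiv t q i).symm_apply_eq.2 (Subtype.ext ?_)
      exact (smul_inv_smul₀ (hr₀ (Sum.inl (t, q, i))) (w t (q.neighbor i))).symm
    · refine Subtype.ext ?_
      change glue t i (w t p) = r (Sum.inr (t, ⟨(p, i), hp⟩)) •
        (Pi.single ⟨p.1 (S.head t i), whiteCell_lt p _⟩ 1 : Fin m → R)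
      obtain ⟨k, rfl⟩ : ∃ k, p = S.sideCell t i k := ⟨_, eq_sideCell t hp⟩
      have hk : (⟨(S.sideCell t i k).1 (S.head t i), whiteCell_lt _ _⟩ : Fin m) = k :=
        Fin.ext (sideCell_head t i k)
      rw [hk, ← hbT, hglue, hbE, ← Pi.single_smul, smul_eq_mul, mul_one]

instance : (lines R m S).IsEquivalence where

end FlagComplex

theorem mainTheorem3 (R : Type u) [DivisionRing R] (m : ℕ) (S : GluedTriangles) :
    Nonempty (FramedLocalSystem R m S ≌ LineSystem R (S.bipartiteGraph m)) :=
  ⟨(FramedLocalSystem.restriction R m S).asEquivalence.trans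
    (FlagComplex.lines R m S).asEquivalence⟩
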